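/- Setting. Let $n\ge 2$ agents be connected by an undirected connected graph $\mathcal W$ on $[n]$ with neighbourhoods $\mathcal N_i$, and let $W=(w_{ij})\in\mathbb R^{n\times n}$ be nonnegative, symmetric and stochastic ($W\mathbf 1=\mathbf 1$), with, for $i\neq j$, $w_{ij}>0$ if and only if $\{i,j\}$ is an edge. Let $\lambda_2$ be the second largest eigenvalue of $W$. Let $f_i:\mathbb R^p\to\mathbb R$, $i\in[n]$, be differentiable with $L$-Lipschitz gradient ($L>0$) and bounded below by $\underline f_i$; put $f=\frac1n\sum_i f_i$ and $f^{\inf}=\frac1n\sum_i\underline f_i$. The stochastic gradients $\nabla f_i(x;\xi_{i,k})$, $k\ge -1$, are unbiased, $\mathbb E[\nabla f_i(x;\xi_{i,k})]=\nabla f_i(x)$, with variance $\mathbb E\|\nabla f_i(x;\xi_{i,k})-\nabla f_i(x)\|^2\le\sigma^2$ ($\sigma>0$) for every $x$; the samples $\xi_{i,k}$ of an iteration are independent across agents and of all the randomness drawn before. The random compression operator $\mathcal C$ on $\mathbb R^p$ satisfies $\mathbb E[\mathcal C(x)]=x$ and $\mathbb E\|\mathcal C(x)-x\|^2\le C\|x\|^2$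 for all $x$ ($C>0$), and the randomness of each of its applications is independent of everything drawn before. Algorithm (CEDAS with constant stepsize $\eta$ and parameters $\alpha,\gamma$). Given deterministic $x_{i,-1}$ and $h_{i,0}$, set $d_{i,0}=0$, $(h_w)_{i,0}=\sum_{j\in\mathcal N_i\cup\{i\}}w_{ij}h_{j,0}$ and $x_{i,0}=x_{i,-1}-\eta\nabla f_i(x_{i,-1};\xi_{i,-1})$. For $k=0,1,\dots$ every agent $i$ computes $y_{i,k}=x_{i,k}-\eta\nabla f_i(x_{i,k};\xi_{i,k})-d_{i,k}$, $q_{i,k}=\mathcal C(y_{i,k}-h_{i,k})$, $\hat y_{i,k}=h_{i,k}+q_{i,k}$, $(\hat y_w)_{i,k}=(h_w)_{i,k}+\sum_{j\in\mathcal N_i\cup\{i\}}w_{ij}q_{j,k}$, $h_{i,k+1}=(1-\alpha)h_{i,k}+\alpha\hat y_{i,k}$, $(h_w)_{i,k+1}=(1-\alpha)(h_w)_{i,k}+\alpha(\hat y_w)_{i,k}$, $d_{i,k+1}=d_{i,k}+\frac\gamma2\big(\hat y_{i,k}-(\hat y_w)_{i,k}\big)$ and $x_{i,k+1}=x_{i,k}-\eta\nabla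 f_i(x_{i,k};\xi_{i,k})-d_{i,k+1}$. Write $\bar x_k=\frac1n\sum_i x_{i,k}$, $\mathbf x_{-1}=(x_{1,-1},\dots,x_{n,-1})^\top$, $H_0=(h_{1,0},\dots,h_{n,0})^\top$ and $\nabla F(\mathbf x_{-1})=(\nabla f_1(x_{1,-1}),\dots,\nabla f_n(x_{n,-1}))^\top$, with the Frobenius norm for $n\times p$ matrices. Theorem. Let $$0<\alpha\le\min\Big\{1,\frac1{12C}\Big\},\qquad 0<\gamma\le\min\Big\{\frac{\sqrt\alpha}{2\sqrt C},\ \frac12,\ \frac{\alpha^2(1-\lambda_2)}{1728\,C}\Big\},$$ and for each horizon $$K\ge\max\Big\{\frac{12L^2n}{\alpha},\ \frac{256\,nL^2}{\gamma^2(1-\lambda_2)^2}\Big\}\qquad(*)$$ run the algorithm with $\eta=\sqrt{n/K}$. For $c>0$ let the transient time $K_T^{(ncvx)}(c)$ be the least integer $K_0\ge 0$ such that $$\frac1K\sum_{t=0}^{K-1}\mathbb E\big[\|\nabla f(\bar x_t)\|^2\big]\le\frac{c}{\sqrt{nK}}\qquad\text{for all integers } K\ge K_0 \text{ satisfying } (*).$$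 Then $$K_T^{(ncvx)}=\mathcal O\left(\max\left\{\frac{n^3}{\gamma^2(1-\lambda_2)^2},\ \frac{\|\mathbf x_{-1}\|^4}{n\gamma^2(1-\lambda_2)^2},\ \frac{\|H_0\|^4}{n\gamma^2(1-\lambda_2)^2},\ \left(\frac{n\|\nabla F(\mathbf x_{-1})\|^4}{\gamma^4(1-\lambda_2)^4}\right)^{1/3}\right\}\right).$$ Precisely: for all $L,\sigma>0$ and $\Delta$ there are constants $c,c'>0$, depending only on $L$, $\sigma$ and $\Delta$, such that whenever the above holds with these $L,\sigma$ and with $f(\bar x_{-1})-f^{\inf}\le\Delta$, the transient time $K_T^{(ncvx)}(c)$ is finite and at most $c'$ times the maximum. -/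

import Mathlib

open MeasureTheory ProbabilityTheory
open scoped ENNReal

namespace CEDAS

/-- The decision space `ℝ^p` with the Euclidean norm. -/
abbrev Vec (p : ℕ) : Type := EuclideanSpace ℝ (Fin p)

/-- Stacked variables: one vector of `ℝ^p` per agent (the rows of an `n × p` matrix). -/
abbrev Stack (n p : ℕ) : Type := Fin n → Vec p

section Basic

/-- The norm of a stacked variable (the Frobenius norm of the `n × p` matrix). -/
noncomputable def stackNorm {n p : ℕ} (x : Stack n p) : ℝ :=
  Real.sqrt (∑ i, ‖x i‖ ^ 2)

/-- The average of the rows of a stacked variable. -/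
noncomputable def avg {n p : ℕ} (x : Stack n p) : Vec p :=
  (n : ℝ)⁻¹ • ∑ i, x i

/-- The average objective function `f = (1/n) ∑ f_i`. -/
noncomputable def avgFun {n p : ℕ} (f : Fin n → Vec p → ℝ) (x : Vec p) : ℝ :=
  (n : ℝ)⁻¹ * ∑ i, f i x

/-- The stacked gradient `∇F(x) = (∇f_1(x_1), …, ∇f_n(x_n))`. -/
noncomputable def stackGrad {n p : ℕ} (f : Fin n → Vec p → ℝ) (x : Stack n p) : Stack n p :=
  fun i => gradient (f i) (x i)

end Basic

section Network

/-- `W` is a mixing matrix compliant to the undirected connected graph `G`: it is nonnegative,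
symmetric and stochastic, and for `i ≠ j` the entry `W i j` is positive exactly on the edges. -/
structure IsMixingMatrix {n : ℕ} (G : SimpleGraph (Fin n)) (W : Matrix (Fin n) (Fin n) ℝ) :
    Prop where
  connected : G.Connected
  nonneg : ∀ i j, 0 ≤ W i j
  symm : W.IsSymm
  stochastic : ∀ i, ∑ j, W i j = 1
  adj_iff : ∀ i j, i ≠ j → (G.Adj i j ↔ 0 < W i j)

theorem isHermitian_of_isSymm {n : ℕ} {W : Matrix (Fin n) (Fin n) ℝ} (hW : W.IsSymm) :
    W.IsHermitian := by
  ext i j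
  simpa using hW.apply i j

/-- The second largest eigenvalue `λ₂` (with multiplicity) of a real symmetric matrix;
`eigenvalues₀` lists the eigenvalues in decreasing order, starting from index `0`. -/
noncomputable def lambdaTwo {n : ℕ} (W : Matrix (Fin n) (Fin n) ℝ) (hW : W.IsSymm)
    (hn : 2 ≤ n) : ℝ :=
  (isHermitian_of_isSymm hW).eigenvalues₀ ⟨1, by rw [Fintype.card_fin]; omega⟩

end Network

section Assumptions

/-- Every `f_i` has an `L`-Lipschitz continuous gradient and is bounded below by `flow i`. -/
structure IsSmoothBddBelow {n p : ℕ} (f : Fin n → Vec p → ℝ) (L : ℝ) (flow : Fin n → ℝ) :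
    Prop where
  differentiable : ∀ i, Differentiable ℝ (f i)
  lipschitz : ∀ i x y, ‖gradient (f i) x - gradient (f i) y‖ ≤ L * ‖x - y‖
  lower : ∀ i x, flow i ≤ f i x

/-- `g x ξ` is a stochastic gradient of `φ` at `x`, the sample `ξ` being drawn from `ν`: it is
unbiased and its variance is at most `σ²`. -/
structure IsStochasticGradient {p q : ℕ} (φ : Vec p → ℝ) (σ : ℝ)
    (g : Vec p → Vec q → Vec p) (ν : Measure (Vec q)) : Prop where
  measurable : Measurable (fun z : Vec p × Vec q => g z.1 z.2)
  integrable : ∀ x, Integrable (g x) ν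
  unbiased : ∀ x, ∫ s, g x s ∂ν = gradient φ x
  variance : ∀ x, ∫⁻ s, ‖g x s - gradient φ x‖ₑ ^ 2 ∂ν ≤ ENNReal.ofReal (σ ^ 2)

/-- The randomized operator `Q`, which sends `x` to `Q x z` with a random seed `z` drawn from
`ν`, is an unbiased compressor with parameter `C`. -/
structure IsUnbiasedCompressor {p : ℕ} {Z : Type*} [MeasurableSpace Z] (C : ℝ)
    (Q : Vec p → Z → Vec p) (ν : Measure Z) : Prop where
  measurable : Measurable (fun z : Vec p × Z => Q z.1 z.2)
  integrable : ∀ x, Integrable (Q x) ν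
  unbiased : ∀ x, ∫ z, Q x z ∂ν = x
  variance : ∀ x, ∫⁻ z, ‖Q x z - x‖ₑ ^ 2 ∂ν ≤ ENNReal.ofReal (C * ‖x‖ ^ 2)

/-- The σ-algebra generated by the gradient samples `ξ s i`, `s < a`, and the compression seeds
`ζ s i`, `s < b`. -/
@[reducible] def past {n q : ℕ} {Ω Z : Type*} [MeasurableSpace Z]
    (ξ : ℕ → Fin n → Ω → Vec q) (ζ : ℕ → Fin n → Ω → Z) (a b : ℕ) : MeasurableSpace Ω :=
  (⨆ (s : ℕ) (_ : s < a) (i : Fin n), MeasurableSpace.comap (ξ s i) inferInstance) ⊔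
    ⨆ (s : ℕ) (_ : s < b) (i : Fin n), MeasurableSpace.comap (ζ s i) inferInstance

/-- The randomness of the algorithm. The agents' gradient samples start at iteration `-1`:
`ξ t i` is the sample that agent `i` draws at iteration `t - 1`, while `ζ k i` is the seed that
agent `i` uses to compress at iteration `k`. They are drawn in the order
`ξ 0, ξ 1, ζ 0, ξ 2, ζ 1, ξ 3, ζ 2, …`. The gradient samples of an iteration are independent across
the agents and of everything drawn before; the compression seed of each agent is independent of
everything drawn before (the seeds of distinct agents at one iteration may be dependent). -/
structure IsSampling {n q : ℕ} {Ω Z : Type*} [MeasurableSpace Ω] [MeasurableSpace Z]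
    (P : Measure Ω) (ξ : ℕ → Fin n → Ω → Vec q) (ζ : ℕ → Fin n → Ω → Z) : Prop where
  measurable_grad : ∀ t i, Measurable (ξ t i)
  measurable_comp : ∀ k i, Measurable (ζ k i)
  indep_grad : ∀ t, iIndep (fun o : Option (Fin n) =>
    o.elim (past ξ ζ t (t - 1)) (fun i => MeasurableSpace.comap (ξ t i) inferInstance)) P
  indep_comp : ∀ k i, Indep (MeasurableSpace.comap (ζ k i) inferInstance)
    (past ξ ζ (k + 2) k) P

end Assumptions

section Algorithm

/-- The variables that the agents keep between two iterations. -/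
structure State (n p : ℕ) where
  x : Stack n p
  d : Stack n p
  h : Stack n p
  hw : Stack n p

open Classical in
/-- Mixing with the neighbours: `∑_{j ∈ N_i ∪ {i}} w_ij z_j`. -/
noncomputable def mix {n p : ℕ} (G : SimpleGraph (Fin n)) (W : Matrix (Fin n) (Fin n) ℝ)
    (z : Stack n p) : Stack n p :=
  fun i => ∑ j with G.Adj i j ∨ j = i, W i j • z j

/-- The output of the communication procedure. -/
structure CommOut (n p : ℕ) where
  yhat : Stack n p
  yhatw : Stack n p
  h : Stack n p
  hw : Stack n p

/-- The communication procedure `COMM(y, h, h_w, α)`, for all the agents at once; `comp i` is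
the realization of the compression operator that agent `i` uses. -/
noncomputable def comm {n p : ℕ} (G : SimpleGraph (Fin n)) (W : Matrix (Fin n) (Fin n) ℝ)
    (α : ℝ) (comp : Fin n → Vec p → Vec p) (y h hw : Stack n p) : CommOut n p :=
  let c : Stack n p := fun i => comp i (y i - h i)
  let yhat : Stack n p := fun i => h i + c i
  let yhatw : Stack n p := fun i => hw i + mix G W c i
  { yhat := yhat
    yhatw := yhatw
    h := fun i => (1 - α) • h i + α • yhat i
    hw := fun i => (1 - α) • hw i + α • yhatw i }

/-- The initialization: `d_0 = 0`, `(h_w)_0 = W h_0` and a stochastic gradient step from `x_{-1}`,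
`grad i` being the realized stochastic gradient oracle of agent `i`. -/
noncomputable def initState {n p : ℕ} (G : SimpleGraph (Fin n)) (W : Matrix (Fin n) (Fin n) ℝ)
    (η : ℝ) (grad : Fin n → Vec p → Vec p) (xinit H₀ : Stack n p) : State n p :=
  { x := fun i => xinit i - η • grad i (xinit i)
    d := 0
    h := H₀
    hw := mix G W H₀ }

/-- One iteration. -/
noncomputable def step {n p : ℕ} (G : SimpleGraph (Fin n)) (W : Matrix (Fin n) (Fin n) ℝ)
    (α γ η : ℝ) (grad comp : Fin n → Vec p → Vec p) (S : State n p) : State n p :=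
  let y : Stack n p := fun i => S.x i - η • grad i (S.x i) - S.d i
  let o := comm G W α comp y S.h S.hw
  let d : Stack n p := fun i => S.d i + (γ / 2) • (o.yhat i - o.yhatw i)
  { x := fun i => S.x i - η • grad i (S.x i) - d i
    d := d
    h := o.h
    hw := o.hw }

/-- The variables of CEDAS at iteration `k`, with the constant stepsize `η`, for the
realizations `ξ` of the gradient samples and `ζ` of the compression seeds (`ξ t` is used at
iteration `t - 1`, `ζ k` at iteration `k`). -/
noncomputable def iterate {n p q : ℕ} {Z : Type*} (G : SimpleGraph (Fin n))
    (W : Matrix (Fin n) (Fin n) ℝ) (α γ η : ℝ) (g : Fin n → Vec p → Vec q → Vec p)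
    (Q : Vec p → Z → Vec p) (xinit H₀ : Stack n p) (ξ : ℕ → Fin n → Vec q)
    (ζ : ℕ → Fin n → Z) : ℕ → State n p
  | 0 => initState G W η (fun i x => g i x (ξ 0 i)) xinit H₀
  | k + 1 => step G W α γ η (fun i x => g i x (ξ (k + 1) i)) (fun i x => Q x (ζ k i))
      (iterate G W α γ η g Q xinit H₀ ξ ζ k)

/-- `(1/K) ∑_{t=0}^{K-1} E‖∇f(x̄_t)‖²` for CEDAS run with the constant stepsize `η = √(n/K)`
(an extended nonnegative real, so that no integrability is presupposed). -/
noncomputable def meanSqGrad {n p q : ℕ} {Ω Z : Type*} [MeasurableSpace Ω]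
    (P : Measure Ω) (f : Fin n → Vec p → ℝ) (G : SimpleGraph (Fin n))
    (W : Matrix (Fin n) (Fin n) ℝ) (α γ : ℝ) (g : Fin n → Vec p → Vec q → Vec p)
    (Q : Vec p → Z → Vec p) (xinit H₀ : Stack n p) (ξ : ℕ → Fin n → Ω → Vec q)
    (ζ : ℕ → Fin n → Ω → Z) (K : ℕ) : ℝ≥0∞ :=
  (K : ℝ≥0∞)⁻¹ * ∑ t ∈ Finset.range K, ∫⁻ ω,
    ‖gradient (avgFun f) (avg (iterate G W α γ (Real.sqrt (n / K)) g Q xinit H₀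
      (fun s i => ξ s i ω) (fun s i => ζ s i ω) t).x)‖ₑ ^ 2 ∂P

/-- The transient time at level `c`, for `n` agents: the least `K₀` such that for every admissible
horizon `K ≥ K₀` the error `err K` is at most `c / √(nK)` (`⊤` if there is no such `K₀`). -/
noncomputable def transientTime (n : ℕ) (admissible : Set ℕ) (err : ℕ → ℝ≥0∞) (c : ℝ) : ℝ≥0∞ :=
  ⨅ (K₀ : ℕ) (_ : ∀ K ≥ K₀, K ∈ admissible → err K ≤ ENNReal.ofReal (c / Real.sqrt (n * K))),
    (K₀ : ℝ≥0∞)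

end Algorithm

end CEDAS

/-! Square integrable random vectors form a real Hilbert space. There, a fresh unbiased noise is a
vector orthogonal to the subspace of past-measurable vectors, and a variance bound is a norm bound.
`IsRun` expresses the algorithm in these terms, `IsTrajectory.isRun` shows that CEDAS satisfies it,
and the estimates become Hilbert space geometry.

The dual variables sum to zero, so the averaged iterate performs a stochastic gradient step, with
noise variance divided by `n`. The descent lemma then bounds `∑ ‖∇f(x̄)‖²` by the initial gap, that
noise and the accumulated consensus error.

For the consensus error, `W` is diagonalized. On a nonconstant eigenmode, put `b = (γ/2)(1 - λ)`,
let `X` be the primal coordinate and `D` the dual one, centered at its target. The unperturbed step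
multiplies `‖X‖² + (1/b - 1)‖D‖²` by exactly `1 - b` (`mode_identity`). Hence the Lyapunov function
contracts at a rate of order `β = γ(1 - λ₂)/2`, up to gradient noise, compression error and terms of
relative size `ηL/β` (`IsRun.lyap_step`).

The compression error is controlled by `C‖y - h‖²`, and `y - h` contracts at a rate of order `α`,
driven by the increments of `y` divided by `α`. Those increments depend on the dual error, whose
weight in the Lyapunov function is at least `1/(2γ)`; so they cost only `γ` times the Lyapunov
function. The feedback loop has gain of order `γ²C/α²` against the damping `β`, and the upper bound
on `γ` closes it (`compression_feedback`, `IsRun.sum_lyap_le`).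

With `η = √(n/K)` and `R = √(nK)`, an accumulated error of order `R/n` is an average error of order
`1/R`. The four entries of the maximum bound `n²`, `‖x₋₁‖²` and `‖H₀‖²` by `2βR`, and `η²‖∇F‖²` by
`4β²R`; every remaining term is then of order `R/n` (`error_le_of_horizon`). -/

namespace CEDAS

/-! ### Spectral decomposition of the mixing matrix -/

section Spectral

/-- The rows of `U` are an orthonormal eigenbasis of the stochastic symmetric matrix `W`; the row
`l₀` is constant and the eigenvalues of the other rows are at most `lam₂`. -/
structure IsSpectralFrame {n : ℕ} (W : Matrix (Fin n) (Fin n) ℝ) (U : Fin n → Fin n → ℝ)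
    (lam : Fin n → ℝ) (l₀ : Fin n) (lam₂ : ℝ) : Prop where
  complete : ∀ i j, ∑ l, U l i * U l j = if i = j then 1 else 0
  eigen : ∀ l j, ∑ i, U l i * W i j = lam l * U l j
  sum_eq_zero : ∀ l, l ≠ l₀ → ∑ i, U l i = 0
  const : ∀ i j, U l₀ i = U l₀ j
  le : ∀ l, l ≠ l₀ → lam l ≤ lam₂
  ge : ∀ l, -1 ≤ lam l

/-- Since `W` fixes the constant vector, `(1 - λ_l) ∑ᵢ U l i = 0`, so every row with eigenvalue
below one is orthogonal to constants. Completeness then expands the constant vector in the row `l₀`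
alone, which makes that row constant. The bound `-1 ≤ λ_l` comes from `∑ w_ij (u_i + u_j)² = 2 + 2
λ_l` for a unit eigenvector `u`. -/
theorem exists_isSpectralFrame {n : ℕ} {G : SimpleGraph (Fin n)} {W : Matrix (Fin n) (Fin n) ℝ}
    (hW : IsMixingMatrix G W) (hn : 2 ≤ n) (hlt : lambdaTwo W hW.symm hn < 1) :
    ∃ U lam l₀, IsSpectralFrame W U lam l₀ (lambdaTwo W hW.symm hn) := by
  have hH := isHermitian_of_isSymm hW.symm
  let b := hH.eigenvectorBasis
  let U : Fin n → Fin n → ℝ := fun l i => b l i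
  -- This is the reindexing through which `eigenvalues` is obtained from the ordered list
  -- `eigenvalues₀`; `l₀` carries the largest eigenvalue.
  let e : Fin (Fintype.card (Fin n)) ≃ Fin n := Fintype.equivOfCardEq (Fintype.card_fin _)
  let l₀ : Fin n := e ⟨0, by rw [Fintype.card_fin]; omega⟩
  have hsymm : ∀ i j, W i j = W j i := fun i j => hW.symm.apply j i
  have hnorm : ∀ l, ∑ i, U l i ^ 2 = 1 := by
    intro l
    have h := b.orthonormal.1 l
    have h2 := EuclideanSpace.real_norm_sq_eq (b l)
    rw [h] at h2
    simpa using h2.symm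
  have hcomp : ∀ i j, ∑ l, U l i * U l j = if i = j then 1 else 0 := by
    intro i j
    have h := b.sum_inner_mul_inner (EuclideanSpace.single i (1 : ℝ)) (EuclideanSpace.single j 1)
    simp only [EuclideanSpace.inner_single_left, EuclideanSpace.inner_single_right] at h
    simpa [U, Pi.single_apply, eq_comm] using h
  have heig : ∀ l j, ∑ i, U l i * W i j = hH.eigenvalues l * U l j := by
    intro l j
    have h := congrFun (hH.mulVec_eigenvectorBasis l) j
    simp only [Matrix.mulVec, dotProduct, Pi.smul_apply, smul_eq_mul] at h
    rw [← h]
    exact Finset.sum_congr rfl fun i _ => by rw [hsymm i j]; ring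
  have hle : ∀ l, l ≠ l₀ → hH.eigenvalues l ≤ lambdaTwo W hW.symm hn := by
    intro l hl
    apply hH.eigenvalues₀_antitone
    have h0 : e.symm l ≠ ⟨0, by rw [Fintype.card_fin]; omega⟩ := by
      intro h
      exact hl ((Equiv.symm_apply_eq e).1 h)
    rw [Fin.le_def]
    have : (e.symm l).val ≠ 0 := fun h => h0 (Fin.ext h)
    change 1 ≤ (e.symm l).val
    omega
  have hsum : ∀ l, l ≠ l₀ → ∑ i, U l i = 0 := by
    intro l hl
    have h : ∑ j, ∑ i, U l i * W i j = hH.eigenvalues l * ∑ j, U l j := by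
      rw [Finset.mul_sum]; exact Finset.sum_congr rfl fun j _ => heig l j
    rw [Finset.sum_comm] at h
    simp_rw [← Finset.mul_sum, hW.stochastic, mul_one] at h
    have h1 := (hle l hl).trans_lt hlt
    have : (1 - hH.eigenvalues l) * ∑ i, U l i = 0 := by linarith
    rcases mul_eq_zero.1 this with h | h
    · linarith
    · exact h
  have hmul : ∀ i, U l₀ i * ∑ j, U l₀ j = 1 := by
    intro i
    have h : ∑ j, ∑ l, U l i * U l j = 1 := by simp [hcomp]
    rw [Finset.sum_comm] at h
    simp_rw [← Finset.mul_sum] at h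
    rw [Finset.sum_eq_single l₀] at h
    · exact h
    · intro l _ hl
      rw [hsum l hl, mul_zero]
    · simp
  refine ⟨U, hH.eigenvalues, l₀, hcomp, heig, hsum, ?_, hle, ?_⟩
  · intro i j
    have hS : ∑ j, U l₀ j ≠ 0 := fun h => by simpa [h] using hmul i
    exact mul_right_cancel₀ hS ((hmul i).trans (hmul j).symm)
  · intro l
    have h1 : ∑ j, (∑ i, U l i * W i j) * U l j = hH.eigenvalues l := by
      simp_rw [heig, mul_assoc, ← Finset.mul_sum]
      have := hnorm l
      simp_rw [pow_two] at this
      rw [this, mul_one]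
    have h2 : 0 ≤ ∑ j, ∑ i, W i j * (U l i + U l j) ^ 2 :=
      Finset.sum_nonneg fun j _ => Finset.sum_nonneg fun i _ =>
        mul_nonneg (hW.nonneg i j) (sq_nonneg _)
    have h3 : ∑ j, ∑ i, W i j * (U l i + U l j) ^ 2
        = (∑ j, ∑ i, W i j * U l i ^ 2) + (∑ j, ∑ i, W i j * U l j ^ 2)
          + 2 * ∑ j, (∑ i, U l i * W i j) * U l j := by
      rw [Finset.mul_sum, ← Finset.sum_add_distrib, ← Finset.sum_add_distrib]
      refine Finset.sum_congr rfl fun j _ => ?_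
      rw [Finset.sum_mul, Finset.mul_sum, ← Finset.sum_add_distrib, ← Finset.sum_add_distrib]
      exact Finset.sum_congr rfl fun i _ => by ring
    have h4 : ∑ j, ∑ i, W i j * U l j ^ 2 = 1 := by
      rw [← hnorm l]
      refine Finset.sum_congr rfl fun j _ => ?_
      rw [← Finset.sum_mul]
      simp_rw [fun i => hsymm i j, hW.stochastic, one_mul]
    have h5 : ∑ j, ∑ i, W i j * U l i ^ 2 = 1 := by
      rw [Finset.sum_comm, ← hnorm l]
      refine Finset.sum_congr rfl fun i _ => ?_
      rw [← Finset.sum_mul, hW.stochastic, one_mul]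
    linarith

end Spectral

/-! ### Coordinates of stacked vectors, Parseval, averages -/

section Transform

set_option linter.unusedSectionVars false

variable {n : ℕ} {𝓗 : Type*} [NormedAddCommGroup 𝓗] [InnerProductSpace ℝ 𝓗]

/-- The coordinates of a stack in the basis given by the rows of `U`. -/
def hat (U : Fin n → Fin n → ℝ) (u : Fin n → 𝓗) (l : Fin n) : 𝓗 := ∑ i, U l i • u i

/-- The squared norm of a stack. -/
def nsq (u : Fin n → 𝓗) : ℝ := ∑ i, ‖u i‖ ^ 2

/-- The average of a stack. -/
noncomputable def mean (u : Fin n → 𝓗) : 𝓗 := (n : ℝ)⁻¹ • ∑ i, u i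

/-- The squared norm of the coordinates of a stack other than `l₀`. -/
def dsq (U : Fin n → Fin n → ℝ) (l₀ : Fin n) (u : Fin n → 𝓗) : ℝ :=
  ∑ l ∈ Finset.univ.erase l₀, ‖hat U u l‖ ^ 2

theorem nsq_nonneg (u : Fin n → 𝓗) : 0 ≤ nsq u := Finset.sum_nonneg fun _ _ => sq_nonneg _

theorem hat_add (U : Fin n → Fin n → ℝ) (u v : Fin n → 𝓗) (l : Fin n) :
    hat U (fun i => u i + v i) l = hat U u l + hat U v l := by
  simp [hat, smul_add, Finset.sum_add_distrib]

theorem hat_sub (U : Fin n → Fin n → ℝ) (u v : Fin n → 𝓗) (l : Fin n) :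
    hat U (fun i => u i - v i) l = hat U u l - hat U v l := by
  simp [hat, smul_sub, Finset.sum_sub_distrib]

theorem hat_smul (U : Fin n → Fin n → ℝ) (c : ℝ) (u : Fin n → 𝓗) (l : Fin n) :
    hat U (fun i => c • u i) l = c • hat U u l := by
  simp [hat, Finset.smul_sum, smul_comm c]

variable {W : Matrix (Fin n) (Fin n) ℝ} {U : Fin n → Fin n → ℝ}
  {lam : Fin n → ℝ} {l₀ : Fin n} {lam₂ : ℝ}

theorem IsSpectralFrame.parseval (hU : IsSpectralFrame W U lam l₀ lam₂) (u : Fin n → 𝓗) :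
    ∑ l, ‖hat U u l‖ ^ 2 = nsq u := by
  have h : ∀ l, ‖hat U u l‖ ^ 2 = ∑ i, ∑ j, U l i * U l j * inner ℝ (u i) (u j) := by
    intro l
    rw [← real_inner_self_eq_norm_sq, hat, sum_inner]
    refine Finset.sum_congr rfl fun i _ => ?_
    rw [inner_sum]
    refine Finset.sum_congr rfl fun j _ => ?_
    rw [real_inner_smul_left, real_inner_smul_right]; ring
  simp_rw [h]
  rw [Finset.sum_comm]
  refine Finset.sum_congr rfl fun i _ => ?_
  rw [Finset.sum_comm]
  simp_rw [← Finset.sum_mul, hU.complete]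
  simp

theorem IsSpectralFrame.dsq_le_nsq (hU : IsSpectralFrame W U lam l₀ lam₂) (u : Fin n → 𝓗) :
    dsq U l₀ u ≤ nsq u := by
  rw [← hU.parseval u]
  exact Finset.sum_le_sum_of_subset_of_nonneg (Finset.erase_subset _ _)
    fun _ _ _ => sq_nonneg _

theorem dsq_nonneg (u : Fin n → 𝓗) : 0 ≤ dsq U l₀ u := Finset.sum_nonneg fun _ _ => sq_nonneg _

theorem IsSpectralFrame.hat_const (hU : IsSpectralFrame W U lam l₀ lam₂) (v : 𝓗) {l : Fin n}
    (hl : l ≠ l₀) : hat U (fun _ => v) l = 0 := by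
  rw [hat, ← Finset.sum_smul, hU.sum_eq_zero l hl, zero_smul]

theorem IsSpectralFrame.hat_mix (hU : IsSpectralFrame W U lam l₀ lam₂) (u : Fin n → 𝓗)
    (l : Fin n) :
    hat U (fun i => ∑ j, W i j • u j) l = lam l • hat U u l := by
  simp only [hat, Finset.smul_sum, smul_smul]
  rw [Finset.sum_comm]
  refine Finset.sum_congr rfl fun j _ => ?_
  rw [← Finset.sum_smul, hU.eigen]

theorem sum_sub_mean (hn : 0 < n) (u : Fin n → 𝓗) : ∑ i, (u i - mean u) = 0 := by
  have : (n : ℝ) ≠ 0 := by positivity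
  simp only [Finset.sum_sub_distrib, Finset.sum_const, Finset.card_univ, Fintype.card_fin, mean]
  rw [← Nat.cast_smul_eq_nsmul ℝ, smul_smul, mul_inv_cancel₀ this, one_smul, sub_self]

theorem IsSpectralFrame.dsq_eq_of_sum_eq_zero (hU : IsSpectralFrame W U lam l₀ lam₂)
    {u : Fin n → 𝓗} (hu : ∑ i, u i = 0) : dsq U l₀ u = nsq u := by
  rw [← hU.parseval u, dsq]
  refine Finset.sum_subset (Finset.erase_subset _ _) fun l _ hl => ?_
  have hl : l = l₀ := by simpa using hl
  subst hl
  rw [hat]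
  simp_rw [fun i => hU.const i l, ← Finset.smul_sum, hu]
  simp

/-- Subtracting the average kills the coordinate `l₀` and leaves the others unchanged. The consensus
error can therefore be studied mode by mode. -/
theorem IsSpectralFrame.nsq_sub_mean (hU : IsSpectralFrame W U lam l₀ lam₂) (u : Fin n → 𝓗) :
    nsq (fun i => u i - mean u) = dsq U l₀ u := by
  rw [← hU.dsq_eq_of_sum_eq_zero (sum_sub_mean (Fin.pos l₀) u)]
  refine Finset.sum_congr rfl fun l hl => ?_
  rw [hat_sub U u (fun _ => mean u), hU.hat_const _ (Finset.ne_of_mem_erase hl), sub_zero]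

theorem norm_mean_sq_le (u : Fin n → 𝓗) : n * ‖mean u‖ ^ 2 ≤ nsq u := by
  rcases Nat.eq_zero_or_pos n with h | hn
  · subst h; simp [nsq]
  have h0 : (0 : ℝ) < n := by exact_mod_cast hn
  have h1 : ‖∑ i, u i‖ ^ 2 ≤ n * nsq u := by
    calc ‖∑ i, u i‖ ^ 2 ≤ (∑ i, ‖u i‖) ^ 2 := by gcongr; exact norm_sum_le _ _
      _ ≤ n * nsq u := by
        simpa [nsq] using sq_sum_le_card_mul_sum_sq (s := Finset.univ) (f := fun i => ‖u i‖)
  rw [mean, norm_smul, mul_pow, norm_inv, Real.norm_natCast]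
  calc (n : ℝ) * ((n : ℝ)⁻¹ ^ 2 * ‖∑ i, u i‖ ^ 2) ≤ n * ((n : ℝ)⁻¹ ^ 2 * (n * nsq u)) := by gcongr
    _ = nsq u := by field_simp

theorem mean_add (u v : Fin n → 𝓗) : mean (fun i => u i + v i) = mean u + mean v := by
  simp [mean, Finset.sum_add_distrib]

theorem mean_sub (u v : Fin n → 𝓗) : mean (fun i => u i - v i) = mean u - mean v := by
  simp [mean, Finset.sum_sub_distrib, smul_sub]

theorem mean_smul (c : ℝ) (u : Fin n → 𝓗) : mean (fun i => c • u i) = c • mean u := by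
  simp [mean, ← Finset.smul_sum, smul_comm c]

end Transform

/-! ### One step of a single eigenmode -/

section ModeStep

set_option linter.unusedSectionVars false

variable {𝓗 : Type*} [NormedAddCommGroup 𝓗] [InnerProductSpace ℝ 𝓗]

theorem norm_add_sq_le_young (a w : 𝓗) {t : ℝ} (ht : 0 < t) :
    ‖a + w‖ ^ 2 ≤ (1 + t) * ‖a‖ ^ 2 + (1 + 1 / t) * ‖w‖ ^ 2 := by
  have h1 : ‖a + w‖ ^ 2 ≤ (‖a‖ + ‖w‖) ^ 2 := by gcongr; exact norm_add_le a w
  have h2 : 0 ≤ (t * ‖a‖ - ‖w‖) ^ 2 / t := by positivity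
  have h3 : (1 + t) * ‖a‖ ^ 2 + (1 + 1 / t) * ‖w‖ ^ 2
      = (‖a‖ + ‖w‖) ^ 2 + (t * ‖a‖ - ‖w‖) ^ 2 / t := by
    field_simp; ring
  linarith

theorem norm_sub_sq_le_young (a w : 𝓗) {t : ℝ} (ht : 0 < t) :
    ‖a - w‖ ^ 2 ≤ (1 + t) * ‖a‖ ^ 2 + (1 + 1 / t) * ‖w‖ ^ 2 := by
  simpa [sub_eq_add_neg] using norm_add_sq_le_young a (-w) ht

/-- The noisy step of one mode is, up to the noise, a rotation scaled by `√(1 - b)`. -/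
theorem mode_identity {b : ℝ} (hb : b ≠ 0) (Y D s e : 𝓗)
    (hsY : inner ℝ s Y = 0) (hsD : inner ℝ s D = 0)
    (heY : inner ℝ e Y = 0) (heD : inner ℝ e D = 0) (hes : inner ℝ e s = 0) :
    ‖(1 - b) • (Y - D - s) - b • e‖ ^ 2
        + (1 / b - 1) * ‖D + b • (Y - D - s) + b • e‖ ^ 2
      = (1 - b) * ‖Y‖ ^ 2 + (1 - b) * ‖s‖ ^ 2 + (1 - b) * ((1 / b - 1) * ‖D‖ ^ 2)
        + b * ‖e‖ ^ 2 := by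
  simp only [← real_inner_self_eq_norm_sq, inner_add_left, inner_add_right, inner_sub_left,
    inner_sub_right, real_inner_smul_left, real_inner_smul_right, hsY, hsD, heY, heD, hes,
    real_inner_comm s Y, real_inner_comm s D, real_inner_comm e Y, real_inner_comm e D,
    real_inner_comm e s, real_inner_comm Y D]
  field_simp
  ring

/-- The roles are: `X` consensus error, `D` dual error, `r` gradient mismatch, `s` gradient noise,
`e` compression error, `w` drift of the dual target. The mismatch is merged with `X` before
`mode_identity` is applied; `r` and `w` are then split off by Young's inequality with parameter `β /
4`, which costs only part of the contraction. The factor `1/b - 1 ≤ 1/β` in front of `D` produces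
the `β⁻²` of the drift term. -/
theorem mode_step {b β γ : ℝ} (hβ : 0 < β) (hβb : β ≤ b) (hbγ : b ≤ γ) (hγ : γ ≤ 1 / 2)
    (X D r s e w : 𝓗)
    (hsX : inner ℝ s X = 0) (hsD : inner ℝ s D = 0) (hsr : inner ℝ s r = 0)
    (heX : inner ℝ e X = 0) (heD : inner ℝ e D = 0) (her : inner ℝ e r = 0)
    (hes : inner ℝ e s = 0) :
    ‖(1 - b) • (X - D - r - s) - b • e‖ ^ 2
        + (1 / b - 1) * ‖D + b • (X - D - r - s) + b • e + w‖ ^ 2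
      ≤ (1 + β / 4) * ((1 - 3 * β / 4) * (‖X‖ ^ 2 + (1 / b - 1) * ‖D‖ ^ 2) + 5 / β * ‖r‖ ^ 2
          + ‖s‖ ^ 2 + γ * ‖e‖ ^ 2) + 5 / β ^ 2 * ‖w‖ ^ 2 := by
  have hb : 0 < b := hβ.trans_le hβb
  have hre : X - D - r - s = (X - r) - D - s := by abel
  rw [hre]
  set A := D + b • ((X - r) - D - s) + b • e with hA
  set A' := (1 - b) • ((X - r) - D - s) - b • e with hA'
  have hid := mode_identity hb.ne' (X - r) D s e (by rw [inner_sub_right, hsX, hsr, sub_zero])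
    hsD (by rw [inner_sub_right, heX, her, sub_zero]) heD hes
  rw [← hA, ← hA'] at hid
  have hb1 : 1 ≤ 1 / b := by rw [le_div_iff₀ hb]; linarith
  have hw := norm_add_sq_le_young A w (t := β / 4) (by positivity)
  have hY := norm_sub_sq_le_young X r (t := β / 4) (by positivity)
  have h4 : 1 + 1 / (β / 4) ≤ 5 / β := by
    rw [div_div_eq_mul_div, one_mul, ← sub_nonneg]
    have : 5 / β - (1 + 4 / β) = (1 - β) / β := by field_simp; ring
    rw [this]; apply div_nonneg <;> linarith
  have hinv : 1 / b - 1 ≤ 1 / β := by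
    have : 1 / b ≤ 1 / β := one_div_le_one_div_of_le hβ hβb
    linarith
  have e1 : (1 / b - 1) * ‖A + w‖ ^ 2
      ≤ (1 + β / 4) * ((1 / b - 1) * ‖A‖ ^ 2) + 5 / β ^ 2 * ‖w‖ ^ 2 := by
    have i1 : (1 / b - 1) * ‖A + w‖ ^ 2
        ≤ (1 / b - 1) * ((1 + β / 4) * ‖A‖ ^ 2 + 5 / β * ‖w‖ ^ 2) := by
      refine mul_le_mul_of_nonneg_left (hw.trans ?_) (by linarith)
      gcongr
    have i2 : (1 / b - 1) * (5 / β * ‖w‖ ^ 2) ≤ 1 / β * (5 / β * ‖w‖ ^ 2) := by gcongr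
    have i3 : 1 / β * (5 / β * ‖w‖ ^ 2) = 5 / β ^ 2 * ‖w‖ ^ 2 := by field_simp
    linarith
  have e2 : ‖A'‖ ^ 2 ≤ (1 + β / 4) * ‖A'‖ ^ 2 :=
    le_mul_of_one_le_left (sq_nonneg _) (by linarith)
  have e3 : (1 - b) * ‖X - r‖ ^ 2 ≤ (1 - 3 * β / 4) * ‖X‖ ^ 2 + 5 / β * ‖r‖ ^ 2 := by
    have i1 : (1 - b) * ‖X - r‖ ^ 2 ≤ (1 - β) * ((1 + β / 4) * ‖X‖ ^ 2 + 5 / β * ‖r‖ ^ 2) := by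
      refine mul_le_mul (by linarith) (hY.trans ?_) (sq_nonneg _) (by linarith)
      gcongr
    have i2 : 0 ≤ β * (5 / β * ‖r‖ ^ 2) := by positivity
    have i3 : 0 ≤ β ^ 2 / 4 * ‖X‖ ^ 2 := by positivity
    generalize 5 / β * ‖r‖ ^ 2 = R at *
    linarith
  have e4 : (1 - b) * ((1 / b - 1) * ‖D‖ ^ 2) ≤ (1 - 3 * β / 4) * ((1 / b - 1) * ‖D‖ ^ 2) := by
    apply mul_le_mul_of_nonneg_right (by linarith)
    exact mul_nonneg (by linarith) (sq_nonneg _)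
  have e5 : (1 - b) * ‖s‖ ^ 2 ≤ ‖s‖ ^ 2 :=
    mul_le_of_le_one_left (sq_nonneg _) (by linarith)
  have e6 : b * ‖e‖ ^ 2 ≤ γ * ‖e‖ ^ 2 := by gcongr
  have e7 : ‖A'‖ ^ 2 + (1 / b - 1) * ‖A‖ ^ 2
      ≤ (1 - 3 * β / 4) * (‖X‖ ^ 2 + (1 / b - 1) * ‖D‖ ^ 2) + 5 / β * ‖r‖ ^ 2
          + ‖s‖ ^ 2 + γ * ‖e‖ ^ 2 := by linarith
  have e8 := mul_le_mul_of_nonneg_left e7 (show 0 ≤ 1 + β / 4 by linarith)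
  linarith

end ModeStep

/-! ### Contraction of the consensus and dual errors -/

section Run

set_option linter.unusedSectionVars false

variable {n : ℕ} {𝓗 : Type*} [NormedAddCommGroup 𝓗] [InnerProductSpace ℝ 𝓗]

/-- A trajectory of CEDAS in a Hilbert space of square integrable random vectors: `gr` are the
gradients at the local iterates, `gb` those at the averaged iterate, `s` the gradient noise and `e`
the compression error. The noises are orthogonal to what was drawn before, which is
represented by the submodules `𝓐 k` (before the gradient sample) and `𝓑 k` (before compression). -/
structure IsRun (W : Matrix (Fin n) (Fin n) ℝ) (α γ η L σ C : ℝ)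
    (x d h y gr gb s e : ℕ → Fin n → 𝓗) (𝓐 𝓑 : ℕ → Submodule ℝ 𝓗) : Prop where
  y_eq : ∀ k i, y k i = x k i - η • (gr k i + s k i) - d k i
  d_zero : ∀ i, d 0 i = 0
  d_succ : ∀ k i, d (k + 1) i
    = d k i + (γ / 2) • ((y k i + e k i) - ∑ j, W i j • (y k j + e k j))
  x_succ : ∀ k i, x (k + 1) i = y k i + d k i - d (k + 1) i
  h_succ : ∀ k i, h (k + 1) i = h k i + α • (y k i + e k i - h k i)
  lip : ∀ k i, ‖gr k i - gb k i‖ ≤ L * ‖x k i - mean (x k)‖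
  lip_mean : ∀ k i, ‖gb (k + 1) i - gb k i‖ ≤ L * ‖mean (x (k + 1)) - mean (x k)‖
  x_mem : ∀ k i, x k i ∈ 𝓐 k
  d_mem : ∀ k i, d k i ∈ 𝓐 k
  gr_mem : ∀ k i, gr k i ∈ 𝓐 k
  gb_mem : ∀ k i, gb k i ∈ 𝓐 k
  s_orth : ∀ k i, ∀ v ∈ 𝓐 k, inner ℝ (s k i) v = 0
  s_pair : ∀ k i j, i ≠ j → inner ℝ (s k i) (s k j) = 0
  s_sq : ∀ k i, ‖s k i‖ ^ 2 ≤ σ ^ 2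
  le : ∀ k, 𝓐 k ≤ 𝓑 k
  s_mem : ∀ k i, s k i ∈ 𝓑 k
  h_mem : ∀ k i, h k i ∈ 𝓑 k
  e_orth : ∀ k i, ∀ v ∈ 𝓑 k, inner ℝ (e k i) v = 0
  e_sq : ∀ k i, ‖e k i‖ ^ 2 ≤ C * ‖y k i - h k i‖ ^ 2

/-- The dual variable, centered at its target. -/
noncomputable def dual (η : ℝ) (d gb : Fin n → 𝓗) (i : Fin n) : 𝓗 :=
  d i + η • (gb i - mean gb)

/-- The eigenvalues of `(γ/2)(I - W)`. -/
noncomputable def rate (γ : ℝ) (lam : Fin n → ℝ) (l : Fin n) : ℝ := γ / 2 * (1 - lam l)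

/-- The Lyapunov function of the consensus and dual errors. -/
noncomputable def lyap (U : Fin n → Fin n → ℝ) (lam : Fin n → ℝ) (l₀ : Fin n) (γ η : ℝ)
    (x d gb : Fin n → 𝓗) : ℝ :=
  ∑ l ∈ Finset.univ.erase l₀,
    (‖hat U x l‖ ^ 2 + (1 / rate γ lam l - 1) * ‖hat U (dual η d gb) l‖ ^ 2)

theorem inner_hat_of_forall {U : Fin n → Fin n → ℝ} {s : Fin n → 𝓗} {v : 𝓗}
    (h : ∀ i, inner ℝ (s i) v = 0) (l : Fin n) : inner ℝ (hat U s l) v = 0 := by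
  simp [hat, sum_inner, real_inner_smul_left, h]

theorem inner_mean_of_forall {s : Fin n → 𝓗} {v : 𝓗}
    (h : ∀ i, inner ℝ (s i) v = 0) : inner ℝ (mean s) v = 0 := by
  simp [mean, sum_inner, real_inner_smul_left, h]

theorem hat_mem {U : Fin n → Fin n → ℝ} {M : Submodule ℝ 𝓗} {u : Fin n → 𝓗}
    (h : ∀ i, u i ∈ M) (l : Fin n) : hat U u l ∈ M :=
  M.sum_mem fun i _ => M.smul_mem _ (h i)

theorem mean_mem {M : Submodule ℝ 𝓗} {u : Fin n → 𝓗} (h : ∀ i, u i ∈ M) : mean u ∈ M :=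
  M.smul_mem _ (M.sum_mem fun i _ => h i)

/-- The variance of the average of uncorrelated noises. -/
theorem norm_mean_sq_le_of_orthogonal (hn : 0 < n) {s : Fin n → 𝓗} {v : ℝ}
    (hp : ∀ i j, i ≠ j → inner ℝ (s i) (s j) = 0) (hs : ∀ i, ‖s i‖ ^ 2 ≤ v) :
    ‖mean s‖ ^ 2 ≤ v / n := by
  have h0 : (0 : ℝ) < n := by exact_mod_cast hn
  have h1 : ‖∑ i, s i‖ ^ 2 = ∑ i, ‖s i‖ ^ 2 := by
    rw [← real_inner_self_eq_norm_sq, sum_inner]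
    refine Finset.sum_congr rfl fun i _ => ?_
    rw [inner_sum, Finset.sum_eq_single i, real_inner_self_eq_norm_sq]
    · exact fun j _ hj => hp i j hj.symm
    · simp
  have h2 : ∑ i, ‖s i‖ ^ 2 ≤ n * v := by
    simpa using Finset.sum_le_sum (s := Finset.univ) fun i _ => hs i
  rw [mean, norm_smul, mul_pow, norm_inv, Real.norm_natCast, h1]
  calc (n : ℝ)⁻¹ ^ 2 * ∑ i, ‖s i‖ ^ 2 ≤ (n : ℝ)⁻¹ ^ 2 * (n * v) := by gcongr
    _ = v / n := by field_simp

theorem norm_sub_sq_le_two (a b : 𝓗) : ‖a - b‖ ^ 2 ≤ 2 * ‖a‖ ^ 2 + 2 * ‖b‖ ^ 2 := by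
  have := norm_sub_sq_le_young a b one_pos
  norm_num at this
  exact this

theorem norm_add_sq_le_two (a b : 𝓗) : ‖a + b‖ ^ 2 ≤ 2 * ‖a‖ ^ 2 + 2 * ‖b‖ ^ 2 := by
  simpa using norm_sub_sq_le_two a (-b)

variable {W : Matrix (Fin n) (Fin n) ℝ} {U : Fin n → Fin n → ℝ} {lam : Fin n → ℝ} {l₀ : Fin n}
  {lam₂ α γ η L σ C β : ℝ} {x d h y gr gb s e : ℕ → Fin n → 𝓗} {𝓐 𝓑 : ℕ → Submodule ℝ 𝓗}

theorem IsSpectralFrame.le_rate (hU : IsSpectralFrame W U lam l₀ lam₂) (hγ : 0 ≤ γ)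
    {l : Fin n} (hl : l ≠ l₀) : γ * (1 - lam₂) / 2 ≤ rate γ lam l := by
  have := hU.le l hl
  rw [rate]
  nlinarith

theorem IsSpectralFrame.rate_le (hU : IsSpectralFrame W U lam l₀ lam₂) (hγ : 0 ≤ γ)
    (l : Fin n) : rate γ lam l ≤ γ := by
  have := hU.ge l
  rw [rate]
  nlinarith

theorem dsq_le_lyap (hU : IsSpectralFrame W U lam l₀ lam₂) (hβ : 0 < γ * (1 - lam₂) / 2)
    (hγ0 : 0 < γ) (hγ : γ ≤ 1 / 2) (x d gb : Fin n → 𝓗) :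
    dsq U l₀ x ≤ lyap U lam l₀ γ η x d gb := by
  refine Finset.sum_le_sum fun l hl => ?_
  have h1 := hU.le_rate hγ0.le (Finset.ne_of_mem_erase hl)
  have h2 := hU.rate_le hγ0.le l
  have : 1 ≤ 1 / rate γ lam l := by rw [le_div_iff₀ (hβ.trans_le h1)]; linarith
  have := mul_nonneg (sub_nonneg.2 this) (sq_nonneg ‖hat U (dual η d gb) l‖)
  linarith

theorem lyap_nonneg (hU : IsSpectralFrame W U lam l₀ lam₂) (hβ : 0 < γ * (1 - lam₂) / 2)
    (hγ0 : 0 < γ) (hγ : γ ≤ 1 / 2) (x d gb : Fin n → 𝓗) :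
    0 ≤ lyap U lam l₀ γ η x d gb :=
  (dsq_nonneg x).trans (dsq_le_lyap hU hβ hγ0 hγ x d gb)

/-- Because `b ≤ γ ≤ 1/2`, the weight `1/b - 1` is at least `1/(2γ)`. The factor `γ` gained here is
what later closes the compression feedback. -/
theorem nsq_dual_le_lyap (hU : IsSpectralFrame W U lam l₀ lam₂) (hβ : 0 < γ * (1 - lam₂) / 2)
    (hγ0 : 0 < γ) (hγ : γ ≤ 1 / 2) (x d gb : Fin n → 𝓗) (hd : ∑ i, d i = 0) :
    nsq (dual η d gb) ≤ 2 * γ * lyap U lam l₀ γ η x d gb := by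
  have h0 : ∑ i, dual η d gb i = 0 := by
    simp only [dual]
    rw [Finset.sum_add_distrib, hd, ← Finset.smul_sum, sum_sub_mean (Fin.pos l₀)]
    simp
  rw [← hU.dsq_eq_of_sum_eq_zero h0, dsq, lyap, Finset.mul_sum]
  refine Finset.sum_le_sum fun l hl => ?_
  have h1 := hU.le_rate hγ0.le (Finset.ne_of_mem_erase hl)
  have h2 := hU.rate_le hγ0.le l
  have h3 : 1 / γ ≤ 1 / rate γ lam l := one_div_le_one_div_of_le (hβ.trans_le h1) h2
  have h4 : 1 ≤ 2 * γ * (1 / rate γ lam l - 1) := by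
    have : 1 / γ * γ = 1 := by field_simp
    nlinarith
  have h5 := mul_le_mul_of_nonneg_right h4 (sq_nonneg ‖hat U (dual η d gb) l‖)
  have h6 : 0 ≤ 2 * γ * ‖hat U x l‖ ^ 2 := by positivity
  linarith

namespace IsRun

variable (R : IsRun W α γ η L σ C x d h y gr gb s e 𝓐 𝓑)
include R

theorem y_mem (k : ℕ) (i : Fin n) : y k i ∈ 𝓑 k := by
  rw [R.y_eq]
  exact (𝓑 k).sub_mem ((𝓑 k).sub_mem (R.le k (R.x_mem k i)) ((𝓑 k).smul_mem _
    ((𝓑 k).add_mem (R.le k (R.gr_mem k i)) (R.s_mem k i)))) (R.le k (R.d_mem k i))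

theorem sum_d_eq_zero (hW : ∀ i, ∑ j, W i j = 1) (hs : ∀ i j, W i j = W j i) (k : ℕ) :
    ∑ i, d k i = 0 := by
  induction k with
  | zero => simp [R.d_zero]
  | succ k ih =>
    have h1 : ∑ i, ∑ j, W i j • (y k j + e k j) = ∑ j, (y k j + e k j) := by
      rw [Finset.sum_comm]
      refine Finset.sum_congr rfl fun j _ => ?_
      rw [← Finset.sum_smul]
      simp_rw [fun i => hs i j, hW, one_smul]
    simp_rw [R.d_succ, Finset.sum_add_distrib, ih, ← Finset.smul_sum, Finset.sum_sub_distrib, h1]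
    simp [Finset.sum_add_distrib]

/-- Columns of `W` sum to one, so mixing and compression are invisible in the average: it makes a
plain stochastic gradient step, with gradients taken at the local iterates. -/
theorem mean_x_succ (hW : ∀ i, ∑ j, W i j = 1) (hs : ∀ i j, W i j = W j i) (k : ℕ) :
    mean (x (k + 1)) - mean (x k) = -(η • (mean (gr k) + mean (s k))) := by
  have h1 : ∑ i, x (k + 1) i = ∑ i, x k i - η • (∑ i, gr k i + ∑ i, s k i) := by
    simp_rw [R.x_succ, R.y_eq, Finset.sum_sub_distrib, Finset.sum_add_distrib,
      Finset.sum_sub_distrib, R.sum_d_eq_zero hW hs, ← Finset.smul_sum, Finset.sum_add_distrib]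
    simp
  simp only [mean, h1]
  module

theorem norm_mean_gr_sub_sq (hU : IsSpectralFrame W U lam l₀ lam₂) (k : ℕ) :
    n * ‖mean (gr k) - mean (gb k)‖ ^ 2 ≤ L ^ 2 * dsq U l₀ (x k) := by
  rw [← mean_sub, ← hU.nsq_sub_mean]
  refine (norm_mean_sq_le _).trans ?_
  rw [nsq, nsq, Finset.mul_sum]
  refine Finset.sum_le_sum fun i _ => ?_
  rw [← mul_pow]
  exact pow_le_pow_left₀ (norm_nonneg _) (R.lip k i) 2

theorem nsq_gr_sub (hU : IsSpectralFrame W U lam l₀ lam₂) (k : ℕ) :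
    nsq (fun i => gr k i - gb k i) ≤ L ^ 2 * dsq U l₀ (x k) := by
  rw [← hU.nsq_sub_mean, nsq, nsq, Finset.mul_sum]
  refine Finset.sum_le_sum fun i _ => ?_
  rw [← mul_pow]
  exact pow_le_pow_left₀ (norm_nonneg _) (R.lip k i) 2

theorem nsq_s (k : ℕ) : nsq (s k) ≤ n * σ ^ 2 := by
  simpa [nsq] using Finset.sum_le_sum (s := Finset.univ) fun i _ => R.s_sq k i

theorem nsq_e (k : ℕ) : nsq (e k) ≤ C * nsq (fun i => y k i - h k i) := by
  rw [nsq, nsq, Finset.mul_sum]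
  exact Finset.sum_le_sum fun i _ => R.e_sq k i

theorem norm_mean_gr_add_sq (k : ℕ) (hn : 0 < n) :
    ‖mean (gr k) + mean (s k)‖ ^ 2 ≤ ‖mean (gr k)‖ ^ 2 + σ ^ 2 / n := by
  have h1 := norm_mean_sq_le_of_orthogonal hn (R.s_pair k) (R.s_sq k)
  have h2 : inner ℝ (mean (gr k)) (mean (s k)) = 0 := by
    rw [real_inner_comm]
    exact inner_mean_of_forall fun i => R.s_orth k i _ (mean_mem (R.gr_mem k))
  rw [norm_add_sq_real, h2]
  linarith

/-- The drift of the gradients at the averaged iterate. -/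
theorem nsq_drift (hU : IsSpectralFrame W U lam l₀ lam₂) (hW : ∀ i, ∑ j, W i j = 1)
    (hs : ∀ i j, W i j = W j i) (k : ℕ) :
    nsq (fun i => gb (k + 1) i - gb k i)
      ≤ L ^ 2 * η ^ 2 * (2 * n * ‖mean (gb k)‖ ^ 2 + 2 * L ^ 2 * dsq U l₀ (x k) + σ ^ 2) := by
  have hn : 0 < n := Fin.pos l₀
  have hn' : (0 : ℝ) < n := by exact_mod_cast hn
  have h1 : nsq (fun i => gb (k + 1) i - gb k i)
      ≤ n * (L * ‖mean (x (k + 1)) - mean (x k)‖) ^ 2 := by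
    have := Finset.sum_le_sum (s := Finset.univ) fun i _ =>
      pow_le_pow_left₀ (norm_nonneg _) (R.lip_mean k i) 2
    simpa [nsq] using this
  refine h1.trans ?_
  rw [R.mean_x_succ hW hs, norm_neg, norm_smul, mul_pow, mul_pow, Real.norm_eq_abs, sq_abs]
  have h2 := R.norm_mean_gr_add_sq k hn
  have h3 : ‖mean (gr k)‖ ^ 2 ≤ 2 * ‖mean (gr k) - mean (gb k)‖ ^ 2 + 2 * ‖mean (gb k)‖ ^ 2 := by
    simpa using norm_add_sq_le_two (mean (gr k) - mean (gb k)) (mean (gb k))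
  have h4 := R.norm_mean_gr_sub_sq hU k
  have h5 : n * ‖mean (gr k) + mean (s k)‖ ^ 2
      ≤ 2 * n * ‖mean (gb k)‖ ^ 2 + 2 * L ^ 2 * dsq U l₀ (x k) + σ ^ 2 := by
    have : (n : ℝ) * (σ ^ 2 / n) = σ ^ 2 := by field_simp
    nlinarith
  have h6 := mul_le_mul_of_nonneg_left h5 (show 0 ≤ L ^ 2 * η ^ 2 by positivity)
  linarith

/-- The frame decouples the run into modes obeying `mode_step`; summing over the modes other than
`l₀` turns coordinates into norms. The movement of the dual target is kept as a separate term, to be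
bounded by `nsq_drift`. -/
theorem lyap_step_le_drift (hU : IsSpectralFrame W U lam l₀ lam₂)
    (hβ : β = γ * (1 - lam₂) / 2) (hβ0 : 0 < β) (hγ0 : 0 < γ) (hγ : γ ≤ 1 / 2) (k : ℕ) :
    lyap U lam l₀ γ η (x (k + 1)) (d (k + 1)) (gb (k + 1))
      ≤ (1 + β / 4) * ((1 - 3 * β / 4) * lyap U lam l₀ γ η (x k) (d k) (gb k)
          + 5 / β * (η ^ 2 * (L ^ 2 * dsq U l₀ (x k))) + η ^ 2 * (n * σ ^ 2)
          + γ * (C * nsq (fun i => y k i - h k i)))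
        + 5 / β ^ 2 * (η ^ 2 * nsq (fun i => gb (k + 1) i - gb k i)) := by
  have hmode : ∀ l ∈ Finset.univ.erase l₀,
      ‖hat U (x (k + 1)) l‖ ^ 2 + (1 / rate γ lam l - 1)
          * ‖hat U (dual η (d (k + 1)) (gb (k + 1))) l‖ ^ 2
      ≤ (1 + β / 4) * ((1 - 3 * β / 4) * (‖hat U (x k) l‖ ^ 2
            + (1 / rate γ lam l - 1) * ‖hat U (dual η (d k) (gb k)) l‖ ^ 2)
          + 5 / β * (η ^ 2 * ‖hat U (fun i => gr k i - gb k i) l‖ ^ 2)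
          + η ^ 2 * ‖hat U (s k) l‖ ^ 2 + γ * ‖hat U (e k) l‖ ^ 2)
        + 5 / β ^ 2 * (η ^ 2 * ‖hat U (fun i => gb (k + 1) i - gb k i) l‖ ^ 2) := by
    intro l hl
    have hl' := Finset.ne_of_mem_erase hl
    have hdual : ∀ k, hat U (dual η (d k) (gb k)) l = hat U (d k) l + η • hat U (gb k) l := by
      intro k
      unfold dual
      rw [hat_add, hat_smul, hat_sub U (gb k) (fun _ => mean (gb k)), hU.hat_const _ hl', sub_zero]
    -- The part `η • gb` of the gradient step is absorbed by the centered dual variable, so only the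
    -- mismatch `gr - gb` and the noises perturb the mode.
    have hy : hat U (y k) l = hat U (x k) l - hat U (dual η (d k) (gb k)) l
        - η • hat U (fun i => gr k i - gb k i) l - η • hat U (s k) l := by
      rw [show y k = fun i => x k i - η • (gr k i + s k i) - d k i from funext (R.y_eq k),
        hat_sub, hat_sub, hat_smul, hat_add, hat_sub, hdual]
      module
    have hd : hat U (d (k + 1)) l = hat U (d k) l
        + rate γ lam l • hat U (y k) l + rate γ lam l • hat U (e k) l := by
      rw [show d (k + 1) = _ from funext (R.d_succ k), hat_add, hat_smul, hat_sub,
        hU.hat_mix (fun j => y k j + e k j), hat_add, rate]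
      module
    have hD : hat U (dual η (d (k + 1)) (gb (k + 1))) l = hat U (dual η (d k) (gb k)) l
        + rate γ lam l • hat U (y k) l + rate γ lam l • hat U (e k) l
        + η • hat U (fun i => gb (k + 1) i - gb k i) l := by
      rw [hdual, hdual, hd, hat_sub]
      module
    have hx : hat U (x (k + 1)) l = (1 - rate γ lam l) • hat U (y k) l
        - rate γ lam l • hat U (e k) l := by
      rw [show x (k + 1) = _ from funext (R.x_succ k), hat_sub, hat_add, hd]
      module
    have mX : hat U (x k) l ∈ 𝓐 k := hat_mem (R.x_mem k) l
    have mD : hat U (dual η (d k) (gb k)) l ∈ 𝓐 k :=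
      hat_mem (fun i => (𝓐 k).add_mem (R.d_mem k i) ((𝓐 k).smul_mem _
        ((𝓐 k).sub_mem (R.gb_mem k i) (mean_mem (R.gb_mem k))))) l
    have mr : η • hat U (fun i => gr k i - gb k i) l ∈ 𝓐 k :=
      (𝓐 k).smul_mem _ (hat_mem (fun i => (𝓐 k).sub_mem (R.gr_mem k i) (R.gb_mem k i)) l)
    have ms : η • hat U (s k) l ∈ 𝓑 k := (𝓑 k).smul_mem _ (hat_mem (R.s_mem k) l)
    have os : ∀ v ∈ 𝓐 k, inner ℝ (η • hat U (s k) l) v = 0 := fun v hv => by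
      rw [real_inner_smul_left, inner_hat_of_forall fun i => R.s_orth k i v hv, mul_zero]
    have oe : ∀ v ∈ 𝓑 k, inner ℝ (hat U (e k) l) v = 0 := fun v hv =>
      inner_hat_of_forall (fun i => R.e_orth k i v hv) l
    have key := mode_step (b := rate γ lam l) hβ0 (hβ ▸ hU.le_rate hγ0.le hl')
      (hU.rate_le hγ0.le l) hγ (hat U (x k) l) (hat U (dual η (d k) (gb k)) l)
      (η • hat U (fun i => gr k i - gb k i) l) (η • hat U (s k) l) (hat U (e k) l)
      (η • hat U (fun i => gb (k + 1) i - gb k i) l) (os _ mX) (os _ mD) (os _ mr)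
      (oe _ (R.le k mX)) (oe _ (R.le k mD)) (oe _ (R.le k mr)) (oe _ ms)
    rw [← hy, ← hx, ← hD] at key
    simpa only [norm_smul, mul_pow, Real.norm_eq_abs, sq_abs] using key
  have hsum := Finset.sum_le_sum hmode
  simp only [Finset.sum_add_distrib, ← Finset.mul_sum] at hsum
  have h1 : dsq U l₀ (fun i => gr k i - gb k i) ≤ L ^ 2 * dsq U l₀ (x k) :=
    (hU.dsq_le_nsq _).trans (R.nsq_gr_sub hU k)
  have h2 : dsq U l₀ (s k) ≤ n * σ ^ 2 := (hU.dsq_le_nsq _).trans (R.nsq_s k)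
  have h3 : dsq U l₀ (e k) ≤ C * nsq (fun i => y k i - h k i) :=
    (hU.dsq_le_nsq _).trans (R.nsq_e k)
  have h4 := hU.dsq_le_nsq (fun i => gb (k + 1) i - gb k i)
  simp only [lyap, Finset.sum_add_distrib]
  refine hsum.trans ?_
  simp only [dsq] at h1 h2 h3 h4 ⊢
  have : 0 ≤ 1 + β / 4 := by positivity
  gcongr

/-- The stepsize condition `ηL ≤ β/8` cancels the inverse powers of `β`: the mismatch costs `5/64`
of `βV`, and the drift turns into small multiples of `V`, the noise and the averaged gradient. The
product `(1 + β/4)(1 - 3β/4)` leaves enough room for a net rate `3β/8`. -/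
theorem lyap_step (hU : IsSpectralFrame W U lam l₀ lam₂)
    (hW : ∀ i, ∑ j, W i j = 1) (hs : ∀ i j, W i j = W j i)
    (hβ : β = γ * (1 - lam₂) / 2) (hβ0 : 0 < β) (hβ1 : β ≤ 1 / 2)
    (hγ0 : 0 < γ) (hγ : γ ≤ 1 / 2) (hC : 0 ≤ C) (hη : 64 * (η ^ 2 * L ^ 2) ≤ β ^ 2) (k : ℕ) :
    lyap U lam l₀ γ η (x (k + 1)) (d (k + 1)) (gb (k + 1))
      ≤ (1 - 3 * β / 8) * lyap U lam l₀ γ η (x k) (d k) (gb k)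
        + 5 / 4 * (η ^ 2 * (n * σ ^ 2)) + 9 / 8 * (γ * (C * nsq (fun i => y k i - h k i)))
        + 1 / 5 * (η ^ 2 * (n * ‖mean (gb k)‖ ^ 2)) := by
  have h1 := R.lyap_step_le_drift hU hβ hβ0 hγ0 hγ k
  have h2 := R.nsq_drift hU hW hs k
  have h3 := dsq_le_lyap (η := η) hU (hβ ▸ hβ0) hγ0 hγ (x k) (d k) (gb k)
  have hd0 : 0 ≤ dsq U l₀ (x k) := dsq_nonneg _
  have hu0 : 0 ≤ nsq (fun i => y k i - h k i) := nsq_nonneg _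
  have hn1 : (1 : ℝ) ≤ n := by exact_mod_cast Fin.pos l₀
  set V := lyap U lam l₀ γ η (x k) (d k) (gb k)
  set V' := lyap U lam l₀ γ η (x (k + 1)) (d (k + 1)) (gb (k + 1))
  set T := dsq U l₀ (x k)
  set N := nsq (fun i => gb (k + 1) i - gb k i)
  set u := nsq (fun i => y k i - h k i)
  set Φ := ‖mean (gb k)‖ ^ 2 with hΦ
  have hΦ0 : 0 ≤ Φ := sq_nonneg _
  have hV0 : 0 ≤ V := hd0.trans h3
  have a1 : 5 / β * (η ^ 2 * (L ^ 2 * T)) ≤ 5 / 64 * (β * V) := by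
    have i1 : 5 / β * (η ^ 2 * (L ^ 2 * T)) = 5 / β * ((η ^ 2 * L ^ 2) * T) := by ring
    have i2 : 5 / β * ((η ^ 2 * L ^ 2) * T) ≤ 5 / β * ((β ^ 2 / 64) * V) := by
      gcongr; linarith
    have i3 : 5 / β * ((β ^ 2 / 64) * V) = 5 / 64 * (β * V) := by field_simp
    linarith
  have a2 : 5 / β ^ 2 * (η ^ 2 * N) ≤ 5 / 64 * (2 * (η ^ 2 * (n * Φ)) + β ^ 2 / 32 * V
      + η ^ 2 * (n * σ ^ 2)) := by
    have i0 : 2 * n * Φ + 2 * L ^ 2 * T + σ ^ 2 ≤ 2 * n * Φ + 2 * L ^ 2 * V + n * σ ^ 2 := by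
      have : σ ^ 2 ≤ n * σ ^ 2 := le_mul_of_one_le_left (sq_nonneg _) hn1
      gcongr
    have i1 : η ^ 2 * N ≤ β ^ 2 / 64 * (η ^ 2 * (2 * n * Φ + 2 * L ^ 2 * V + n * σ ^ 2)) := by
      calc η ^ 2 * N ≤ η ^ 2 * (L ^ 2 * η ^ 2 * (2 * n * Φ + 2 * L ^ 2 * V + n * σ ^ 2)) := by
            gcongr; exact h2.trans (by gcongr)
        _ = (η ^ 2 * L ^ 2) * (η ^ 2 * (2 * n * Φ + 2 * L ^ 2 * V + n * σ ^ 2)) := by ring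
        _ ≤ _ := by gcongr; linarith
    have i2 : η ^ 2 * (2 * n * Φ + 2 * L ^ 2 * V + n * σ ^ 2)
        ≤ 2 * (η ^ 2 * (n * Φ)) + β ^ 2 / 32 * V + η ^ 2 * (n * σ ^ 2) := by
      have : (η ^ 2 * L ^ 2) * V ≤ (β ^ 2 / 64) * V := by gcongr; linarith
      linarith
    calc 5 / β ^ 2 * (η ^ 2 * N) ≤ 5 / β ^ 2 * (β ^ 2 / 64 *
          (2 * (η ^ 2 * (n * Φ)) + β ^ 2 / 32 * V + η ^ 2 * (n * σ ^ 2))) :=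
          mul_le_mul_of_nonneg_left (i1.trans (by gcongr)) (by positivity)
      _ = _ := by field_simp
  have hS0 : 0 ≤ η ^ 2 * (n * σ ^ 2) := by positivity
  have hF0 : 0 ≤ η ^ 2 * (n * Φ) := by positivity
  have hE0 : 0 ≤ γ * (C * u) := by positivity
  generalize η ^ 2 * (n * σ ^ 2) = S at *
  generalize η ^ 2 * (n * Φ) = F at *
  generalize γ * (C * u) = E at *
  have b1 : (1 + β / 4) * ((1 - 3 * β / 4) * V + 5 / β * (η ^ 2 * (L ^ 2 * T)) + S + E)
      ≤ (1 + β / 4) * ((1 - 3 * β / 4) * V + 5 / 64 * (β * V) + S + E) := by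
    gcongr
  have b2 : β * S ≤ 1 / 2 * S := by gcongr
  have b3 : β * E ≤ 1 / 2 * E := by gcongr
  have b4 : β ^ 2 * V ≤ β * V / 2 := by nlinarith [mul_nonneg hβ0.le hV0]
  have b5 : 0 ≤ β ^ 2 * V := by positivity
  have b6 : 0 ≤ β * V := by positivity
  linarith

end IsRun

end Run

/-! ### Compression feedback and accumulated errors -/

section RunSum

set_option linter.unusedSectionVars false

variable {n : ℕ} {𝓗 : Type*} [NormedAddCommGroup 𝓗] [InnerProductSpace ℝ 𝓗]

theorem nsq_sub_mean_le (hn : 0 < n) (u : Fin n → 𝓗) : nsq (fun i => u i - mean u) ≤ nsq u := by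
  have h : nsq (fun i => u i - mean u) = nsq u - n * ‖mean u‖ ^ 2 := by
    have h0 : (n : ℝ) ≠ 0 := by positivity
    have h1 : ∑ i, u i = (n : ℝ) • mean u := by rw [mean, smul_smul, mul_inv_cancel₀ h0, one_smul]
    simp only [nsq, norm_sub_sq_real, Finset.sum_add_distrib, Finset.sum_sub_distrib,
      ← Finset.mul_sum, ← sum_inner, h1, real_inner_smul_left, real_inner_self_eq_norm_sq]
    simp
    ring
  have : 0 ≤ (n : ℝ) * ‖mean u‖ ^ 2 := by positivity
  linarith

/-- The vectors `a` and `b` will be consecutive dual errors; Young's inequality with parameter `1 /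
2` treats `2a - b` more tightly than the four other terms. -/
theorem norm_sub_sq_le_of_decomp (a b s r m w : 𝓗) :
    ‖s + r + (2 : ℝ) • a - b + m - w‖ ^ 2
      ≤ 12 * ‖a‖ ^ 2 + 6 * ‖b‖ ^ 2
        + 8 * (‖s‖ ^ 2 + ‖r‖ ^ 2 + ‖m‖ ^ 2 + ‖w‖ ^ 2) := by
  have e : s + r + (2 : ℝ) • a - b + m - w = ((2 : ℝ) • a - b) + ((s + r) + (m - w)) := by abel
  rw [e]
  have h1 := norm_add_sq_le_two ((2 : ℝ) • a - b) ((s + r) + (m - w))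
  have h2 := norm_add_sq_le_two (s + r) (m - w)
  have h3 := norm_add_sq_le_two s r
  have h4 := norm_sub_sq_le_two m w
  have h5 := norm_sub_sq_le_young ((2 : ℝ) • a) b (t := 1 / 2) (by norm_num)
  rw [norm_smul, mul_pow] at h5
  norm_num at h5
  linarith

variable {W : Matrix (Fin n) (Fin n) ℝ} {U : Fin n → Fin n → ℝ} {lam : Fin n → ℝ} {l₀ : Fin n}
  {lam₂ α γ η L σ C β : ℝ} {x d h y gr gb s e : ℕ → Fin n → 𝓗} {𝓐 𝓑 : ℕ → Submodule ℝ 𝓗}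

namespace IsRun

variable (R : IsRun W α γ η L σ C x d h y gr gb s e 𝓐 𝓑)
include R

/-- Substituting the primal update cancels `x`, leaving `d k - 2 d (k+1)` and the new gradient step.
Rewriting `d` through its centered version shows that consensus enters only through `gr - gb`, with
the small factor `η`. -/
theorem y_succ_sub (k : ℕ) (i : Fin n) :
    y (k + 1) i - y k i = -(η • s (k + 1) i + η • (gr (k + 1) i - gb (k + 1) i)
      + (2 : ℝ) • dual η (d (k + 1)) (gb (k + 1)) i - dual η (d k) (gb k) i
      + η • mean (gb (k + 1))
      - η • ((gb (k + 1) i - gb k i) - mean fun j => gb (k + 1) j - gb k j)) := by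
  rw [R.y_eq (k + 1), R.x_succ, mean_sub, dual, dual]
  module

/-- The main constants are `12 · 2γ` and `6 · 2γ`, from `nsq_dual_le_lyap`; the stepsize condition
makes the mismatch and drift small enough to fit when these are rounded up to `25γ` and `13γ`. -/
theorem nsq_y_succ_sub (hU : IsSpectralFrame W U lam l₀ lam₂)
    (hW : ∀ i, ∑ j, W i j = 1) (hs : ∀ i j, W i j = W j i)
    (hβ : β = γ * (1 - lam₂) / 2) (hβ0 : 0 < β) (hβγ : β ≤ γ)
    (hγ0 : 0 < γ) (hγ : γ ≤ 1 / 2) (hη : 64 * (η ^ 2 * L ^ 2) ≤ β ^ 2) (k : ℕ) :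
    nsq (fun i => y (k + 1) i - y k i)
      ≤ 25 * γ * lyap U lam l₀ γ η (x (k + 1)) (d (k + 1)) (gb (k + 1))
        + 13 * γ * lyap U lam l₀ γ η (x k) (d k) (gb k) + 9 * (η ^ 2 * (n * σ ^ 2))
        + 8 * (η ^ 2 * (n * ‖mean (gb (k + 1))‖ ^ 2)) + η ^ 2 * (n * ‖mean (gb k)‖ ^ 2) := by
  have hn : 0 < n := Fin.pos l₀
  have hn1 : (1 : ℝ) ≤ n := by exact_mod_cast hn
  have hsd := R.sum_d_eq_zero hW hs
  have h1 : nsq (fun i => y (k + 1) i - y k i)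
      ≤ 12 * nsq (dual η (d (k + 1)) (gb (k + 1))) + 6 * nsq (dual η (d k) (gb k))
        + 8 * (η ^ 2 * nsq (s (k + 1)) + η ^ 2 * nsq (fun i => gr (k + 1) i - gb (k + 1) i)
          + η ^ 2 * (n * ‖mean (gb (k + 1))‖ ^ 2)
          + η ^ 2 * nsq (fun i =>
              (gb (k + 1) i - gb k i) - mean fun j => gb (k + 1) j - gb k j)) := by
    have := Finset.sum_le_sum (s := Finset.univ) fun i _ => norm_sub_sq_le_of_decomp
      (dual η (d (k + 1)) (gb (k + 1)) i) (dual η (d k) (gb k) i) (η • s (k + 1) i)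
      (η • (gr (k + 1) i - gb (k + 1) i)) (η • mean (gb (k + 1)))
      (η • ((gb (k + 1) i - gb k i) - mean fun j => gb (k + 1) j - gb k j))
    simp_rw [← norm_neg (_ - _ : 𝓗), ← R.y_succ_sub] at this
    simp only [norm_smul, mul_pow, Real.norm_eq_abs, sq_abs, Finset.sum_add_distrib,
      ← Finset.mul_sum] at this
    simpa [nsq, norm_sub_rev] using this
  have h2 := nsq_dual_le_lyap (η := η) hU (hβ ▸ hβ0) hγ0 hγ (x (k + 1)) (d (k + 1)) (gb (k + 1))
    (hsd _)
  have h3 := nsq_dual_le_lyap (η := η) hU (hβ ▸ hβ0) hγ0 hγ (x k) (d k) (gb k) (hsd _)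
  have h4 := R.nsq_s (k + 1)
  have h5 := (R.nsq_gr_sub hU (k + 1)).trans (mul_le_mul_of_nonneg_left
    (dsq_le_lyap (η := η) hU (hβ ▸ hβ0) hγ0 hγ (x (k + 1)) (d (k + 1)) (gb (k + 1)))
    (sq_nonneg L))
  have h6 := R.nsq_drift hU hW hs k
  have h7 := nsq_sub_mean_le hn (fun j => gb (k + 1) j - gb k j)
  have h8 := dsq_le_lyap (η := η) hU (hβ ▸ hβ0) hγ0 hγ (x k) (d k) (gb k)
  have h9 := lyap_nonneg (η := η) hU (hβ ▸ hβ0) hγ0 hγ (x (k + 1)) (d (k + 1)) (gb (k + 1))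
  have hd0 : 0 ≤ dsq U l₀ (x k) := dsq_nonneg _
  set V := lyap U lam l₀ γ η (x k) (d k) (gb k)
  set V' := lyap U lam l₀ γ η (x (k + 1)) (d (k + 1)) (gb (k + 1))
  set T := dsq U l₀ (x k)
  set N := nsq (fun i => gb (k + 1) i - gb k i)
  set Φ := ‖mean (gb k)‖ ^ 2 with hΦ
  set Φ' := ‖mean (gb (k + 1))‖ ^ 2 with hΦ'
  have hΦ0 : 0 ≤ Φ := sq_nonneg _
  have hV0 : 0 ≤ V := hd0.trans h8
  have hβ2 : β ^ 2 ≤ γ / 2 := by nlinarith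
  have hβ3 : β ^ 2 ≤ 1 / 4 := by nlinarith
  have b1 : η ^ 2 * nsq (fun i => gr (k + 1) i - gb (k + 1) i) ≤ γ / 128 * V' := by
    calc _ ≤ η ^ 2 * (L ^ 2 * V') := by gcongr
      _ = (η ^ 2 * L ^ 2) * V' := by ring
      _ ≤ γ / 128 * V' := by gcongr; linarith
  have b2 : η ^ 2 * nsq (fun i =>
      (gb (k + 1) i - gb k i) - mean fun j => gb (k + 1) j - gb k j)
      ≤ 1 / 128 * (η ^ 2 * (n * Φ)) + γ / 128 * V + 1 / 256 * (η ^ 2 * (n * σ ^ 2)) := by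
    have i0 : σ ^ 2 ≤ n * σ ^ 2 := le_mul_of_one_le_left (sq_nonneg _) hn1
    have i2 : (η ^ 2 * L ^ 2) * V ≤ γ / 128 * V := by gcongr; linarith
    calc _ ≤ η ^ 2 * (L ^ 2 * η ^ 2 * (2 * n * Φ + 2 * L ^ 2 * T + σ ^ 2)) := by
          gcongr; exact h7.trans h6
      _ ≤ η ^ 2 * (L ^ 2 * η ^ 2 * (2 * n * Φ + 2 * L ^ 2 * V + n * σ ^ 2)) := by gcongr
      _ = (η ^ 2 * L ^ 2) * (2 * (η ^ 2 * (n * Φ)) + 2 * ((η ^ 2 * L ^ 2) * V)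
            + η ^ 2 * (n * σ ^ 2)) := by ring
      _ ≤ 1 / 256 * (2 * (η ^ 2 * (n * Φ)) + 2 * (γ / 128 * V) + η ^ 2 * (n * σ ^ 2)) := by
          gcongr; linarith
      _ ≤ _ := by
          have : 0 ≤ γ * V := by positivity
          linarith
  have b3 : η ^ 2 * nsq (s (k + 1)) ≤ η ^ 2 * (n * σ ^ 2) := by gcongr
  have hS0 : 0 ≤ η ^ 2 * (n * σ ^ 2) := by positivity
  have hF0 : 0 ≤ η ^ 2 * (n * Φ) := by positivity
  have hV1 : 0 ≤ γ * V := by positivity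
  have hV2 : 0 ≤ γ * V' := by positivity
  linarith

/-- The new difference is `(1 - α)(y - h) - α e` plus the increment of `y`. The compression error is
orthogonal to `y - h`, and `α²C ≤ α/12` keeps its contribution below the contraction; Young's
inequality with parameter `α` separates the increment. -/
theorem nsq_y_sub_h_succ (hα0 : 0 < α) (hα1 : α ≤ 1) (hαC : 12 * (α * C) ≤ 1) (k : ℕ) :
    nsq (fun i => y (k + 1) i - h (k + 1) i)
      ≤ (1 - 5 * α / 6) * nsq (fun i => y k i - h k i)
        + 2 / α * nsq (fun i => y (k + 1) i - y k i) := by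
  rw [nsq, nsq, nsq, Finset.mul_sum, Finset.mul_sum, ← Finset.sum_add_distrib]
  refine Finset.sum_le_sum fun i _ => ?_
  have e1 : y (k + 1) i - h (k + 1) i = ((1 - α) • (y k i - h k i) - α • e k i)
      + (y (k + 1) i - y k i) := by
    rw [R.h_succ]; module
  rw [e1]
  refine (norm_add_sq_le_young _ _ hα0).trans ?_
  have h0 : inner ℝ (y k i - h k i) (e k i) = 0 := by
    rw [real_inner_comm]
    exact R.e_orth k i _ ((𝓑 k).sub_mem (R.y_mem k i) (R.h_mem k i))
  have h1 : ‖(1 - α) • (y k i - h k i) - α • e k i‖ ^ 2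
      ≤ ((1 - α) ^ 2 + α / 12) * ‖y k i - h k i‖ ^ 2 := by
    rw [norm_sub_sq_real, real_inner_smul_left, real_inner_smul_right, h0, norm_smul, norm_smul,
      mul_pow, mul_pow, Real.norm_eq_abs, Real.norm_eq_abs, sq_abs, sq_abs]
    have i1 : α ^ 2 * ‖e k i‖ ^ 2 ≤ α ^ 2 * (C * ‖y k i - h k i‖ ^ 2) := by
      gcongr; exact R.e_sq k i
    have i2 : α * (12 * (α * C)) * ‖y k i - h k i‖ ^ 2 ≤ α * 1 * ‖y k i - h k i‖ ^ 2 := by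
      gcongr
    linarith
  have h2 : 1 + 1 / α ≤ 2 / α := by
    have : 1 ≤ 1 / α := by rw [le_div_iff₀ hα0]; linarith
    have h3 : 2 / α = 1 / α + 1 / α := by ring
    linarith
  have h3 : (1 + α) * ((1 - α) ^ 2 + α / 12) ≤ 1 - 5 * α / 6 := by
    nlinarith [mul_nonneg (sq_nonneg α) (sub_nonneg.2 hα1), sq_nonneg α]
  have h4 : (1 + α) * ‖(1 - α) • (y k i - h k i) - α • e k i‖ ^ 2
      ≤ (1 - 5 * α / 6) * ‖y k i - h k i‖ ^ 2 := by
    calc _ ≤ (1 + α) * (((1 - α) ^ 2 + α / 12) * ‖y k i - h k i‖ ^ 2) := by gcongr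
      _ = ((1 + α) * ((1 - α) ^ 2 + α / 12)) * ‖y k i - h k i‖ ^ 2 := by ring
      _ ≤ _ := by gcongr
  gcongr

end IsRun

/-- Summing a contraction with forcing. -/
theorem sum_range_le_of_step {u f : ℕ → ℝ} {a : ℝ} (hu : ∀ k, 0 ≤ u k)
    (h : ∀ k, u (k + 1) ≤ (1 - a) * u k + f k) (K : ℕ) :
    a * ∑ k ∈ Finset.range K, u k ≤ u 0 + ∑ k ∈ Finset.range K, f k := by
  have : a * ∑ k ∈ Finset.range K, u k + u K ≤ u 0 + ∑ k ∈ Finset.range K, f k := by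
    induction K with
    | zero => simp
    | succ K ih =>
      rw [Finset.sum_range_succ, Finset.sum_range_succ]
      have := h K
      linarith
  linarith [hu K]

/-- The sum gains a last term without lengthening the forcing. This matters for `y - h`, whose
forcing at step `k` involves the Lyapunov function at `k + 1`, so that the indices stay in the
common range. -/
theorem sum_range_le_of_step' {u f : ℕ → ℝ} {a : ℝ} (hu : ∀ k, 0 ≤ u k) (ha : a ≤ 1)
    (h : ∀ k, u (k + 1) ≤ (1 - a) * u k + f k) (K : ℕ) :
    a * ∑ k ∈ Finset.range (K + 1), u k ≤ u 0 + ∑ k ∈ Finset.range K, f k := by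
  have : a * ∑ k ∈ Finset.range (K + 1), u k + (1 - a) * u K
      ≤ u 0 + ∑ k ∈ Finset.range K, f k := by
    induction K with
    | zero => simp; linarith
    | succ K ih =>
      rw [Finset.sum_range_succ u (K + 1), Finset.sum_range_succ f K]
      have := h K
      linarith
  have := mul_nonneg (sub_nonneg.2 ha) (hu K)
  linarith

theorem sum_range_succ_shift_le {u : ℕ → ℝ} (hu : ∀ k, 0 ≤ u k) (K : ℕ) :
    ∑ k ∈ Finset.range K, u (k + 1) ≤ ∑ k ∈ Finset.range (K + 1), u k := by
  rw [Finset.sum_range_succ']; linarith [hu 0]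

theorem sum_range_le_succ {u : ℕ → ℝ} (hu : ∀ k, 0 ≤ u k) (K : ℕ) :
    ∑ k ∈ Finset.range K, u k ≤ ∑ k ∈ Finset.range (K + 1), u k := by
  rw [Finset.sum_range_succ]; linarith [hu K]

/-- The feedback of the compression error on the consensus error. -/
theorem compression_feedback {α γ C β Q₀ SV T SQ : ℝ} (hα0 : 0 < α) (hα1 : α ≤ 1) (hγ0 : 0 < γ)
    (hC : 0 ≤ C) (hβγ : β ≤ γ) (hγα : 1728 * (γ * (γ * C)) ≤ 2 * (α ^ 2 * β))
    (hQ : 0 ≤ Q₀) (hSV : 0 ≤ SV) (hT : 0 ≤ T)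
    (h : 5 * α / 6 * SQ ≤ Q₀ + 2 / α * (38 * γ * SV + 9 * T)) :
    γ * (C * SQ) ≤ 1 / 720 * Q₀ + 12 / 5 / 864 * (38 * (β * SV) + 9 * T) := by
  have c1 : γ * C * (1728 * γ) ≤ 2 * β * α ^ 2 := by linarith
  -- Since `β ≤ γ`, one factor `γ` cancels from the smallness condition.
  have c2 : 864 * (γ * C) ≤ α ^ 2 := by
    have h1 : α ^ 2 * β ≤ α ^ 2 * γ := by gcongr
    have : γ * (864 * (γ * C)) ≤ γ * α ^ 2 := by linarith
    exact le_of_mul_le_mul_left this hγ0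
  have hγC : 0 ≤ γ * C := by positivity
  have e1 : SQ ≤ 6 / (5 * α) * Q₀ + 12 / (5 * α ^ 2) * (38 * γ * SV + 9 * T) := by
    have : SQ = 6 / (5 * α) * (5 * α / 6 * SQ) := by field_simp
    rw [this]
    calc _ ≤ 6 / (5 * α) * (Q₀ + 2 / α * (38 * γ * SV + 9 * T)) := by gcongr
      _ = _ := by field_simp; ring
  have e2 : γ * C * (6 / (5 * α) * Q₀) ≤ 1 / 720 * Q₀ := by
    rw [← mul_assoc]
    refine mul_le_mul_of_nonneg_right ?_ hQ
    rw [mul_div_assoc', div_le_iff₀ (by positivity)]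
    have : α ^ 2 ≤ α := by nlinarith
    linarith
  have e3 : γ * C * (12 / (5 * α ^ 2) * (9 * T)) ≤ 12 / 5 / 864 * (9 * T) := by
    rw [← mul_assoc]
    refine mul_le_mul_of_nonneg_right ?_ (by positivity)
    rw [mul_div_assoc', div_le_iff₀ (by positivity)]
    linarith
  -- The factor `γ` from the increments of `y` joins the `γ` multiplying the compression error,
  -- giving `γ²C/α² ≤ β/864`.
  have e4 : γ * C * (12 / (5 * α ^ 2) * (38 * γ * SV)) ≤ 12 / 5 / 864 * (38 * (β * SV)) := by
    have : γ * C * (12 / (5 * α ^ 2) * (38 * γ * SV))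
        = (γ * C * (1728 * γ)) * (12 / (5 * α ^ 2) * (38 * SV) / 1728) := by ring
    rw [this]
    calc _ ≤ (2 * β * α ^ 2) * (12 / (5 * α ^ 2) * (38 * SV) / 1728) := by gcongr
      _ = _ := by field_simp; ring
  calc γ * (C * SQ) = γ * C * SQ := by ring
    _ ≤ γ * C * (6 / (5 * α) * Q₀ + 12 / (5 * α ^ 2) * (38 * γ * SV + 9 * T)) := by gcongr
    _ ≤ _ := by linarith

/-- The decrease of a smooth function along a stochastic gradient step. -/
theorem descent_of_orthogonal {a b s : Fin n → 𝓗} {T : ℝ} (hn : 0 < n) (hη0 : 0 < η) (hL : 0 ≤ L)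
    (hηL : η * L ≤ 1) (hp : ∀ i j, i ≠ j → inner ℝ (s i) (s j) = 0)
    (hs : ∀ i, ‖s i‖ ^ 2 ≤ σ ^ 2) (hb : ∀ i, inner ℝ (s i) (mean b) = 0)
    (ha : ∀ i, inner ℝ (s i) (mean a) = 0)
    (hab : n * ‖mean a - mean b‖ ^ 2 ≤ L ^ 2 * T) :
    inner ℝ (mean b) (-(η • (mean a + mean s))) + L / 2 * ‖-(η • (mean a + mean s))‖ ^ 2
      ≤ - (η / 2 * ‖mean b‖ ^ 2) + η * L ^ 2 / (2 * n) * T + L * η ^ 2 * σ ^ 2 / (2 * n) := by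
  have hn' : (0 : ℝ) < n := by exact_mod_cast hn
  have h0 : inner ℝ (mean b) (mean s) = 0 := by
    rw [real_inner_comm]; exact inner_mean_of_forall hb
  have h1 : inner ℝ (mean a) (mean s) = 0 := by
    rw [real_inner_comm]; exact inner_mean_of_forall ha
  have h2 : ‖mean a + mean s‖ ^ 2 ≤ ‖mean a‖ ^ 2 + σ ^ 2 / n := by
    have := norm_mean_sq_le_of_orthogonal hn hp hs
    rw [norm_add_sq_real, h1]
    linarith
  have h3 : ‖mean a - mean b‖ ^ 2 ≤ L ^ 2 / n * T := by
    rw [div_mul_eq_mul_div, le_div_iff₀ hn', mul_comm]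
    exact hab
  -- Polarization supplies `-(η/2)‖mean a‖²`, which absorbs the second-order term because `ηL ≤ 1`.
  have h4 : inner ℝ (mean b) (mean a)
      = (‖mean b‖ ^ 2 + ‖mean a‖ ^ 2 - ‖mean a - mean b‖ ^ 2) / 2 := by
    rw [norm_sub_sq_real, real_inner_comm]; ring
  rw [norm_neg, norm_smul, mul_pow, Real.norm_eq_abs, sq_abs, inner_neg_right,
    real_inner_smul_right, inner_add_right, h0, add_zero, h4]
  have h5 : L / 2 * (η ^ 2 * ‖mean a + mean s‖ ^ 2)
      ≤ L / 2 * (η ^ 2 * (‖mean a‖ ^ 2 + σ ^ 2 / n)) := by gcongr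
  have h6 : η / 2 * ‖mean a - mean b‖ ^ 2 ≤ η / 2 * (L ^ 2 / n * T) := by gcongr
  have h7 : η / 2 * (η * L) * ‖mean a‖ ^ 2 ≤ η / 2 * 1 * ‖mean a‖ ^ 2 := by gcongr
  have h8 : η / 2 * (L ^ 2 / n * T) = η * L ^ 2 / (2 * n) * T := by field_simp
  have h9 : L / 2 * (η ^ 2 * (σ ^ 2 / n)) = L * η ^ 2 * σ ^ 2 / (2 * n) := by field_simp
  linarith

namespace IsRun

variable (R : IsRun W α γ η L σ C x d h y gr gb s e 𝓐 𝓑)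
include R

/-- The accumulated consensus error. -/
theorem sum_lyap_le (hU : IsSpectralFrame W U lam l₀ lam₂)
    (hW : ∀ i, ∑ j, W i j = 1) (hs : ∀ i j, W i j = W j i)
    (hβ : β = γ * (1 - lam₂) / 2) (hβ0 : 0 < β) (hβγ : β ≤ γ)
    (hγ0 : 0 < γ) (hγ : γ ≤ 1 / 2) (hC : 0 ≤ C) (hη : 64 * (η ^ 2 * L ^ 2) ≤ β ^ 2)
    (hα0 : 0 < α) (hα1 : α ≤ 1) (hαC : 12 * (α * C) ≤ 1)
    (hγα : 1728 * (γ * (γ * C)) ≤ 2 * (α ^ 2 * β)) (K : ℕ) :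
    β / 4 * ∑ k ∈ Finset.range (K + 1), lyap U lam l₀ γ η (x k) (d k) (gb k)
      ≤ lyap U lam l₀ γ η (x 0) (d 0) (gb 0) + nsq (fun i => y 0 i - h 0 i)
        + 2 * ((K + 1) * (η ^ 2 * (n * σ ^ 2)))
        + 1 / 4 * (η ^ 2 * (n * ∑ k ∈ Finset.range (K + 1), ‖mean (gb k)‖ ^ 2)) := by
  have hβ1 : β ≤ 1 / 2 := hβγ.trans hγ
  set V : ℕ → ℝ := fun k => lyap U lam l₀ γ η (x k) (d k) (gb k) with hV
  set Q : ℕ → ℝ := fun k => nsq (fun i => y k i - h k i) with hQ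
  set F : ℕ → ℝ := fun k => η ^ 2 * (n * ‖mean (gb k)‖ ^ 2) with hF
  set S : ℝ := η ^ 2 * (n * σ ^ 2) with hS
  have hV0 : ∀ k, 0 ≤ V k := fun k => lyap_nonneg hU (hβ ▸ hβ0) hγ0 hγ _ _ _
  have hQ0 : ∀ k, 0 ≤ Q k := fun k => nsq_nonneg _
  have hF0 : ∀ k, 0 ≤ F k := fun k => by positivity
  have hS0 : 0 ≤ S := by positivity
  have hVstep : ∀ k, V (k + 1) ≤ (1 - 3 * β / 8) * V k
      + (5 / 4 * S + 9 / 8 * (γ * (C * Q k)) + 1 / 5 * F k) := fun k => by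
    have := R.lyap_step hU hW hs hβ hβ0 hβ1 hγ0 hγ hC hη k
    linarith
  have hQstep : ∀ k, Q (k + 1) ≤ (1 - 5 * α / 6) * Q k
      + 2 / α * (25 * γ * V (k + 1) + 13 * γ * V k + 9 * S + 8 * F (k + 1) + F k) := fun k => by
    refine (R.nsq_y_sub_h_succ hα0 hα1 hαC k).trans ?_
    have := R.nsq_y_succ_sub hU hW hs hβ hβ0 hβγ hγ0 hγ hη k
    gcongr
  have s1 := sum_range_le_of_step hV0 hVstep (K + 1)
  have s2 := sum_range_le_of_step' hQ0 (by linarith) hQstep K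
  simp only [Finset.sum_add_distrib, ← Finset.mul_sum, Finset.sum_const, Finset.card_range,
    nsmul_eq_mul] at s1 s2
  have hFsum : η ^ 2 * (n * ∑ k ∈ Finset.range (K + 1), ‖mean (gb k)‖ ^ 2)
      = ∑ k ∈ Finset.range (K + 1), F k := by
    simp only [hF, Finset.mul_sum]
  rw [hFsum]
  have v1 := sum_range_succ_shift_le hV0 K
  have v2 := sum_range_le_succ hV0 K
  have f1 := sum_range_succ_shift_le hF0 K
  have f2 := sum_range_le_succ hF0 K
  have hSV0 : 0 ≤ ∑ k ∈ Finset.range (K + 1), V k := Finset.sum_nonneg fun k _ => hV0 k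
  have hSQ0 : 0 ≤ ∑ k ∈ Finset.range (K + 1), Q k := Finset.sum_nonneg fun k _ => hQ0 k
  have hSF0 : 0 ≤ ∑ k ∈ Finset.range (K + 1), F k := Finset.sum_nonneg fun k _ => hF0 k
  set SV := ∑ k ∈ Finset.range (K + 1), V k
  set SQ := ∑ k ∈ Finset.range (K + 1), Q k
  set SF := ∑ k ∈ Finset.range (K + 1), F k
  push_cast at s1
  have hKS : (K : ℝ) * S ≤ (K + 1) * S := by gcongr; linarith
  have hKS0 : 0 ≤ ((K : ℝ) + 1) * S := by positivity
  set T := ((K : ℝ) + 1) * S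
  -- Both shifted sums are at most the full one, hence `38 = 25 + 13` and `9 = 8 + 1`.
  have s3 : 5 * α / 6 * SQ ≤ Q 0 + 2 / α * (38 * γ * SV + 9 * (T + SF)) := by
    have w1 := mul_le_mul_of_nonneg_left v1 hγ0.le
    have w2 := mul_le_mul_of_nonneg_left v2 hγ0.le
    exact s2.trans (add_le_add le_rfl (mul_le_mul_of_nonneg_left (by linarith) (by positivity)))
  -- The returned consensus coefficient is `(9/8)(12/5)(38/864) < 1/8`, which leaves `β/4` out of
  -- `3β/8`.
  have s4 := compression_feedback hα0 hα1 hγ0 hC hβγ hγα (hQ0 0) hSV0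
    (show 0 ≤ T + SF by positivity) s3
  have hQ00 := hQ0 0
  have hb : 0 ≤ β * SV := by positivity
  linarith

/-- The descent inequality along the averaged iterates. -/
theorem descent {φ : ℕ → ℝ} (hU : IsSpectralFrame W U lam l₀ lam₂)
    (hW : ∀ i, ∑ j, W i j = 1) (hs : ∀ i j, W i j = W j i) (hη0 : 0 < η) (hL : 0 ≤ L)
    (hηL : η * L ≤ 1)
    (hφ : ∀ k, φ (k + 1) ≤ φ k + inner ℝ (mean (gb k)) (mean (x (k + 1)) - mean (x k))
      + L / 2 * ‖mean (x (k + 1)) - mean (x k)‖ ^ 2) (k : ℕ) :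
    φ (k + 1) ≤ φ k - η / 2 * ‖mean (gb k)‖ ^ 2 + η * L ^ 2 / (2 * n) * dsq U l₀ (x k)
      + L * η ^ 2 * σ ^ 2 / (2 * n) := by
  have h1 := hφ k
  rw [R.mean_x_succ hW hs] at h1
  have h2 := descent_of_orthogonal (Fin.pos l₀) hη0 hL hηL (R.s_pair k) (R.s_sq k)
    (fun i => R.s_orth k i _ (mean_mem (R.gb_mem k)))
    (fun i => R.s_orth k i _ (mean_mem (R.gr_mem k))) (R.norm_mean_gr_sub_sq hU k)
  linarith

/-- The accumulated squared gradients at the averaged iterates. -/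
theorem sum_norm_grad_le {φ : ℕ → ℝ} {φinf : ℝ} (hU : IsSpectralFrame W U lam l₀ lam₂)
    (hW : ∀ i, ∑ j, W i j = 1) (hs : ∀ i j, W i j = W j i)
    (hβ : β = γ * (1 - lam₂) / 2) (hβ0 : 0 < β) (hβγ : β ≤ γ)
    (hγ0 : 0 < γ) (hγ : γ ≤ 1 / 2) (hC : 0 ≤ C) (hη : 64 * (η ^ 2 * L ^ 2) ≤ β ^ 2)
    (hα0 : 0 < α) (hα1 : α ≤ 1) (hαC : 12 * (α * C) ≤ 1)
    (hγα : 1728 * (γ * (γ * C)) ≤ 2 * (α ^ 2 * β)) (hη0 : 0 < η) (hL : 0 ≤ L)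
    (hφ : ∀ k, φ (k + 1) ≤ φ k + inner ℝ (mean (gb k)) (mean (x (k + 1)) - mean (x k))
      + L / 2 * ‖mean (x (k + 1)) - mean (x k)‖ ^ 2) (hinf : ∀ k, φinf ≤ φ k) (K : ℕ) :
    ∑ k ∈ Finset.range (K + 1), ‖mean (gb k)‖ ^ 2
      ≤ 4 / η * (φ 0 - φinf)
        + 8 * L ^ 2 / (n * β) * (lyap U lam l₀ γ η (x 0) (d 0) (gb 0)
            + nsq (fun i => y 0 i - h 0 i))
        + 16 * L ^ 2 / β * ((K + 1) * (η ^ 2 * σ ^ 2))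
        + 2 * ((K + 1) * (L * η * σ ^ 2 / n)) := by
  have hn' : (0 : ℝ) < n := by exact_mod_cast Fin.pos l₀
  have hβ1 : β ≤ 1 / 2 := hβγ.trans hγ
  have hηL : η * L ≤ 1 := by
    have : (η * L) ^ 2 ≤ 1 ^ 2 := by rw [mul_pow]; nlinarith
    exact le_of_sq_le_sq this (by norm_num)
  have h1 := R.sum_lyap_le hU hW hs hβ hβ0 hβγ hγ0 hγ hC hη hα0 hα1 hαC hγα K
  have h2 : η / 2 * ∑ k ∈ Finset.range (K + 1), ‖mean (gb k)‖ ^ 2 + φ (K + 1)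
      ≤ φ 0 + η * L ^ 2 / (2 * n) * ∑ k ∈ Finset.range (K + 1), dsq U l₀ (x k)
        + (K + 1 : ℕ) * (L * η ^ 2 * σ ^ 2 / (2 * n)) := by
    generalize K + 1 = M
    induction M with
    | zero => simp
    | succ M ih =>
      rw [Finset.sum_range_succ, Finset.sum_range_succ]
      have := R.descent hU hW hs hη0 hL hηL hφ M
      push_cast
      linarith
  have h3 : ∑ k ∈ Finset.range (K + 1), dsq U l₀ (x k)
      ≤ ∑ k ∈ Finset.range (K + 1), lyap U lam l₀ γ η (x k) (d k) (gb k) :=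
    Finset.sum_le_sum fun k _ => dsq_le_lyap hU (hβ ▸ hβ0) hγ0 hγ _ _ _
  have h4 := hinf (K + 1)
  have hP0 : 0 ≤ ∑ k ∈ Finset.range (K + 1), ‖mean (gb k)‖ ^ 2 :=
    Finset.sum_nonneg fun _ _ => sq_nonneg _
  push_cast at h2
  set P := ∑ k ∈ Finset.range (K + 1), ‖mean (gb k)‖ ^ 2
  set SV := ∑ k ∈ Finset.range (K + 1), lyap U lam l₀ γ η (x k) (d k) (gb k)
  set A := lyap U lam l₀ γ η (x 0) (d 0) (gb 0) + nsq (fun i => y 0 i - h 0 i)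
  have h5 : SV ≤ 4 / β * (A + 2 * ((K + 1) * (η ^ 2 * (n * σ ^ 2)))
        + 1 / 4 * (η ^ 2 * (n * P))) := by
    have : SV = 4 / β * (β / 4 * SV) := by field_simp
    rw [this]; gcongr
  have h6 : η / 2 * P ≤ φ 0 - φinf + η * L ^ 2 / (2 * n) * SV
      + (K + 1) * (L * η ^ 2 * σ ^ 2 / (2 * n)) := by
    have : η * L ^ 2 / (2 * n) * ∑ k ∈ Finset.range (K + 1), dsq U l₀ (x k)
        ≤ η * L ^ 2 / (2 * n) * SV := by gcongr
    linarith
  have h7 : P ≤ 2 / η * (φ 0 - φinf) + L ^ 2 / n * SV + (K + 1) * (L * η * σ ^ 2 / n) := by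
    have : P = 2 / η * (η / 2 * P) := by field_simp
    rw [this]
    calc _ ≤ 2 / η * (φ 0 - φinf + η * L ^ 2 / (2 * n) * SV
      + (K + 1) * (L * η ^ 2 * σ ^ 2 / (2 * n))) := by gcongr
      _ = _ := by field_simp
  -- The gradient sum reappears with coefficient `η²L²/β ≤ 1/2`. Absorbing that half on the left
  -- doubles the other constants.
  have h8 : L ^ 2 / n * SV ≤ 4 * L ^ 2 / (n * β) * A
      + 8 * L ^ 2 / β * ((K + 1) * (η ^ 2 * σ ^ 2)) + 1 / 2 * P := by
    calc L ^ 2 / n * SV ≤ L ^ 2 / n * (4 / β * (A + 2 * ((K + 1) * (η ^ 2 * (n * σ ^ 2)))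
        + 1 / 4 * (η ^ 2 * (n * P)))) := by gcongr
      _ = 4 * L ^ 2 / (n * β) * A + 8 * L ^ 2 / β * ((K + 1) * (η ^ 2 * σ ^ 2))
          + (η ^ 2 * L ^ 2) / β * P := by field_simp; ring
      _ ≤ _ := by
        refine add_le_add le_rfl (mul_le_mul_of_nonneg_right ?_ hP0)
        rw [div_le_iff₀ hβ0]
        nlinarith
  have e1 : 4 / η * (φ 0 - φinf) = 2 * (2 / η * (φ 0 - φinf)) := by ring
  have e2 : 8 * L ^ 2 / (n * β) * A = 2 * (4 * L ^ 2 / (n * β) * A) := by ring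
  have e3 : 16 * L ^ 2 / β * ((K + 1) * (η ^ 2 * σ ^ 2))
      = 2 * (8 * L ^ 2 / β * ((K + 1) * (η ^ 2 * σ ^ 2))) := by ring
  rw [e1, e2, e3]
  linarith

end IsRun

end RunSum

/-! ### Pointwise statements and elements of `L²` -/

section L2

variable {Ω F : Type*} {m mΩ : MeasurableSpace Ω} {P : Measure Ω} [NormedAddCommGroup F]

theorem ofReal_norm_toLp_sq {u : Ω → F} (hu : MemLp u 2 P) :
    ENNReal.ofReal (‖hu.toLp u‖ ^ 2) = ∫⁻ ω, ‖u ω‖ₑ ^ 2 ∂P := by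
  rw [ENNReal.ofReal_pow (norm_nonneg _), ofReal_norm, Lp.enorm_toLp,
    eLpNorm_eq_lintegral_rpow_enorm_toReal (by norm_num) (by norm_num), ← ENNReal.rpow_natCast,
    ← ENNReal.rpow_mul]
  norm_num

theorem memLp_two_of_lintegral_lt_top {u : Ω → F} (hm : AEStronglyMeasurable u P)
    (h : ∫⁻ ω, ‖u ω‖ₑ ^ 2 ∂P < ∞) : MemLp u 2 P := by
  refine ⟨hm, ?_⟩
  rw [eLpNorm_lt_top_iff_lintegral_rpow_enorm_lt_top (by norm_num) (by norm_num)]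
  simpa using h

theorem norm_toLp_sq_le {u : Ω → F} (hu : MemLp u 2 P) {c : ℝ} (hc : 0 ≤ c)
    (h : ∫⁻ ω, ‖u ω‖ₑ ^ 2 ∂P ≤ ENNReal.ofReal c) : ‖hu.toLp u‖ ^ 2 ≤ c := by
  rw [← ofReal_norm_toLp_sq hu] at h
  exact (ENNReal.ofReal_le_ofReal_iff hc).1 h

theorem norm_toLp_sub_le_mul {u v u' v' : Ω → F} (hu : MemLp u 2 P) (hv : MemLp v 2 P)
    (hu' : MemLp u' 2 P) (hv' : MemLp v' 2 P) {L : ℝ}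
    (h : ∀ ω, ‖u ω - v ω‖ ≤ L * ‖u' ω - v' ω‖) :
    ‖hu.toLp u - hv.toLp v‖ ≤ L * ‖hu'.toLp u' - hv'.toLp v'‖ := by
  rw [← MemLp.toLp_sub, ← MemLp.toLp_sub]
  refine Lp.norm_le_mul_norm_of_ae_le_mul ?_
  filter_upwards [(hu.sub hv).coeFn_toLp, (hu'.sub hv').coeFn_toLp] with ω h1 h2
  rw [h1, h2]
  exact h ω

theorem integrable_inner_of_memLp [InnerProductSpace ℝ F] {u v : Ω → F} (hu : MemLp u 2 P)
    (hv : MemLp v 2 P) : Integrable (fun ω => inner ℝ (u ω) (v ω)) P := by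
  refine (L2.integrable_inner (𝕜 := ℝ) (hu.toLp u) (hv.toLp v)).congr ?_
  filter_upwards [hu.coeFn_toLp, hv.coeFn_toLp] with ω h1 h2
  rw [h1, h2]

theorem inner_toLp [InnerProductSpace ℝ F] {u v : Ω → F} (hu : MemLp u 2 P) (hv : MemLp v 2 P) :
    inner ℝ (hu.toLp u) (hv.toLp v) = ∫ ω, inner ℝ (u ω) (v ω) ∂P := by
  rw [L2.inner_def]
  refine integral_congr_ae ?_
  filter_upwards [hu.coeFn_toLp, hv.coeFn_toLp] with ω h1 h2
  rw [h1, h2]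

theorem toLp_mem_lpMeas [InnerProductSpace ℝ F] [MeasurableSpace F] [BorelSpace F]
    [SecondCountableTopology F] {u : Ω → F} (hu : MemLp u 2 P)
    (hm : Measurable[m] u) : hu.toLp u ∈ lpMeas F ℝ m 2 P := by
  rw [mem_lpMeas_iff_aestronglyMeasurable]
  exact (hm.stronglyMeasurable.aestronglyMeasurable).congr hu.coeFn_toLp.symm

/-- Each element of `lpMeas` has an `m`-measurable representative, so orthogonality can be tested on
genuine functions, to which independence applies. -/
theorem inner_toLp_eq_zero_of_forall [InnerProductSpace ℝ F] [MeasurableSpace F] [BorelSpace F]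
    [SecondCountableTopology F] {u : Ω → F}
    (hu : MemLp u 2 P)
    (h : ∀ A : Ω → F, Measurable[m] A → MemLp A 2 P → ∫ ω, inner ℝ (u ω) (A ω) ∂P = 0)
    (v : Lp F 2 P) (hv : v ∈ lpMeas F ℝ m 2 P) : inner ℝ (hu.toLp u) v = 0 := by
  rw [mem_lpMeas_iff_aestronglyMeasurable] at hv
  obtain ⟨A, hA, hAv⟩ := hv
  have hA2 : MemLp A 2 P := (Lp.memLp v).ae_eq hAv
  have : v = hA2.toLp A := by
    rw [← Lp.toLp_coeFn v (Lp.memLp v)]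
    exact MemLp.toLp_congr _ _ hAv
  rw [this, inner_toLp]
  exact h A hA.measurable hA2

theorem toLp_sum {ι : Type*} (s : Finset ι) {u : ι → Ω → F} (hu : ∀ i, MemLp (u i) 2 P)
    (hs : MemLp (fun ω => ∑ i ∈ s, u i ω) 2 P) :
    hs.toLp _ = ∑ i ∈ s, (hu i).toLp (u i) := by
  classical
  induction s using Finset.induction_on with
  | empty => simp only [Finset.sum_empty]; exact MemLp.toLp_zero _
  | insert a s ha ih =>
    have hs' : MemLp (fun ω => ∑ i ∈ s, u i ω) 2 P := memLp_finsetSum _ fun i _ => hu i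
    rw [Finset.sum_insert ha, ← ih hs', ← MemLp.toLp_add]
    refine MemLp.toLp_congr _ _ (Filter.Eventually.of_forall fun ω => ?_)
    simp [Finset.sum_insert ha]

end L2

/-! ### Fresh noise: variance and orthogonality -/

section Independence

variable {Ω E Z F : Type*} {m mΩ : MeasurableSpace Ω} [MeasurableSpace E] [MeasurableSpace Z]
  {P : Measure Ω} [IsProbabilityMeasure P]

/-- The product law allows averaging over the fresh variable with the past frozen, by Fubini; this
replaces conditional expectation throughout. -/
theorem map_prodMk_eq_of_indep (hm : m ≤ mΩ) {Y : Ω → E} (hY : Measurable[m] Y) {ζ : Ω → Z}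
    (hζ : Measurable ζ) (hind : Indep (MeasurableSpace.comap ζ inferInstance) m P) :
    P.map (fun ω => (Y ω, ζ ω)) = (P.map Y).prod (P.map ζ) := by
  have hi : IndepFun Y ζ P := by
    rw [IndepFun_iff_Indep]
    exact indep_of_indep_of_le_left hind.symm hY.comap_le
  exact (indepFun_iff_map_prod_eq_prod_map_map (hY.mono hm le_rfl).aemeasurable
    hζ.aemeasurable).1 hi

/-- The second moment of a fresh noise, given the past. -/
theorem lintegral_enorm_sq_le_of_indep [NormedAddCommGroup F] [MeasurableSpace F] [BorelSpace F]
    (hm : m ≤ mΩ) {Y : Ω → E} (hY : Measurable[m] Y) {ζ : Ω → Z}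
    (hζ : Measurable ζ) (hind : Indep (MeasurableSpace.comap ζ inferInstance) m P)
    {Φ : E → Z → F} (hΦ : Measurable fun z : E × Z => Φ z.1 z.2) {v : E → ℝ≥0∞}
    (hv : ∀ y, ∫⁻ z, ‖Φ y z‖ₑ ^ 2 ∂(P.map ζ) ≤ v y) :
    ∫⁻ ω, ‖Φ (Y ω) (ζ ω)‖ₑ ^ 2 ∂P ≤ ∫⁻ ω, v (Y ω) ∂P := by
  have hY' := hY.mono hm le_rfl
  have hG : Measurable fun z : E × Z => ‖Φ z.1 z.2‖ₑ ^ 2 := hΦ.enorm.pow_const 2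
  have := Measure.isProbabilityMeasure_map (μ := P) hζ.aemeasurable
  calc ∫⁻ ω, ‖Φ (Y ω) (ζ ω)‖ₑ ^ 2 ∂P
      = ∫⁻ z, ‖Φ z.1 z.2‖ₑ ^ 2 ∂(P.map fun ω => (Y ω, ζ ω)) :=
        (lintegral_map hG (hY'.prodMk hζ)).symm
    _ = ∫⁻ y, ∫⁻ z, ‖Φ y z‖ₑ ^ 2 ∂(P.map ζ) ∂(P.map Y) := by
        rw [map_prodMk_eq_of_indep hm hY hζ hind, lintegral_prod _ hG.aemeasurable]
    _ = ∫⁻ ω, ∫⁻ z, ‖Φ (Y ω) z‖ₑ ^ 2 ∂(P.map ζ) ∂P :=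
        lintegral_map hG.lintegral_prod_right' hY'
    _ ≤ ∫⁻ ω, v (Y ω) ∂P := lintegral_mono fun ω => hv (Y ω)

/-- A fresh centered noise is orthogonal to the past. -/
theorem integral_inner_eq_zero_of_indep [NormedAddCommGroup F] [InnerProductSpace ℝ F]
    [MeasurableSpace F] [BorelSpace F] [SecondCountableTopology F] [CompleteSpace F]
    (hm : m ≤ mΩ) {Y : Ω → E} (hY : Measurable[m] Y) {A : Ω → F} (hA : Measurable[m] A)
    (hA2 : MemLp A 2 P) {ζ : Ω → Z}
    (hζ : Measurable ζ) (hind : Indep (MeasurableSpace.comap ζ inferInstance) m P)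
    {Φ : E → Z → F} (hΦ : Measurable fun z : E × Z => Φ z.1 z.2)
    (hint : ∀ y, Integrable (Φ y) (P.map ζ)) (hzero : ∀ y, ∫ z, Φ y z ∂(P.map ζ) = 0)
    (hΦ2 : MemLp (fun ω => Φ (Y ω) (ζ ω)) 2 P) :
    ∫ ω, inner ℝ (Φ (Y ω) (ζ ω)) (A ω) ∂P = 0 := by
  have hY' := hY.mono hm le_rfl
  have hA' := hA.mono hm le_rfl
  -- The test function is adjoined to the past variable: for fixed values of the pair, the integral
  -- over the fresh sample is zero.
  have hYA : Measurable[m] fun ω => (Y ω, A ω) := hY.prodMk hA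
  have hYA' := hYA.mono hm le_rfl
  have := Measure.isProbabilityMeasure_map (μ := P) hζ.aemeasurable
  have := Measure.isProbabilityMeasure_map (μ := P) hYA'.aemeasurable
  let G : (E × F) × Z → ℝ := fun z => inner ℝ (Φ z.1.1 z.2) z.1.2
  have hG : Measurable G := by
    have h1 : Measurable fun z : (E × F) × Z => Φ z.1.1 z.2 :=
      hΦ.comp ((measurable_fst.comp measurable_fst).prodMk measurable_snd)
    exact h1.inner (measurable_snd.comp measurable_fst)
  have hpair : Measurable fun ω => ((Y ω, A ω), ζ ω) := hYA'.prodMk hζ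
  have hmap := map_prodMk_eq_of_indep hm hYA hζ hind
  have hGi : Integrable (fun ω => G ((Y ω, A ω), ζ ω)) P := integrable_inner_of_memLp hΦ2 hA2
  have hGi' : Integrable G ((P.map fun ω => (Y ω, A ω)).prod (P.map ζ)) := by
    rw [← hmap]
    exact (integrable_map_measure hG.aestronglyMeasurable hpair.aemeasurable).2 hGi
  calc ∫ ω, inner ℝ (Φ (Y ω) (ζ ω)) (A ω) ∂P
      = ∫ z, G z ∂(P.map fun ω => ((Y ω, A ω), ζ ω)) :=
        (integral_map hpair.aemeasurable hG.aestronglyMeasurable).symm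
    _ = ∫ t, ∫ z, G (t, z) ∂(P.map ζ) ∂(P.map fun ω => (Y ω, A ω)) := by
        rw [hmap, integral_prod _ hGi']
    _ = 0 := by
        have : ∀ t : E × F, ∫ z, G (t, z) ∂(P.map ζ) = 0 := by
          intro t
          have h1 : ∫ z, G (t, z) ∂(P.map ζ) = ∫ z, inner ℝ t.2 (Φ t.1 z) ∂(P.map ζ) :=
            integral_congr_ae (Filter.Eventually.of_forall fun z => real_inner_comm _ _)
          rw [h1, integral_inner (hint t.1), hzero, inner_zero_right]
        simp [this]

end Independence

/-! ### Smooth functions and the averaged objective -/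

section Smooth

variable {F : Type*} [NormedAddCommGroup F] [InnerProductSpace ℝ F] [CompleteSpace F]

/-- The descent lemma. -/
theorem le_add_inner_add_of_lipschitz_gradient {φ : F → ℝ} {L : ℝ} (hφ : Differentiable ℝ φ)
    (hL : ∀ x y, ‖gradient φ x - gradient φ y‖ ≤ L * ‖x - y‖) (x y : F) :
    φ y ≤ φ x + inner ℝ (gradient φ x) (y - x) + L / 2 * ‖y - x‖ ^ 2 := by
  set v := y - x with hv
  -- This is `φ` along the segment minus the nonconstant part of its quadratic majorant; the
  -- Lipschitz gradient makes its derivative nonpositive.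
  let ψ : ℝ → ℝ := fun t => φ (x + t • v) - t * inner ℝ (gradient φ x) v - L / 2 * t ^ 2 * ‖v‖ ^ 2
  have hline : ∀ t : ℝ, HasDerivAt (fun t : ℝ => x + t • v) v t := fun t => by
    simpa using ((hasDerivAt_id t).smul_const v).const_add x
  have hd : ∀ t, HasDerivAt ψ (inner ℝ (gradient φ (x + t • v)) v - inner ℝ (gradient φ x) v
      - L * t * ‖v‖ ^ 2) t := fun t => by
    have h1 := ((hφ (x + t • v)).hasGradientAt.hasFDerivAt).comp_hasDerivAt t (hline t)
    rw [InnerProductSpace.toDual_apply_apply] at h1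
    have h2 := (h1.sub ((hasDerivAt_id t).mul_const (inner ℝ (gradient φ x) v))).sub
      ((((hasDerivAt_id t).pow 2).const_mul (L / 2)).mul_const (‖v‖ ^ 2))
    exact h2.congr_deriv (by norm_num; ring_nf; simp)
  have hanti : AntitoneOn ψ (Set.Icc 0 1) := by
    refine antitoneOn_of_deriv_nonpos (convex_Icc 0 1)
      (fun t _ => (hd t).continuousAt.continuousWithinAt)
      (fun t _ => (hd t).differentiableAt.differentiableWithinAt) fun t ht => ?_
    rw [interior_Icc] at ht
    rw [(hd t).deriv, ← inner_sub_left]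
    have h1 := real_inner_le_norm (gradient φ (x + t • v) - gradient φ x) v
    have h2 := hL (x + t • v) x
    rw [add_sub_cancel_left, norm_smul, Real.norm_eq_abs, abs_of_pos ht.1] at h2
    have h3 := mul_le_mul_of_nonneg_right h2 (norm_nonneg v)
    nlinarith
  have h := hanti (Set.left_mem_Icc.2 zero_le_one) (Set.right_mem_Icc.2 zero_le_one) zero_le_one
  simp only [ψ] at h
  simp only [one_smul, zero_smul, add_zero, hv] at h
  rw [hv]
  rw [add_sub_cancel] at h
  linarith

end Smooth

section Smoothness

variable {n p : ℕ} {f : Fin n → Vec p → ℝ} {L : ℝ} {flow : Fin n → ℝ}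

theorem IsSmoothBddBelow.measurable_gradient (hf : IsSmoothBddBelow f L flow) (i : Fin n) :
    Measurable (gradient (f i)) := by
  have h : LipschitzWith L.toNNReal (gradient (f i)) :=
    LipschitzWith.of_dist_le_mul fun x y => by
      rw [dist_eq_norm, dist_eq_norm]
      refine (hf.lipschitz i x y).trans ?_
      gcongr
      exact Real.le_coe_toNNReal L
  exact h.continuous.measurable

theorem IsSmoothBddBelow.hasGradientAt_avgFun (hf : IsSmoothBddBelow f L flow) (x : Vec p) :
    HasGradientAt (avgFun f) (avg fun i => gradient (f i) x) x := by
  have h : ∀ i, HasFDerivAt (f i) (InnerProductSpace.toDual ℝ _ (gradient (f i) x)) x :=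
    fun i => (hf.differentiable i x).hasGradientAt.hasFDerivAt
  rw [hasGradientAt_iff_hasFDerivAt, avg, map_smul, map_sum]
  exact (HasFDerivAt.fun_sum fun i _ => h i).const_smul ((n : ℝ)⁻¹)

theorem IsSmoothBddBelow.gradient_avgFun (hf : IsSmoothBddBelow f L flow) (x : Vec p) :
    gradient (avgFun f) x = avg fun i => gradient (f i) x :=
  (hf.hasGradientAt_avgFun x).gradient

theorem IsSmoothBddBelow.differentiable_avgFun (hf : IsSmoothBddBelow f L flow) :
    Differentiable ℝ (avgFun f) := fun x => (hf.hasGradientAt_avgFun x).differentiableAt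

theorem IsSmoothBddBelow.lipschitz_avgFun (hf : IsSmoothBddBelow f L flow) (hn : 0 < n)
    (x y : Vec p) : ‖gradient (avgFun f) x - gradient (avgFun f) y‖ ≤ L * ‖x - y‖ := by
  rw [hf.gradient_avgFun, hf.gradient_avgFun, avg, avg, ← smul_sub, ← Finset.sum_sub_distrib,
    norm_smul, norm_inv, Real.norm_natCast]
  have hn' : (0 : ℝ) < n := by exact_mod_cast hn
  have h : ‖∑ i, (gradient (f i) x - gradient (f i) y)‖ ≤ n * (L * ‖x - y‖) := by
    refine (norm_sum_le _ _).trans ?_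
    simpa using Finset.sum_le_sum (s := Finset.univ) fun i _ => hf.lipschitz i x y
  calc (n : ℝ)⁻¹ * _ ≤ (n : ℝ)⁻¹ * (n * (L * ‖x - y‖)) := by gcongr
    _ = _ := by field_simp

theorem IsSmoothBddBelow.lower_avgFun (hf : IsSmoothBddBelow f L flow) (x : Vec p) :
    (n : ℝ)⁻¹ * ∑ i, flow i ≤ avgFun f x := by
  unfold avgFun
  gcongr with i
  exact hf.lower i x

theorem IsSmoothBddBelow.memLp_gradient {Ω : Type*} {mΩ : MeasurableSpace Ω} {P : Measure Ω}
    [IsProbabilityMeasure P] (hf : IsSmoothBddBelow f L flow) (i : Fin n) {X : Ω → Vec p}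
    (hX : MemLp X 2 P) : MemLp (fun ω => gradient (f i) (X ω)) 2 P := by
  have h1 : MemLp (fun ω => L * ‖X ω‖ + ‖gradient (f i) 0‖) 2 P :=
    (hX.norm.const_mul L).add (memLp_const _)
  refine h1.mono' ((hf.measurable_gradient i).comp_aemeasurable
    hX.1.aemeasurable).aestronglyMeasurable (Filter.Eventually.of_forall fun ω => ?_)
  have h2 := hf.lipschitz i (X ω) 0
  have h3 := norm_sub_norm_le (gradient (f i) (X ω)) (gradient (f i) 0)
  rw [sub_zero] at h2
  linarith

end Smoothness

/-! ### Independence of the samples from the past -/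

section Sampling

set_option linter.unusedSectionVars false

variable {n p q : ℕ} {Ω Z : Type*} [mΩ : MeasurableSpace Ω] [MeasurableSpace Z] {P : Measure Ω}
  {ξ : ℕ → Fin n → Ω → Vec q} {ζ : ℕ → Fin n → Ω → Z}

theorem past_mono {a b a' b' : ℕ} (ha : a ≤ a') (hb : b ≤ b') :
    past ξ ζ a b ≤ past ξ ζ a' b' := by
  refine sup_le_sup ?_ ?_
  · exact iSup_mono fun s => iSup_mono' fun hs => ⟨hs.trans_le ha, le_rfl⟩
  · exact iSup_mono fun s => iSup_mono' fun hs => ⟨hs.trans_le hb, le_rfl⟩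

theorem measurable_past_grad {a b s : ℕ} (hs : s < a) (i : Fin n) :
    Measurable[past ξ ζ a b] (ξ s i) := by
  rw [measurable_iff_comap_le]
  refine le_trans ?_ le_sup_left
  exact le_iSup_of_le s (le_iSup_of_le hs (le_iSup_of_le i le_rfl))

theorem measurable_past_comp {a b s : ℕ} (hs : s < b) (i : Fin n) :
    Measurable[past ξ ζ a b] (ζ s i) := by
  rw [measurable_iff_comap_le]
  refine le_trans ?_ le_sup_right
  exact le_iSup_of_le s (le_iSup_of_le hs (le_iSup_of_le i le_rfl))

theorem IsSampling.past_le (hS : IsSampling P ξ ζ) (a b : ℕ) : past ξ ζ a b ≤ mΩ := by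
  refine sup_le ?_ ?_
  · exact iSup_le fun s => iSup_le fun _ => iSup_le fun i => (hS.measurable_grad s i).comap_le
  · exact iSup_le fun s => iSup_le fun _ => iSup_le fun i => (hS.measurable_comp s i).comap_le

theorem IsSampling.option_le (hS : IsSampling P ξ ζ) (t : ℕ) (o : Option (Fin n)) :
    (o.elim (past ξ ζ t (t - 1)) fun i => MeasurableSpace.comap (ξ t i) inferInstance) ≤ mΩ := by
  cases o with
  | none => exact hS.past_le _ _
  | some i => exact (hS.measurable_grad t i).comap_le

/-- Joint independence allows another agent's current sample to be grouped with the past. This makes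
gradient noises of distinct agents uncorrelated, hence the variance `σ²/n` of their average. -/
theorem IsSampling.indep_grad_past_sup (hS : IsSampling P ξ ζ) (t : ℕ) {i j : Fin n}
    (hij : i ≠ j) : Indep (MeasurableSpace.comap (ξ t i) inferInstance)
      (past ξ ζ t (t - 1) ⊔ MeasurableSpace.comap (ξ t j) inferInstance) P := by
  have h := indep_iSup_of_disjoint (hS.option_le t) (hS.indep_grad t)
    (S := {some i}) (T := {none, some j}) (by simp [hij])
  simpa [iSup_or, iSup_sup_eq] using h

theorem IsSampling.indep_grad_past (hS : IsSampling P ξ ζ) (t : ℕ) (i : Fin n) :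
    Indep (MeasurableSpace.comap (ξ t i) inferInstance) (past ξ ζ t (t - 1)) P := by
  have h := indep_iSup_of_disjoint (hS.option_le t) (hS.indep_grad t)
    (S := {some i}) (T := {none}) (by simp)
  simpa using h

end Sampling

/-! ### Gradient noise and compression error in `L²` -/

section Noise

set_option linter.unusedSectionVars false

variable {n p q : ℕ} {Ω Z : Type*} {m : MeasurableSpace Ω} [mΩ : MeasurableSpace Ω] [MeasurableSpace Z] {P : Measure Ω}
  [IsProbabilityMeasure P]
  {ξ : ℕ → Fin n → Ω → Vec q} {ζ : ℕ → Fin n → Ω → Z} {f : Fin n → Vec p → ℝ} {L σ C : ℝ}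
  {flow : Fin n → ℝ} {g : Fin n → Vec p → Vec q → Vec p} {Q : Vec p → Z → Vec p}

/-- The gradient noise of agent `i` at the random point `X`. -/
noncomputable def noise (f : Fin n → Vec p → ℝ) (g : Fin n → Vec p → Vec q → Vec p)
    (i : Fin n) (X : Ω → Vec p) (ξ : Ω → Vec q) (ω : Ω) : Vec p :=
  g i (X ω) (ξ ω) - gradient (f i) (X ω)

theorem measurable_noise (hf : IsSmoothBddBelow f L flow) {i : Fin n}
    {ν : Measure (Vec q)} (hg : IsStochasticGradient (f i) σ (g i) ν) {X : Ω → Vec p}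
    {s : Ω → Vec q} (hX : Measurable[m] X) (hs : Measurable[m] s) :
    Measurable[m] (noise f g i X s) :=
  (hg.measurable.comp (hX.prodMk hs)).sub ((hf.measurable_gradient i).comp hX)

variable (hf : IsSmoothBddBelow f L flow) (hS : IsSampling P ξ ζ)
  (hg : ∀ t i, IsStochasticGradient (f i) σ (g i) (P.map (ξ t i)))
include hf hS hg

theorem lintegral_noise_sq_le (t : ℕ) (i : Fin n) {X : Ω → Vec p}
    (hX : Measurable[past ξ ζ t (t - 1)] X) :
    ∫⁻ ω, ‖noise f g i X (ξ t i) ω‖ₑ ^ 2 ∂P ≤ ENNReal.ofReal (σ ^ 2) := by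
  have h := lintegral_enorm_sq_le_of_indep (P := P) (hS.past_le t (t - 1)) hX
    (hS.measurable_grad t i) (hS.indep_grad_past t i)
    (Φ := fun x s => g i x s - gradient (f i) x) (v := fun _ => ENNReal.ofReal (σ ^ 2))
    ((hg t i).measurable.sub ((hf.measurable_gradient i).comp measurable_fst))
    ((hg t i).variance)
  simpa [noise] using h

theorem memLp_noise (t : ℕ) (i : Fin n) {X : Ω → Vec p}
    (hX : Measurable[past ξ ζ t (t - 1)] X) : MemLp (noise f g i X (ξ t i)) 2 P := by
  refine memLp_two_of_lintegral_lt_top ?_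
    ((lintegral_noise_sq_le hf hS hg t i hX).trans_lt ENNReal.ofReal_lt_top)
  exact (measurable_noise hf (hg t i) (hX.mono (hS.past_le _ _) le_rfl)
    (hS.measurable_grad t i)).aestronglyMeasurable

/-- The intermediate σ-algebra `m` serves two uses: the past alone, and the past enlarged by another
agent's sample. -/
theorem integral_inner_noise_eq_zero (t : ℕ) (i : Fin n) (hm : m ≤ mΩ)
    (hpm : past ξ ζ t (t - 1) ≤ m)
    (hind : Indep (MeasurableSpace.comap (ξ t i) inferInstance) m P) {X : Ω → Vec p}
    (hX : Measurable[past ξ ζ t (t - 1)] X) {A : Ω → Vec p} (hA : Measurable[m] A)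
    (hA2 : MemLp A 2 P) : ∫ ω, inner ℝ (noise f g i X (ξ t i) ω) (A ω) ∂P = 0 := by
  have := Measure.isProbabilityMeasure_map (μ := P) (hS.measurable_grad t i).aemeasurable
  refine integral_inner_eq_zero_of_indep hm (hX.mono hpm le_rfl) hA hA2
    (hS.measurable_grad t i) hind (Φ := fun x s => g i x s - gradient (f i) x)
    ((hg t i).measurable.sub ((hf.measurable_gradient i).comp measurable_fst))
    (fun x => ((hg t i).integrable x).sub (integrable_const _)) (fun x => ?_)
    (memLp_noise hf hS hg t i hX)
  rw [integral_sub ((hg t i).integrable x) (integrable_const _), (hg t i).unbiased]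
  simp

theorem inner_noise_noise_eq_zero (t : ℕ) {i j : Fin n} (hij : i ≠ j) {X X' : Ω → Vec p}
    (hX : Measurable[past ξ ζ t (t - 1)] X) (hX' : Measurable[past ξ ζ t (t - 1)] X') :
    inner ℝ ((memLp_noise hf hS hg t i hX).toLp _) ((memLp_noise hf hS hg t j hX').toLp _) = 0 := by
  rw [inner_toLp]
  refine integral_inner_noise_eq_zero hf hS hg t i
    (sup_le (hS.past_le _ _) (hS.measurable_grad t j).comap_le) le_sup_left
    (hS.indep_grad_past_sup t hij) hX ?_ (memLp_noise hf hS hg t j hX')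
  exact measurable_noise hf (hg t j) (hX'.mono le_sup_left le_rfl)
    ((comap_measurable (ξ t j)).mono le_sup_right le_rfl)

theorem inner_noise_eq_zero (t : ℕ) (i : Fin n) {X : Ω → Vec p}
    (hX : Measurable[past ξ ζ t (t - 1)] X) (v : Lp (Vec p) 2 P)
    (hv : v ∈ lpMeas (Vec p) ℝ (past ξ ζ t (t - 1)) 2 P) :
    inner ℝ ((memLp_noise hf hS hg t i hX).toLp _) v = 0 :=
  inner_toLp_eq_zero_of_forall _ (fun _ hA hA2 =>
    integral_inner_noise_eq_zero hf hS hg t i (hS.past_le _ _) le_rfl (hS.indep_grad_past t i)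
      hX hA hA2) v hv

theorem norm_noise_sq_le (t : ℕ) (i : Fin n) {X : Ω → Vec p}
    (hX : Measurable[past ξ ζ t (t - 1)] X) :
    ‖(memLp_noise hf hS hg t i hX).toLp _‖ ^ 2 ≤ σ ^ 2 :=
  norm_toLp_sq_le _ (sq_nonneg σ) (lintegral_noise_sq_le hf hS hg t i hX)

omit hf hg
variable (hC : 0 ≤ C) (hQ : ∀ k i, IsUnbiasedCompressor C Q (P.map (ζ k i)))
include hC hQ

theorem lintegral_compress_sq_le (k : ℕ) (i : Fin n) {Y : Ω → Vec p}
    (hY : Measurable[past ξ ζ (k + 2) k] Y) (hY2 : MemLp Y 2 P) :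
    ∫⁻ ω, ‖Q (Y ω) (ζ k i ω) - Y ω‖ₑ ^ 2 ∂P ≤ ENNReal.ofReal (C * ‖hY2.toLp Y‖ ^ 2) := by
  have h := lintegral_enorm_sq_le_of_indep (P := P) (hS.past_le (k + 2) k) hY
    (hS.measurable_comp k i) (hS.indep_comp k i)
    (Φ := fun y z => Q y z - y) (v := fun y => ENNReal.ofReal (C * ‖y‖ ^ 2))
    ((hQ k i).measurable.sub measurable_fst) ((hQ k i).variance)
  refine h.trans_eq ?_
  rw [ENNReal.ofReal_mul hC, ofReal_norm_toLp_sq, ← lintegral_const_mul' _ _ ENNReal.ofReal_ne_top]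
  refine lintegral_congr fun ω => ?_
  rw [ENNReal.ofReal_mul hC, ENNReal.ofReal_pow (norm_nonneg _), ofReal_norm]

theorem memLp_compress (k : ℕ) (i : Fin n) {Y : Ω → Vec p}
    (hY : Measurable[past ξ ζ (k + 2) k] Y) (hY2 : MemLp Y 2 P) :
    MemLp (fun ω => Q (Y ω) (ζ k i ω) - Y ω) 2 P := by
  refine memLp_two_of_lintegral_lt_top ?_
    ((lintegral_compress_sq_le hS hC hQ k i hY hY2).trans_lt ENNReal.ofReal_lt_top)
  have hY' := hY.mono (hS.past_le _ _) le_rfl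
  exact (((hQ k i).measurable.comp (hY'.prodMk (hS.measurable_comp k i))).sub
    hY').aestronglyMeasurable

theorem norm_compress_sq_le (k : ℕ) (i : Fin n) {Y : Ω → Vec p}
    (hY : Measurable[past ξ ζ (k + 2) k] Y) (hY2 : MemLp Y 2 P) :
    ‖(memLp_compress hS hC hQ k i hY hY2).toLp _‖ ^ 2 ≤ C * ‖hY2.toLp Y‖ ^ 2 :=
  norm_toLp_sq_le _ (by positivity) (lintegral_compress_sq_le hS hC hQ k i hY hY2)

theorem inner_compress_eq_zero (k : ℕ) (i : Fin n) {Y : Ω → Vec p}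
    (hY : Measurable[past ξ ζ (k + 2) k] Y) (hY2 : MemLp Y 2 P) (v : Lp (Vec p) 2 P)
    (hv : v ∈ lpMeas (Vec p) ℝ (past ξ ζ (k + 2) k) 2 P) :
    inner ℝ ((memLp_compress hS hC hQ k i hY hY2).toLp _) v = 0 := by
  have := Measure.isProbabilityMeasure_map (μ := P) (hS.measurable_comp k i).aemeasurable
  refine inner_toLp_eq_zero_of_forall _ (fun A hA hA2 => ?_) v hv
  refine integral_inner_eq_zero_of_indep (hS.past_le _ _) hY hA hA2
    (hS.measurable_comp k i) (hS.indep_comp k i) (Φ := fun y z => Q y z - y)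
    ((hQ k i).measurable.sub measurable_fst)
    (fun x => ((hQ k i).integrable x).sub (integrable_const _)) (fun x => ?_)
    (memLp_compress hS hC hQ k i hY hY2)
  rw [integral_sub ((hQ k i).integrable x) (integrable_const _), (hQ k i).unbiased]
  simp

end Noise

/-! ### CEDAS as a trajectory in `L²` -/

section Trajectory

set_option linter.unusedSectionVars false

variable {n p q : ℕ} {Ω Z : Type*} [mΩ : MeasurableSpace Ω] [MeasurableSpace Z]
  {P : Measure Ω} [IsProbabilityMeasure P]

/-- The random variables of CEDAS, with the mixing with the neighbours written through `W`:
`Y` is the transmitted variable and `E` the compression error. -/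
structure IsTrajectory (W : Matrix (Fin n) (Fin n) ℝ) (α γ η : ℝ)
    (g : Fin n → Vec p → Vec q → Vec p) (Q : Vec p → Z → Vec p) (xinit H₀ : Stack n p)
    (ξ : ℕ → Fin n → Ω → Vec q) (ζ : ℕ → Fin n → Ω → Z)
    (X D H Y E : ℕ → Fin n → Ω → Vec p) : Prop where
  x_zero : ∀ i ω, X 0 i ω = xinit i - η • g i (xinit i) (ξ 0 i ω)
  d_zero : ∀ i ω, D 0 i ω = 0
  h_zero : ∀ i ω, H 0 i ω = H₀ i
  y_eq : ∀ k i ω, Y k i ω = X k i ω - η • g i (X k i ω) (ξ (k + 1) i ω) - D k i ω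
  e_eq : ∀ k i ω, E k i ω = Q (Y k i ω - H k i ω) (ζ k i ω) - (Y k i ω - H k i ω)
  d_succ : ∀ k i ω, D (k + 1) i ω
    = D k i ω + (γ / 2) • ((Y k i ω + E k i ω) - ∑ j, W i j • (Y k j ω + E k j ω))
  x_succ : ∀ k i ω, X (k + 1) i ω = Y k i ω + D k i ω - D (k + 1) i ω
  h_succ : ∀ k i ω, H (k + 1) i ω = H k i ω + α • (Y k i ω + E k i ω - H k i ω)

theorem IsMixingMatrix.mix_eq {G : SimpleGraph (Fin n)} {W : Matrix (Fin n) (Fin n) ℝ}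
    (hW : IsMixingMatrix G W) (z : Stack n p) (i : Fin n) : mix G W z i = ∑ j, W i j • z j := by
  classical
  rw [mix, Finset.sum_filter]
  refine Finset.sum_congr rfl fun j _ => ?_
  split_ifs with h
  · rfl
  · push Not at h
    have h0 : W i j = 0 := by
      by_contra hne
      exact h.1 ((hW.adj_iff i j (Ne.symm h.2)).2 (lt_of_le_of_ne (hW.nonneg i j) (Ne.symm hne)))
    rw [h0, zero_smul]

variable {W : Matrix (Fin n) (Fin n) ℝ} {α γ η : ℝ}
  {g : Fin n → Vec p → Vec q → Vec p} {Q : Vec p → Z → Vec p} {xinit H₀ : Stack n p}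
  {ξ : ℕ → Fin n → Ω → Vec q} {ζ : ℕ → Fin n → Ω → Z}

omit [MeasurableSpace Z] in
-- By linearity the two communication updates commute with `W`, so `h_w` never leaves `W h`. It can
-- be eliminated, and the dual update sees `(I - W)(y + e)`.
theorem IsMixingMatrix.iterate_hw {G : SimpleGraph (Fin n)} (hW : IsMixingMatrix G W)
    (a : ℕ → Fin n → Vec q) (b : ℕ → Fin n → Z) (k : ℕ) (i : Fin n) :
    (iterate G W α γ η g Q xinit H₀ a b k).hw i
      = ∑ j, W i j • (iterate G W α γ η g Q xinit H₀ a b k).h j := by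
  induction k with
  | zero => simp [iterate, initState, hW.mix_eq]
  | succ k ih =>
    simp only [iterate, step, comm, hW.mix_eq, ih, smul_add, Finset.smul_sum,
      Finset.sum_add_distrib, smul_comm (W i _)]

omit [MeasurableSpace Z] in
theorem IsMixingMatrix.isTrajectory {G : SimpleGraph (Fin n)} (hW : IsMixingMatrix G W) :
    IsTrajectory W α γ η g Q xinit H₀ ξ ζ
      (fun k i ω => (iterate G W α γ η g Q xinit H₀ (fun s i => ξ s i ω) (fun s i => ζ s i ω) k).x i)
      (fun k i ω => (iterate G W α γ η g Q xinit H₀ (fun s i => ξ s i ω) (fun s i => ζ s i ω) k).d i)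
      (fun k i ω => (iterate G W α γ η g Q xinit H₀ (fun s i => ξ s i ω) (fun s i => ζ s i ω) k).h i)
      (fun k i ω =>
        let S := iterate G W α γ η g Q xinit H₀ (fun s i => ξ s i ω) (fun s i => ζ s i ω) k
        S.x i - η • g i (S.x i) (ξ (k + 1) i ω) - S.d i)
      (fun k i ω =>
        let S := iterate G W α γ η g Q xinit H₀ (fun s i => ξ s i ω) (fun s i => ζ s i ω) k
        Q (S.x i - η • g i (S.x i) (ξ (k + 1) i ω) - S.d i - S.h i) (ζ k i ω)
          - (S.x i - η • g i (S.x i) (ξ (k + 1) i ω) - S.d i - S.h i)) := by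
  refine ⟨fun _ _ => rfl, fun _ _ => rfl, fun _ _ => rfl, fun _ _ _ => rfl, fun _ _ _ => rfl,
    fun k i ω => ?_, fun k i ω => ?_, fun k i ω => ?_⟩
  · rw [iterate]
    simp only [step, comm, hW.mix_eq, hW.iterate_hw]
    rw [← Finset.sum_add_distrib]
    congr 2
    congr 1
    · abel
    · refine Finset.sum_congr rfl fun j _ => ?_
      rw [← smul_add]
      congr 1
      abel
  · dsimp only
    rw [iterate]
    simp only [step]
    abel
  · dsimp only
    rw [iterate]
    simp only [step, comm]
    module

namespace IsTrajectory

variable {X D H Y E : ℕ → Fin n → Ω → Vec p} {f : Fin n → Vec p → ℝ} {L σ C : ℝ}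
  {flow : Fin n → ℝ}
  (T : IsTrajectory W α γ η g Q xinit H₀ ξ ζ X D H Y E)
  (hf : IsSmoothBddBelow f L flow) (hS : IsSampling P ξ ζ)
  (hg : ∀ t i, IsStochasticGradient (f i) σ (g i) (P.map (ξ t i)))
  (hC : 0 ≤ C) (hQ : ∀ k i, IsUnbiasedCompressor C Q (P.map (ζ k i)))

section Measurability
include T hg

theorem measurable_y_of {m : MeasurableSpace Ω} {k : ℕ} {i : Fin n} (hX : Measurable[m] (X k i))
    (hD : Measurable[m] (D k i)) (hξ : Measurable[m] (ξ (k + 1) i)) : Measurable[m] (Y k i) := by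
  rw [show Y k i = _ from funext (T.y_eq k i)]
  exact (hX.sub ((((hg 0 i).measurable).comp (hX.prodMk hξ)).const_smul η)).sub hD

include hQ

theorem measurable_e_of {m : MeasurableSpace Ω} {k : ℕ} {i : Fin n} (hY : Measurable[m] (Y k i))
    (hH : Measurable[m] (H k i)) (hζ : Measurable[m] (ζ k i)) : Measurable[m] (E k i) := by
  rw [show E k i = _ from funext (T.e_eq k i)]
  exact (((hQ 0 i).measurable).comp ((hY.sub hH).prodMk hζ)).sub (hY.sub hH)

/-- The iterates are functions of the past samples. -/
theorem measurable_past (k : ℕ) : ∀ i, Measurable[past ξ ζ (k + 1) k] (X k i)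
    ∧ Measurable[past ξ ζ (k + 1) k] (D k i) ∧ Measurable[past ξ ζ (k + 1) k] (H k i) := by
  induction k with
  | zero =>
    intro i
    refine ⟨?_, ?_, ?_⟩
    · rw [show X 0 i = _ from funext (T.x_zero i)]
      exact measurable_const.sub ((((hg 0 i).measurable).comp
        (measurable_const.prodMk (measurable_past_grad zero_lt_one i))).const_smul η)
    · rw [show D 0 i = _ from funext (T.d_zero i)]
      exact measurable_const
    · rw [show H 0 i = _ from funext (T.h_zero i)]
      exact measurable_const
  | succ k ih =>
    have hle : past ξ ζ (k + 1) k ≤ past ξ ζ (k + 1 + 1) (k + 1) :=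
      past_mono (Nat.le_succ _) (Nat.le_succ _)
    have hX := fun i => ((ih i).1).mono hle le_rfl
    have hD := fun i => ((ih i).2.1).mono hle le_rfl
    have hH := fun i => ((ih i).2.2).mono hle le_rfl
    have hY := fun i => T.measurable_y_of hg (hX i) (hD i)
      (measurable_past_grad (Nat.lt_succ_self _) i)
    have hE := fun i => T.measurable_e_of hg hQ (hY i) (hH i)
      (measurable_past_comp (Nat.lt_succ_self _) i)
    have hD' : ∀ i, Measurable[past ξ ζ (k + 1 + 1) (k + 1)] (D (k + 1) i) := fun i => by
      rw [show D (k + 1) i = _ from funext (T.d_succ k i)]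
      exact (hD i).add ((((hY i).add (hE i)).sub (Finset.measurable_fun_sum _ fun j _ =>
        ((hY j).add (hE j)).const_smul (W i j))).const_smul (γ / 2))
    refine fun i => ⟨?_, hD' i, ?_⟩
    · rw [show X (k + 1) i = _ from funext (T.x_succ k i)]
      exact ((hY i).add (hD i)).sub (hD' i)
    · rw [show H (k + 1) i = _ from funext (T.h_succ k i)]
      exact (hH i).add ((((hY i).add (hE i)).sub (hH i)).const_smul α)

/-- Forming `Y k` consumes the sample `ξ (k + 1)`, so the first index of the past rises to `k + 2`,
while the seed `ζ k` is not yet drawn. -/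
theorem measurable_y (k : ℕ) (i : Fin n) : Measurable[past ξ ζ (k + 2) k] (Y k i) := by
  have hle : past ξ ζ (k + 1) k ≤ past ξ ζ (k + 2) k := past_mono (Nat.le_succ _) le_rfl
  obtain ⟨hX, hD, -⟩ := T.measurable_past hg hQ k i
  exact T.measurable_y_of hg (hX.mono hle le_rfl) (hD.mono hle le_rfl)
    (measurable_past_grad (Nat.lt_succ_self _) i)

theorem measurable_y_sub_h (k : ℕ) (i : Fin n) :
    Measurable[past ξ ζ (k + 2) k] (fun ω => Y k i ω - H k i ω) :=
  (T.measurable_y hg hQ k i).sub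
    ((T.measurable_past hg hQ k i).2.2.mono (past_mono (Nat.le_succ _) le_rfl) le_rfl)

end Measurability

section MemLp
include T hf hS hg

theorem y_eq_noise (k : ℕ) (i : Fin n) : Y k i = fun ω => X k i ω
    - η • (gradient (f i) (X k i ω) + noise f g i (X k i) (ξ (k + 1) i) ω) - D k i ω := by
  funext ω
  rw [T.y_eq, noise, add_sub_cancel]

include hQ

theorem memLp_y_of {k : ℕ} {i : Fin n} (hX : MemLp (X k i) 2 P) (hD : MemLp (D k i) 2 P) :
    MemLp (Y k i) 2 P := by
  rw [T.y_eq_noise hf hS hg]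
  exact (hX.sub (((hf.memLp_gradient i hX).add
    (memLp_noise hf hS hg (k + 1) i (T.measurable_past hg hQ k i).1)).const_smul η)).sub hD

include hC

theorem memLp_e_of {k : ℕ} {i : Fin n} (hY : MemLp (Y k i) 2 P) (hH : MemLp (H k i) 2 P) :
    MemLp (E k i) 2 P := by
  rw [show E k i = _ from funext (T.e_eq k i)]
  exact memLp_compress hS hC hQ k i (T.measurable_y_sub_h hg hQ k i) (hY.sub hH)

/-- Square integrability propagates because Lipschitz gradients grow at most linearly and both kinds
of noise have finite second moment at square integrable past-measurable points. -/
theorem memLp (k : ℕ) : ∀ i, MemLp (X k i) 2 P ∧ MemLp (D k i) 2 P ∧ MemLp (H k i) 2 P := by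
  induction k with
  | zero =>
    intro i
    refine ⟨?_, ?_, ?_⟩
    · have h : X 0 i = fun ω => xinit i
          - η • (gradient (f i) (xinit i) + noise f g i (fun _ => xinit i) (ξ 0 i) ω) := by
        funext ω
        rw [T.x_zero, noise, add_sub_cancel]
      rw [h]
      have h1 : MemLp (fun _ : Ω => xinit i) 2 P := memLp_const _
      have h2 : MemLp (fun _ : Ω => gradient (f i) (xinit i)) 2 P := memLp_const _
      exact h1.sub ((h2.add (memLp_noise hf hS hg 0 i measurable_const)).const_smul η)
    · rw [show D 0 i = fun _ => 0 from funext (T.d_zero i)]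
      exact memLp_const _
    · rw [show H 0 i = fun _ => H₀ i from funext (T.h_zero i)]
      exact memLp_const _
  | succ k ih =>
    have hX := fun i => (ih i).1
    have hD := fun i => (ih i).2.1
    have hH := fun i => (ih i).2.2
    have hY := fun i => T.memLp_y_of hf hS hg hQ (hX i) (hD i)
    have hE := fun i => T.memLp_e_of hf hS hg hC hQ (hY i) (hH i)
    have hD' : ∀ i, MemLp (D (k + 1) i) 2 P := fun i => by
      rw [show D (k + 1) i = _ from funext (T.d_succ k i)]
      exact (hD i).add ((((hY i).add (hE i)).sub (memLp_finsetSum _ fun j _ =>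
        ((hY j).add (hE j)).const_smul (W i j))).const_smul (γ / 2))
    refine fun i => ⟨?_, hD' i, ?_⟩
    · rw [show X (k + 1) i = _ from funext (T.x_succ k i)]
      exact ((hY i).add (hD i)).sub (hD' i)
    · rw [show H (k + 1) i = _ from funext (T.h_succ k i)]
      exact (hH i).add ((((hY i).add (hE i)).sub (hH i)).const_smul α)

theorem memLp_x (k : ℕ) (i : Fin n) : MemLp (X k i) 2 P := (T.memLp hf hS hg hC hQ k i).1
theorem memLp_d (k : ℕ) (i : Fin n) : MemLp (D k i) 2 P := (T.memLp hf hS hg hC hQ k i).2.1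
theorem memLp_h (k : ℕ) (i : Fin n) : MemLp (H k i) 2 P := (T.memLp hf hS hg hC hQ k i).2.2
theorem memLp_y (k : ℕ) (i : Fin n) : MemLp (Y k i) 2 P :=
  T.memLp_y_of hf hS hg hQ (T.memLp_x hf hS hg hC hQ k i) (T.memLp_d hf hS hg hC hQ k i)
theorem memLp_e (k : ℕ) (i : Fin n) : MemLp (E k i) 2 P :=
  T.memLp_e_of hf hS hg hC hQ (T.memLp_y hf hS hg hC hQ k i) (T.memLp_h hf hS hg hC hQ k i)

end MemLp

end IsTrajectory

/-- The average of square integrable random vectors, as an element of `L²`. -/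
theorem memLp_avg {X : Fin n → Ω → Vec p} (hX : ∀ i, MemLp (X i) 2 P) :
    MemLp (fun ω => avg fun i => X i ω) 2 P :=
  (memLp_finsetSum Finset.univ fun i _ => hX i).const_smul ((n : ℝ)⁻¹)

theorem mean_toLp {X : Fin n → Ω → Vec p} (hX : ∀ i, MemLp (X i) 2 P) :
    mean (fun i => (hX i).toLp (X i)) = (memLp_avg hX).toLp _ := by
  rw [mean, ← toLp_sum Finset.univ hX (memLp_finsetSum _ fun i _ => hX i), ← MemLp.toLp_const_smul]
  rfl

theorem measurable_avg {m : MeasurableSpace Ω} {X : Fin n → Ω → Vec p}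
    (hX : ∀ i, Measurable[m] (X i)) : Measurable[m] (fun ω => avg fun i => X i ω) :=
  (Finset.measurable_fun_sum Finset.univ fun i _ => hX i).const_smul ((n : ℝ)⁻¹)

namespace IsTrajectory

variable {X D H Y E : ℕ → Fin n → Ω → Vec p} {f : Fin n → Vec p → ℝ} {L σ C : ℝ}
  {flow : Fin n → ℝ}
  (T : IsTrajectory W α γ η g Q xinit H₀ ξ ζ X D H Y E)
  (hf : IsSmoothBddBelow f L flow) (hS : IsSampling P ξ ζ)
  (hg : ∀ t i, IsStochasticGradient (f i) σ (g i) (P.map (ξ t i)))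
  (hC : 0 ≤ C) (hQ : ∀ k i, IsUnbiasedCompressor C Q (P.map (ζ k i)))

/-- The gradient noise of iteration `k` uses the sample of index `k + 1`. The two families of
subspaces are the vectors measurable just before that sample and just before the seed `ζ k`. -/
theorem isRun : IsRun W α γ η L σ C
    (fun k i => (T.memLp_x hf hS hg hC hQ k i).toLp _)
    (fun k i => (T.memLp_d hf hS hg hC hQ k i).toLp _)
    (fun k i => (T.memLp_h hf hS hg hC hQ k i).toLp _)
    (fun k i => (T.memLp_y hf hS hg hC hQ k i).toLp _)
    (fun k i => (hf.memLp_gradient i (T.memLp_x hf hS hg hC hQ k i)).toLp _)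
    (fun k i => (hf.memLp_gradient i (memLp_avg (T.memLp_x hf hS hg hC hQ k))).toLp _)
    (fun k i => (memLp_noise hf hS hg (k + 1) i (T.measurable_past hg hQ k i).1).toLp _)
    (fun k i => (T.memLp_e hf hS hg hC hQ k i).toLp _)
    (fun k => lpMeas (Vec p) ℝ (past ξ ζ (k + 1) k) 2 P)
    (fun k => lpMeas (Vec p) ℝ (past ξ ζ (k + 2) k) 2 P) where
  y_eq k i := by
    rw [← MemLp.toLp_add, ← MemLp.toLp_const_smul, ← MemLp.toLp_sub, ← MemLp.toLp_sub]
    exact MemLp.toLp_congr _ _ (Filter.Eventually.of_forall fun ω =>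
      congrFun (T.y_eq_noise hf hS hg k i) ω)
  d_zero i := by
    rw [← MemLp.toLp_zero (MemLp.zero' (p := 2) (μ := P))]
    exact MemLp.toLp_congr _ _ (Filter.Eventually.of_forall fun ω => T.d_zero i ω)
  d_succ k i := by
    simp_rw [← MemLp.toLp_add, ← MemLp.toLp_const_smul]
    rw [← toLp_sum Finset.univ (fun j => (((T.memLp_y hf hS hg hC hQ k j).add
      (T.memLp_e hf hS hg hC hQ k j)).const_smul (W i j))) (memLp_finsetSum _ fun j _ =>
      (((T.memLp_y hf hS hg hC hQ k j).add (T.memLp_e hf hS hg hC hQ k j)).const_smul (W i j))),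
      ← MemLp.toLp_sub, ← MemLp.toLp_const_smul, ← MemLp.toLp_add]
    exact MemLp.toLp_congr _ _ (Filter.Eventually.of_forall fun ω => T.d_succ k i ω)
  x_succ k i := by
    rw [← MemLp.toLp_add, ← MemLp.toLp_sub]
    exact MemLp.toLp_congr _ _ (Filter.Eventually.of_forall fun ω => T.x_succ k i ω)
  h_succ k i := by
    rw [← MemLp.toLp_add, ← MemLp.toLp_sub, ← MemLp.toLp_const_smul, ← MemLp.toLp_add]
    exact MemLp.toLp_congr _ _ (Filter.Eventually.of_forall fun ω => T.h_succ k i ω)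
  lip k i := by
    rw [mean_toLp]
    exact norm_toLp_sub_le_mul _ _ _ _ fun ω => hf.lipschitz i _ _
  lip_mean k i := by
    rw [mean_toLp, mean_toLp]
    exact norm_toLp_sub_le_mul _ _ _ _ fun ω => hf.lipschitz i _ _
  x_mem k i := toLp_mem_lpMeas _ (T.measurable_past hg hQ k i).1
  d_mem k i := toLp_mem_lpMeas _ (T.measurable_past hg hQ k i).2.1
  gr_mem k i := toLp_mem_lpMeas _
    ((hf.measurable_gradient i).comp (T.measurable_past hg hQ k i).1)
  gb_mem k i := toLp_mem_lpMeas _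
    ((hf.measurable_gradient i).comp (measurable_avg fun i => (T.measurable_past hg hQ k i).1))
  s_orth k i v hv := inner_noise_eq_zero hf hS hg (k + 1) i (T.measurable_past hg hQ k i).1 v hv
  s_pair k i j hij := inner_noise_noise_eq_zero hf hS hg (k + 1) hij
    (T.measurable_past hg hQ k i).1 (T.measurable_past hg hQ k j).1
  s_sq k i := norm_noise_sq_le hf hS hg (k + 1) i (T.measurable_past hg hQ k i).1
  le k v hv := by
    rw [mem_lpMeas_iff_aestronglyMeasurable] at hv ⊢
    exact hv.mono (past_mono (Nat.le_succ _) le_rfl)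
  s_mem k i := toLp_mem_lpMeas _ (measurable_noise hf (hg 0 i)
    ((T.measurable_past hg hQ k i).1.mono (past_mono (Nat.le_succ _) le_rfl) le_rfl)
    (measurable_past_grad (Nat.lt_succ_self _) i))
  h_mem k i := toLp_mem_lpMeas _
    ((T.measurable_past hg hQ k i).2.2.mono (past_mono (Nat.le_succ _) le_rfl) le_rfl)
  e_orth k i v hv := by
    have h := inner_compress_eq_zero hS hC hQ k i (T.measurable_y_sub_h hg hQ k i)
      ((T.memLp_y hf hS hg hC hQ k i).sub (T.memLp_h hf hS hg hC hQ k i)) v hv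
    rw [← h]
    congr 1
    exact MemLp.toLp_congr _ _ (Filter.Eventually.of_forall fun ω => T.e_eq k i ω)
  e_sq k i := by
    have h := norm_compress_sq_le hS hC hQ k i (T.measurable_y_sub_h hg hQ k i)
      ((T.memLp_y hf hS hg hC hQ k i).sub (T.memLp_h hf hS hg hC hQ k i))
    rw [← MemLp.toLp_sub]
    refine le_trans (le_of_eq ?_) h
    congr 2
    exact MemLp.toLp_congr _ _ (Filter.Eventually.of_forall fun ω => T.e_eq k i ω)

end IsTrajectory

end Trajectory

/-! ### Errors after the initial step -/

section Initial

set_option linter.unusedSectionVars false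

variable {n : ℕ} {𝓗 : Type*} [NormedAddCommGroup 𝓗] [InnerProductSpace ℝ 𝓗]
  {W : Matrix (Fin n) (Fin n) ℝ} {U : Fin n → Fin n → ℝ} {lam : Fin n → ℝ} {l₀ : Fin n}
  {lam₂ α γ η L σ C β : ℝ} {x d h y gr gb s e : ℕ → Fin n → 𝓗} {𝓐 𝓑 : ℕ → Submodule ℝ 𝓗}

theorem norm_sub_sq_le_three (a b c : 𝓗) :
    ‖a - (b + c)‖ ^ 2 ≤ 3 * (‖a‖ ^ 2 + ‖b‖ ^ 2 + ‖c‖ ^ 2) := by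
  have h1 := norm_sub_sq_le_young a (b + c) (t := 2) (by norm_num)
  have h2 := norm_add_sq_le_two b c
  linarith

/-- With `d = 0` the centered dual variable is the whole gradient disagreement times `η`, weighted
by up to `1/β`. This is the origin of the `‖∇F(x₋₁)‖` entry of the transient time. -/
theorem lyap_le (hU : IsSpectralFrame W U lam l₀ lam₂) (hβ : β = γ * (1 - lam₂) / 2)
    (hβ0 : 0 < β) (hγ0 : 0 < γ) (x d gb : Fin n → 𝓗) (hd : ∀ i, d i = 0) :
    lyap U lam l₀ γ η x d gb ≤ nsq x + 1 / β * (η ^ 2 * nsq gb) := by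
  have h1 : lyap U lam l₀ γ η x d gb ≤ dsq U l₀ x + 1 / β * dsq U l₀ (dual η d gb) := by
    rw [dsq, dsq, Finset.mul_sum, ← Finset.sum_add_distrib]
    refine Finset.sum_le_sum fun l hl => ?_
    have h1 := hU.le_rate hγ0.le (Finset.ne_of_mem_erase hl)
    have h2 : 1 / rate γ lam l ≤ 1 / β := one_div_le_one_div_of_le hβ0 (hβ ▸ h1)
    have h3 : 1 / rate γ lam l - 1 ≤ 1 / β := by linarith
    gcongr
  have h2 : nsq (dual η d gb) ≤ η ^ 2 * nsq gb := by
    have h3 : nsq (dual η d gb) = η ^ 2 * nsq fun i => gb i - mean gb := by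
      rw [nsq, nsq, Finset.mul_sum]
      refine Finset.sum_congr rfl fun i _ => ?_
      rw [dual, hd, zero_add, norm_smul, mul_pow, Real.norm_eq_abs, sq_abs]
    rw [h3]
    have := nsq_sub_mean_le (Fin.pos l₀) gb
    gcongr
  have h3 := hU.dsq_le_nsq x
  have h4 := (hU.dsq_le_nsq (dual η d gb)).trans h2
  have h5 : 1 / β * dsq U l₀ (dual η d gb) ≤ 1 / β * (η ^ 2 * nsq gb) := by gcongr
  linarith

/-- The errors after the initial stochastic gradient step. -/
theorem IsRun.initial_error_le (R : IsRun W α γ η L σ C x d h y gr gb s e 𝓐 𝓑)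
    (hU : IsSpectralFrame W U lam l₀ lam₂) (hβ : β = γ * (1 - lam₂) / 2)
    (hβ0 : 0 < β) (hβ1 : β ≤ 1 / 2) (hγ0 : 0 < γ) (hη : 64 * (η ^ 2 * L ^ 2) ≤ β ^ 2)
    {xi gi si Hi : Fin n → 𝓗} (hx : ∀ i, x 0 i = xi i - η • (gi i + si i))
    (hh : ∀ i, h 0 i = Hi i) (hsi : ∀ i, ‖si i‖ ^ 2 ≤ σ ^ 2)
    (hgr : ∀ i, ‖gr 0 i - gi i‖ ≤ L * ‖x 0 i - xi i‖)
    (hgb : ∀ i, ‖gb 0 i - gi i‖ ≤ L * ‖mean (x 0) - xi i‖) :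
    lyap U lam l₀ γ η (x 0) (d 0) (gb 0) + nsq (fun i => y 0 i - h 0 i)
      ≤ 16 * nsq xi + 14 / β * (η ^ 2 * nsq gi) + 20 * (η ^ 2 * (n * σ ^ 2)) + 4 * nsq Hi := by
  have hsi' : nsq si ≤ n * σ ^ 2 := by
    simpa [nsq] using Finset.sum_le_sum (s := Finset.univ) fun i _ => hsi i
  have hX : nsq (x 0) ≤ 3 * (nsq xi + η ^ 2 * nsq gi + η ^ 2 * nsq si) := by
    have h1 := Finset.sum_le_sum (s := Finset.univ) fun i _ =>
      norm_sub_sq_le_three (xi i) (η • gi i) (η • si i)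
    simp only [← smul_add, ← hx, norm_smul, mul_pow, Real.norm_eq_abs, sq_abs, ← Finset.mul_sum,
      Finset.sum_add_distrib] at h1
    exact h1
  -- Gradients at `x 0` and at its average are both compared with those at the starting point; the
  -- resulting `L²` terms are later made small by `η²L² ≤ β/128`.
  have aux : ∀ (u v : Fin n → 𝓗), (∀ i, ‖u i - gi i‖ ≤ L * ‖v i - xi i‖) →
      nsq u ≤ 2 * nsq gi + 4 * (L ^ 2 * (nsq v + nsq xi)) := by
    intro u v huv
    simp only [nsq]
    rw [← Finset.sum_add_distrib, Finset.mul_sum, Finset.mul_sum, Finset.mul_sum,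
      ← Finset.sum_add_distrib]
    refine Finset.sum_le_sum fun i _ => ?_
    have h1 := norm_add_sq_le_two (u i - gi i) (gi i)
    rw [sub_add_cancel] at h1
    have h2 := pow_le_pow_left₀ (norm_nonneg _) (huv i) 2
    rw [mul_pow] at h2
    have h3 := mul_le_mul_of_nonneg_left (norm_sub_sq_le_two (v i) (xi i)) (sq_nonneg L)
    linarith
  have hG := aux (gr 0) (x 0) hgr
  have hB := aux (gb 0) (fun _ => mean (x 0)) hgb
  have hm : nsq (fun _ : Fin n => mean (x 0)) ≤ nsq (x 0) := by
    have := norm_mean_sq_le (x 0)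
    simpa [nsq] using this
  have hY : nsq (fun i => y 0 i - h 0 i)
      ≤ 4 * (nsq (x 0) + η ^ 2 * nsq (gr 0) + η ^ 2 * nsq (s 0) + nsq Hi) := by
    simp only [nsq]
    rw [Finset.mul_sum, Finset.mul_sum, ← Finset.sum_add_distrib, ← Finset.sum_add_distrib,
      ← Finset.sum_add_distrib, Finset.mul_sum]
    refine Finset.sum_le_sum fun i _ => ?_
    have e1 : y 0 i - h 0 i = (x 0 i - η • gr 0 i) - (η • s 0 i + Hi i) := by
      rw [R.y_eq, R.d_zero, hh]; module
    rw [e1]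
    have h1 := norm_sub_sq_le_two (x 0 i - η • gr 0 i) (η • s 0 i + Hi i)
    have h2 := norm_sub_sq_le_two (x 0 i) (η • gr 0 i)
    have h3 := norm_add_sq_le_two (η • s 0 i) (Hi i)
    simp only [norm_smul, mul_pow, Real.norm_eq_abs, sq_abs] at h2 h3
    linarith
  have hV := lyap_le (η := η) hU hβ hβ0 hγ0 (x 0) (d 0) (gb 0) R.d_zero
  have hS := R.nsq_s 0
  have x0 : 0 ≤ nsq xi := nsq_nonneg _
  have X0 : 0 ≤ nsq (x 0) := nsq_nonneg _
  have hF0 : 0 ≤ η ^ 2 * nsq gi := mul_nonneg (sq_nonneg _) (nsq_nonneg _)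
  have hN0 : 0 ≤ η ^ 2 * (n * σ ^ 2) := by positivity
  have i1 : η ^ 2 * nsq si ≤ η ^ 2 * (n * σ ^ 2) := by gcongr
  have i2 : η ^ 2 * nsq (s 0) ≤ η ^ 2 * (n * σ ^ 2) := by gcongr
  have hβ2 : η ^ 2 * L ^ 2 ≤ β / 128 := by nlinarith
  have i3 : (η ^ 2 * L ^ 2) * (nsq (x 0) + nsq xi) ≤ β / 128 * (nsq (x 0) + nsq xi) := by gcongr
  have i4 : η ^ 2 * nsq (gr 0) ≤ 2 * (η ^ 2 * nsq gi) + β / 32 * (nsq (x 0) + nsq xi) := by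
    have := mul_le_mul_of_nonneg_left hG (sq_nonneg η)
    linarith
  have i5 : η ^ 2 * nsq (gb 0) ≤ 2 * (η ^ 2 * nsq gi) + β / 32 * (nsq (x 0) + nsq xi) := by
    have h1 := mul_le_mul_of_nonneg_left hB (sq_nonneg η)
    have h2 := mul_le_mul_of_nonneg_left hm (show 0 ≤ η ^ 2 * L ^ 2 by positivity)
    linarith
  have i6 : 1 / β * (η ^ 2 * nsq (gb 0))
      ≤ 2 / β * (η ^ 2 * nsq gi) + 1 / 32 * (nsq (x 0) + nsq xi) := by
    calc _ ≤ 1 / β * (2 * (η ^ 2 * nsq gi) + β / 32 * (nsq (x 0) + nsq xi)) := by gcongr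
      _ = _ := by field_simp
  have i7 : 2 * (η ^ 2 * nsq gi) ≤ 1 / β * (η ^ 2 * nsq gi) := by
    gcongr
    rw [le_div_iff₀ hβ0]; linarith
  have i8 : β / 32 * (nsq (x 0) + nsq xi) ≤ 1 / 64 * (nsq (x 0) + nsq xi) :=
    mul_le_mul_of_nonneg_right (by linarith) (add_nonneg X0 x0)
  have e2 : 2 / β * (η ^ 2 * nsq gi) = 2 * (1 / β * (η ^ 2 * nsq gi)) := by ring
  have e14 : 14 / β * (η ^ 2 * nsq gi) = 14 * (1 / β * (η ^ 2 * nsq gi)) := by ring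
  rw [e2] at i6
  rw [e14]
  linarith

end Initial

/-! ### Arithmetic of the horizon -/

section Arithmetic

/-- The bound on the accumulated gradients, for horizons past the transient time. -/
theorem error_le_of_horizon {n K R η β L σ Δ x F H V φ₀ S : ℝ} (hn : 2 ≤ n) (hR : 0 < R)
    (hη : η * R = n) (hK : n * K = R ^ 2) (hβ0 : 0 < β) (hβ1 : β ≤ 1 / 2) (hL : 0 < L)
    (hnR : n ^ 2 ≤ 2 * β * R) (hx : x ≤ 2 * β * R) (hH : H ≤ 2 * β * R)
    (hF : η ^ 2 * F ≤ 4 * β ^ 2 * R)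
    (hφ : φ₀ ≤ Δ + η * L ^ 2 / (2 * n) * x + L * η ^ 2 * σ ^ 2 / (2 * n))
    (hV : V ≤ 16 * x + 14 / β * (η ^ 2 * F) + 20 * (η ^ 2 * (n * σ ^ 2)) + 4 * H)
    (hS : S ≤ 4 / η * φ₀ + 8 * L ^ 2 / (n * β) * V + 16 * L ^ 2 / β * (K * (η ^ 2 * σ ^ 2))
      + 2 * (K * (L * η * σ ^ 2 / n))) :
    S ≤ (4 * (Δ + L ^ 2 + L * σ ^ 2) + 8 * L ^ 2 * (96 + 20 * σ ^ 2) + 32 * L ^ 2 * σ ^ 2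
      + 2 * L * σ ^ 2) * (R / n) := by
  have hn0 : 0 < n := by linarith
  have eη : η = n / R := by rw [eq_div_iff hR.ne', hη]
  have eK : K = R ^ 2 / n := by rw [eq_div_iff hn0.ne', ← hK]; ring
  have hβR : 2 * β * R ≤ R := mul_le_of_le_one_left hR.le (by linarith)
  have hη0 : 0 < η := by rw [eη]; positivity
  -- Here `ηn = n²/R ≤ 2β`, and `n ≥ 2` gives `η ≤ β ≤ 1/2`.
  have hη2 : η ^ 2 * n ≤ β := by
    have h1 : η * n ≤ 2 * β := by
      rw [eη, div_mul_eq_mul_div, div_le_iff₀ hR]; linarith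
    have h2 : η * 2 ≤ η * n := by gcongr
    have h3 : η ≤ 1 / 2 := by linarith
    calc η ^ 2 * n = η * (η * n) := by ring
      _ ≤ 1 / 2 * (2 * β) := by gcongr
      _ = β := by ring
  have hR1 : 1 ≤ R := by nlinarith
  have t1 : 4 / η * φ₀ ≤ 4 * (Δ + L ^ 2 + L * σ ^ 2) * (R / n) := by
    have h1 : η * L ^ 2 / (2 * n) * x ≤ L ^ 2 := by
      have : η * L ^ 2 / (2 * n) * x = L ^ 2 * (x / (2 * R)) := by rw [eη]; field_simp
      rw [this]
      refine mul_le_of_le_one_right (sq_nonneg _) ?_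
      rw [div_le_one (by positivity)]; linarith
    have h2 : L * η ^ 2 * σ ^ 2 / (2 * n) ≤ L * σ ^ 2 := by
      rw [div_le_iff₀ (by positivity)]
      have h3 : η ^ 2 ≤ 1 := by
        have : η ^ 2 * 1 ≤ η ^ 2 * n := by gcongr; linarith
        linarith
      have h4 : L * σ ^ 2 * η ^ 2 ≤ L * σ ^ 2 * 1 := by gcongr
      have h5 : L * σ ^ 2 * 1 ≤ L * σ ^ 2 * (2 * n) := by gcongr; linarith
      linarith
    calc 4 / η * φ₀ ≤ 4 / η * (Δ + L ^ 2 + L * σ ^ 2) := by gcongr; linarith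
      _ = _ := by rw [eη]; field_simp
  have t2 : 8 * L ^ 2 / (n * β) * V ≤ 8 * L ^ 2 * (96 + 20 * σ ^ 2) * (R / n) := by
    have h1 : V ≤ β * R * (96 + 20 * σ ^ 2) := by
      have h2 : 14 / β * (η ^ 2 * F) ≤ 14 / β * (4 * β ^ 2 * R) := by gcongr
      have h3 : 14 / β * (4 * β ^ 2 * R) = 56 * (β * R) := by field_simp; ring
      have h4 : η ^ 2 * n * σ ^ 2 ≤ β * R * σ ^ 2 :=
        mul_le_mul_of_nonneg_right (hη2.trans (le_mul_of_one_le_right hβ0.le hR1)) (sq_nonneg σ)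
      linarith
    calc 8 * L ^ 2 / (n * β) * V ≤ 8 * L ^ 2 / (n * β) * (β * R * (96 + 20 * σ ^ 2)) := by gcongr
      _ = _ := by field_simp
  have t3 : 16 * L ^ 2 / β * (K * (η ^ 2 * σ ^ 2)) ≤ 32 * L ^ 2 * σ ^ 2 * (R / n) := by
    have h1 : 16 * L ^ 2 / β * (K * (η ^ 2 * σ ^ 2)) = 16 * L ^ 2 * σ ^ 2 * (n / β) := by
      rw [eη, eK]; field_simp
    -- This is equivalent to `n² ≤ 2βR`: the noise accumulated in the consensus error is what
    -- demands a horizon of order `n³/β²`.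
    have h2 : n / β ≤ 2 * (R / n) := by
      rw [← mul_div_assoc, div_le_div_iff₀ hβ0 hn0]; linarith
    have h3 : 16 * L ^ 2 * σ ^ 2 * (n / β) ≤ 16 * L ^ 2 * σ ^ 2 * (2 * (R / n)) := by gcongr
    linarith
  have t4 : 2 * (K * (L * η * σ ^ 2 / n)) = 2 * L * σ ^ 2 * (R / n) := by
    rw [eη, eK]; field_simp
  linarith

/-- A horizon past the transient time dominates the network size and the initial values. -/
theorem bounds_of_horizon {n K R η β x F H : ℝ} (hn : 2 ≤ n) (hK0 : 0 < K) (hR : 0 < R)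
    (hηR : η * R = n) (hK : n * K = R ^ 2) (hβ0 : 0 < β)
    (h1 : n ^ 3 / (4 * β ^ 2) ≤ K) (h2 : x ^ 4 / (4 * n * β ^ 2) ≤ K)
    (h3 : H ^ 4 / (4 * n * β ^ 2) ≤ K)
    (h4 : (n * F ^ 4 / (16 * β ^ 4)) ^ ((1 : ℝ) / 3) ≤ K) :
    n ^ 2 ≤ 2 * β * R ∧ x ^ 2 ≤ 2 * β * R ∧ H ^ 2 ≤ 2 * β * R
      ∧ η ^ 2 * F ^ 2 ≤ 4 * β ^ 2 * R := by
  have hn0 : 0 < n := by linarith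
  have hpos : 0 ≤ 2 * β * R := by positivity
  have aux : ∀ a : ℝ, a ^ 4 / (4 * n * β ^ 2) ≤ K → a ^ 2 ≤ 2 * β * R := by
    intro a ha
    rw [div_le_iff₀ (by positivity)] at ha
    refine le_of_sq_le_sq ?_ hpos
    have : (2 * β * R) ^ 2 = K * (4 * n * β ^ 2) := by rw [mul_pow, ← hK]; ring
    rw [this]
    linarith
  refine ⟨aux n ?_, aux x h2, aux H h3, ?_⟩
  · have : n ^ 4 / (4 * n * β ^ 2) = n ^ 3 / (4 * β ^ 2) := by field_simp
    rw [this]; exact h1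
  -- Cubing undoes the exponent `1/3`; the relation `η²K = n` then converts the bound on `K³` into
  -- one on `η²F²`.
  · have h5 : n * F ^ 4 / (16 * β ^ 4) ≤ K ^ 3 := by
      have h6 : 0 ≤ n * F ^ 4 / (16 * β ^ 4) := by positivity
      have h7 := pow_le_pow_left₀ (Real.rpow_nonneg h6 _) h4 3
      rwa [← Real.rpow_natCast, ← Real.rpow_mul h6, show (1 : ℝ) / 3 * (3 : ℕ) = 1 by norm_num,
        Real.rpow_one] at h7
    rw [div_le_iff₀ (by positivity)] at h5
    have e1 : η ^ 2 * K = n := by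
      have : η ^ 2 * (n * K) = n ^ 2 := by rw [hK, ← hηR]; ring
      have h8 : n * (η ^ 2 * K) = n * n := by linarith
      exact mul_left_cancel₀ hn0.ne' h8
    refine le_of_sq_le_sq ?_ (by positivity)
    have h6 : K ^ 2 * (η ^ 2 * F ^ 2) ^ 2 ≤ K ^ 2 * (4 * β ^ 2 * R) ^ 2 := by
      calc K ^ 2 * (η ^ 2 * F ^ 2) ^ 2 = (η ^ 2 * K) ^ 2 * F ^ 4 := by ring
        _ = n * (n * F ^ 4) := by rw [e1]; ring
        _ ≤ n * (K ^ 3 * (16 * β ^ 4)) := by gcongr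
        _ = K ^ 2 * (16 * β ^ 4 * (n * K)) := by ring
        _ = K ^ 2 * (4 * β ^ 2 * R) ^ 2 := by rw [hK]; ring
    exact le_of_mul_le_mul_left h6 (by positivity)

end Arithmetic

/-! ### Expected descent and the transient time -/

section Main

set_option linter.unusedSectionVars false

variable {n p q : ℕ} {Ω Z : Type*} [mΩ : MeasurableSpace Ω] [MeasurableSpace Z]
  {P : Measure Ω} [IsProbabilityMeasure P] {f : Fin n → Vec p → ℝ} {L σ C : ℝ}
  {flow : Fin n → ℝ}

/-- The objective lies between its lower bound and the quadratic majorant at the origin, both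
integrable along a square integrable vector. -/
theorem IsSmoothBddBelow.integrable_avgFun (hf : IsSmoothBddBelow f L flow) (hn : 0 < n)
    {a : Ω → Vec p} (ha : MemLp a 2 P) : Integrable (fun ω => avgFun f (a ω)) P := by
  have h1 : Integrable (fun ω => avgFun f 0 + inner ℝ (gradient (avgFun f) 0) (a ω)
      + L / 2 * ‖a ω‖ ^ 2) P :=
    ((integrable_const _).add ((ha.integrable (by norm_num)).const_inner _)).add
      (((memLp_two_iff_integrable_sq_norm ha.1).1 ha).const_mul _)
  refine Integrable.mono' ((integrable_const |(n : ℝ)⁻¹ * ∑ i, flow i|).add h1.abs)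
    (hf.differentiable_avgFun.continuous.comp_aestronglyMeasurable ha.1)
    (Filter.Eventually.of_forall fun ω => ?_)
  have h2 := le_add_inner_add_of_lipschitz_gradient hf.differentiable_avgFun
    (hf.lipschitz_avgFun hn) 0 (a ω)
  have h3 := hf.lower_avgFun (a ω)
  rw [sub_zero] at h2
  rw [Real.norm_eq_abs, abs_le]
  simp only [Pi.add_apply]
  have h4 := neg_abs_le ((n : ℝ)⁻¹ * ∑ i, flow i)
  have h5 := le_abs_self (avgFun f 0 + inner ℝ (gradient (avgFun f) 0) (a ω) + L / 2 * ‖a ω‖ ^ 2)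
  have h6 := abs_nonneg ((n : ℝ)⁻¹ * ∑ i, flow i)
  have h7 := abs_nonneg
    (avgFun f 0 + inner ℝ (gradient (avgFun f) 0) (a ω) + L / 2 * ‖a ω‖ ^ 2)
  constructor <;> linarith

/-- The gradient of the average function, as the mean of the gradients in `L²`. -/
theorem IsSmoothBddBelow.mean_gradient_toLp (hf : IsSmoothBddBelow f L flow)
    {a : Ω → Vec p} (ha : MemLp a 2 P) (hG : MemLp (fun ω => gradient (avgFun f) (a ω)) 2 P) :
    mean (fun i => (hf.memLp_gradient i ha).toLp _) = hG.toLp _ := by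
  rw [mean_toLp]
  exact MemLp.toLp_congr _ _ (Filter.Eventually.of_forall fun ω => (hf.gradient_avgFun _).symm)

theorem IsSmoothBddBelow.memLp_gradient_avgFun (hf : IsSmoothBddBelow f L flow)
    {a : Ω → Vec p} (ha : MemLp a 2 P) : MemLp (fun ω => gradient (avgFun f) (a ω)) 2 P := by
  simp_rw [hf.gradient_avgFun]
  exact memLp_avg fun i => hf.memLp_gradient i ha

/-- The descent lemma in expectation. -/
theorem IsSmoothBddBelow.integral_avgFun_le (hf : IsSmoothBddBelow f L flow) (hn : 0 < n)
    {a b : Ω → Vec p} (ha : MemLp a 2 P) (hb : MemLp b 2 P) :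
    ∫ ω, avgFun f (b ω) ∂P ≤ ∫ ω, avgFun f (a ω) ∂P
      + inner ℝ (mean fun i => (hf.memLp_gradient i ha).toLp _) (hb.toLp b - ha.toLp a)
      + L / 2 * ‖hb.toLp b - ha.toLp a‖ ^ 2 := by
  have hG := hf.memLp_gradient_avgFun ha
  have hba := hb.sub ha
  rw [hf.mean_gradient_toLp ha hG, ← real_inner_self_eq_norm_sq, ← MemLp.toLp_sub, inner_toLp,
    inner_toLp, ← integral_const_mul]
  have i1 := hf.integrable_avgFun hn ha
  have i2 := integrable_inner_of_memLp hG hba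
  have i3 := (integrable_inner_of_memLp hba hba).const_mul (L / 2)
  have i12 : Integrable (fun ω => avgFun f (a ω)
      + inner ℝ (gradient (avgFun f) (a ω)) ((b - a) ω)) P := i1.add i2
  rw [← integral_add i1 i2, ← integral_add i12 i3]
  refine integral_mono (hf.integrable_avgFun hn hb) (i12.add i3) fun ω => ?_
  have := le_add_inner_add_of_lipschitz_gradient hf.differentiable_avgFun
    (hf.lipschitz_avgFun hn) (a ω) (b ω)
  simpa [real_inner_self_eq_norm_sq] using this

theorem norm_toLp_const_sq_le (v : Vec p) :
    ‖(memLp_const v : MemLp (fun _ : Ω => v) 2 P).toLp _‖ ^ 2 ≤ ‖v‖ ^ 2 := by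
  refine norm_toLp_sq_le _ (sq_nonneg _) (le_of_eq ?_)
  simp [ENNReal.ofReal_pow (norm_nonneg _), ofReal_norm]

theorem nsq_toLp_const_le (v : Stack n p) :
    nsq (fun i => (memLp_const (v i) : MemLp (fun _ : Ω => v i) 2 P).toLp _)
      ≤ stackNorm v ^ 2 := by
  rw [stackNorm, Real.sq_sqrt (Finset.sum_nonneg fun _ _ => sq_nonneg _), nsq]
  exact Finset.sum_le_sum fun i _ => norm_toLp_const_sq_le _

variable {G : SimpleGraph (Fin n)} {W : Matrix (Fin n) (Fin n) ℝ} {α γ η β lam₂ : ℝ}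
  {g : Fin n → Vec p → Vec q → Vec p} {Q : Vec p → Z → Vec p} {xinit H₀ : Stack n p}
  {ξ : ℕ → Fin n → Ω → Vec q} {ζ : ℕ → Fin n → Ω → Z}
  {X D H Y E : ℕ → Fin n → Ω → Vec p}
  {U : Fin n → Fin n → ℝ} {lam : Fin n → ℝ} {l₀ : Fin n}

namespace IsTrajectory

variable (T : IsTrajectory W α γ η g Q xinit H₀ ξ ζ X D H Y E)
  (hf : IsSmoothBddBelow f L flow) (hS : IsSampling P ξ ζ)
  (hg : ∀ t i, IsStochasticGradient (f i) σ (g i) (P.map (ξ t i)))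
  (hC : 0 ≤ C) (hQ : ∀ k i, IsUnbiasedCompressor C Q (P.map (ζ k i)))
include T hf hS hg

theorem x_zero_toLp (i : Fin n) (h0 : MemLp (X 0 i) 2 P) : h0.toLp _
    = (memLp_const (xinit i) : MemLp (fun _ : Ω => xinit i) 2 P).toLp _
      - η • ((memLp_const (gradient (f i) (xinit i)) :
          MemLp (fun _ : Ω => gradient (f i) (xinit i)) 2 P).toLp _
        + (memLp_noise hf hS hg 0 i (X := fun _ => xinit i) measurable_const).toLp _) := by
  rw [← MemLp.toLp_add, ← MemLp.toLp_const_smul, ← MemLp.toLp_sub]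
  refine MemLp.toLp_congr _ _ (Filter.Eventually.of_forall fun ω => ?_)
  change X 0 i ω = xinit i - η • (gradient (f i) (xinit i) + noise f g i _ (ξ 0 i) ω)
  rw [T.x_zero, noise, add_sub_cancel]

/-- The first stochastic gradient step decreases the objective. -/
theorem integral_avgFun_zero_le (hn : 0 < n) (hη0 : 0 < η) (hL : 0 ≤ L) (hηL : η * L ≤ 1)
    (hX : ∀ i, MemLp (X 0 i) 2 P) :
    ∫ ω, avgFun f (avg fun i => X 0 i ω) ∂P ≤ avgFun f (avg xinit)
      + η * L ^ 2 / (2 * n) * stackNorm xinit ^ 2 + L * η ^ 2 * σ ^ 2 / (2 * n) := by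
  let xi : Fin n → Lp (Vec p) 2 P := fun i =>
    (memLp_const (xinit i) : MemLp (fun _ : Ω => xinit i) 2 P).toLp _
  let gi : Fin n → Lp (Vec p) 2 P := fun i => (memLp_const (gradient (f i) (xinit i)) :
    MemLp (fun _ : Ω => gradient (f i) (xinit i)) 2 P).toLp _
  let si : Fin n → Lp (Vec p) 2 P := fun i =>
    (memLp_noise hf hS hg 0 i (X := fun _ => xinit i) measurable_const).toLp _
  have hci : ∀ i, MemLp (fun _ : Ω => xinit i) 2 P := fun i => memLp_const _
  have hca : MemLp (fun _ : Ω => avg xinit) 2 P := memLp_const _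
  let gb : Fin n → Lp (Vec p) 2 P := fun i => (hf.memLp_gradient i hca).toLp _
  have hmx : mean xi = hca.toLp _ := mean_toLp hci
  have h1 := hf.integral_avgFun_le hn hca (memLp_avg hX)
  have h2 : (memLp_avg hX).toLp _ - hca.toLp _ = -(η • (mean gi + mean si)) := by
    rw [← mean_toLp hX, ← hmx, ← mean_sub, ← mean_add, ← mean_smul]
    have : (fun i => (hX i).toLp (X 0 i) - xi i) = fun i => (-1 : ℝ) • (η • (gi i + si i)) := by
      funext i
      rw [T.x_zero_toLp hf hS hg i (hX i)]
      module
    rw [this, mean_smul, neg_one_smul]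
  -- At time zero `0 - 1 = 0`, so the past is generated by nothing; constants belong to its
  -- subspace, and the first step tests the noise only against constants.
  have hconst : ∀ v : Lp (Vec p) 2 P, ∀ c : Vec p, ∀ hc : MemLp (fun _ : Ω => c) 2 P,
      v = hc.toLp _ → v ∈ lpMeas (Vec p) ℝ (past ξ ζ 0 (0 - 1)) 2 P := by
    intro v c hc hv
    rw [hv]
    exact toLp_mem_lpMeas _ measurable_const
  have horth : ∀ i v, v ∈ lpMeas (Vec p) ℝ (past ξ ζ 0 (0 - 1)) 2 P → inner ℝ (si i) v = 0 :=
    fun i v hv => inner_noise_eq_zero hf hS hg 0 i measurable_const v hv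
  have hlip : n * ‖mean gi - mean gb‖ ^ 2 ≤ L ^ 2 * stackNorm xinit ^ 2 := by
    rw [← mean_sub]
    refine (norm_mean_sq_le _).trans ?_
    have h3 : nsq (fun i => gi i - gb i) ≤ L ^ 2 * nsq (fun i => xi i - mean xi) := by
      rw [nsq, nsq, Finset.mul_sum]
      refine Finset.sum_le_sum fun i _ => ?_
      rw [← mul_pow, hmx]
      exact pow_le_pow_left₀ (norm_nonneg _) (norm_toLp_sub_le_mul _ _ _ _
        fun ω => hf.lipschitz i _ _) 2
    refine h3.trans ?_
    have := (nsq_sub_mean_le hn xi).trans (nsq_toLp_const_le xinit)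
    gcongr
  have h4 := descent_of_orthogonal (a := gi) (b := gb) (s := si) hn hη0 hL hηL
    (fun i j hij => inner_noise_noise_eq_zero hf hS hg 0 hij measurable_const measurable_const)
    (fun i => norm_noise_sq_le hf hS hg 0 i measurable_const)
    (fun i => horth i _ (mean_mem fun j => hconst _ (gradient (f j) (avg xinit)) (memLp_const _)
      rfl))
    (fun i => horth i _ (mean_mem fun j => hconst _ _ (memLp_const _) rfl)) hlip
  rw [h2] at h1
  have h5 : ∫ _ω : Ω, avgFun f (avg xinit) ∂P = avgFun f (avg xinit) := by simp
  have h6 : 0 ≤ η / 2 * ‖mean gb‖ ^ 2 := by positivity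
  linarith

include hC hQ

/-- The accumulated squared gradients past the transient time. -/
theorem sum_norm_grad_le_of_horizon (hU : IsSpectralFrame W U lam l₀ lam₂)
    (hW : ∀ i, ∑ j, W i j = 1) (hs : ∀ i j, W i j = W j i)
    (hβ : β = γ * (1 - lam₂) / 2) (hβ0 : 0 < β) (hβγ : β ≤ γ) (hγ0 : 0 < γ) (hγ : γ ≤ 1 / 2)
    (hη : 64 * (η ^ 2 * L ^ 2) ≤ β ^ 2) (hα0 : 0 < α) (hα1 : α ≤ 1) (hαC : 12 * (α * C) ≤ 1)
    (hγα : 1728 * (γ * (γ * C)) ≤ 2 * (α ^ 2 * β)) (hη0 : 0 < η) (hL : 0 < L) (hn : 2 ≤ n)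
    {Δ R : ℝ} (hΔ : avgFun f (avg xinit) - (n : ℝ)⁻¹ * ∑ i, flow i ≤ Δ) (K : ℕ)
    (hR : 0 < R) (hηR : η * R = n) (hKR : n * ((K : ℝ) + 1) = R ^ 2)
    (hnR : (n : ℝ) ^ 2 ≤ 2 * β * R) (hxR : stackNorm xinit ^ 2 ≤ 2 * β * R)
    (hHR : stackNorm H₀ ^ 2 ≤ 2 * β * R)
    (hFR : η ^ 2 * stackNorm (stackGrad f xinit) ^ 2 ≤ 4 * β ^ 2 * R) :
    ∑ k ∈ Finset.range (K + 1),
      ‖mean fun i => (hf.memLp_gradient i (memLp_avg (T.memLp_x hf hS hg hC hQ k))).toLp _‖ ^ 2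
      ≤ (4 * (Δ + L ^ 2 + L * σ ^ 2) + 8 * L ^ 2 * (96 + 20 * σ ^ 2) + 32 * L ^ 2 * σ ^ 2
        + 2 * L * σ ^ 2) * (R / n) := by
  have hn0 : 0 < n := by omega
  have hβ1 : β ≤ 1 / 2 := hβγ.trans hγ
  have hηL : η * L ≤ 1 := by
    have : (η * L) ^ 2 ≤ 1 ^ 2 := by rw [mul_pow]; nlinarith
    exact le_of_sq_le_sq this (by norm_num)
  have hX := T.memLp_x hf hS hg hC hQ
  have run := T.isRun hf hS hg hC hQ
  have hφ : ∀ k, ∫ ω, avgFun f (avg fun i => X (k + 1) i ω) ∂P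
      ≤ ∫ ω, avgFun f (avg fun i => X k i ω) ∂P
        + inner ℝ (mean fun i => (hf.memLp_gradient i (memLp_avg (hX k))).toLp _)
          ((mean fun i => (hX (k + 1) i).toLp _) - mean fun i => (hX k i).toLp _)
        + L / 2 * ‖(mean fun i => (hX (k + 1) i).toLp _) - mean fun i => (hX k i).toLp _‖ ^ 2 := by
    intro k
    rw [mean_toLp (hX (k + 1)), mean_toLp (hX k)]
    exact hf.integral_avgFun_le hn0 (memLp_avg (hX k)) (memLp_avg (hX (k + 1)))
  have hinf : ∀ k, (n : ℝ)⁻¹ * ∑ i, flow i ≤ ∫ ω, avgFun f (avg fun i => X k i ω) ∂P := by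
    intro k
    have h := integral_mono (integrable_const ((n : ℝ)⁻¹ * ∑ i, flow i))
      (hf.integrable_avgFun hn0 (memLp_avg (hX k))) fun ω => hf.lower_avgFun _
    simpa using h
  have hsum := run.sum_norm_grad_le (φ := fun k => ∫ ω, avgFun f (avg fun i => X k i ω) ∂P)
    hU hW hs hβ hβ0 hβγ hγ0 hγ hC hη hα0 hα1 hαC hγα hη0 hL.le hφ hinf K
  have hinit := run.initial_error_le hU hβ hβ0 hβ1 hγ0 hη
    (xi := fun i => (memLp_const (xinit i) : MemLp (fun _ : Ω => xinit i) 2 P).toLp _)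
    (gi := fun i => (memLp_const (gradient (f i) (xinit i)) :
      MemLp (fun _ : Ω => gradient (f i) (xinit i)) 2 P).toLp _)
    (si := fun i => (memLp_noise hf hS hg 0 i (X := fun _ => xinit i) measurable_const).toLp _)
    (Hi := fun i => (memLp_const (H₀ i) : MemLp (fun _ : Ω => H₀ i) 2 P).toLp _)
    (fun i => T.x_zero_toLp hf hS hg i (hX 0 i))
    (fun i => MemLp.toLp_congr _ _ (Filter.Eventually.of_forall fun ω => T.h_zero i ω))
    (fun i => norm_noise_sq_le hf hS hg 0 i measurable_const)
    (fun i => norm_toLp_sub_le_mul _ _ _ _ fun ω => hf.lipschitz i _ _)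
    (fun i => by
      rw [mean_toLp (hX 0)]
      exact norm_toLp_sub_le_mul _ _ _ _ fun ω => hf.lipschitz i _ _)
  have hφ0 := T.integral_avgFun_zero_le hf hS hg hn0 hη0 hL.le hηL (hX 0)
  have c1 := nsq_toLp_const_le (P := P) xinit
  have c2 : _ ≤ stackNorm (stackGrad f xinit) ^ 2 := nsq_toLp_const_le (P := P) (stackGrad f xinit)
  have c3 := nsq_toLp_const_le (P := P) H₀
  refine error_le_of_horizon (by exact_mod_cast hn) hR hηR hKR hβ0 hβ1 hL hnR hxR hHR hFR
    (φ₀ := (∫ ω, avgFun f (avg fun i => X 0 i ω) ∂P) - (n : ℝ)⁻¹ * ∑ i, flow i)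
    (by linarith) (hinit.trans ?_) hsum
  gcongr
  exact c2

end IsTrajectory

/-- The error bound for CEDAS past the transient time. -/
theorem meanSqGrad_le (hW : IsMixingMatrix G W) (hn : 2 ≤ n)
    (hf : IsSmoothBddBelow f L flow) (hS : IsSampling P ξ ζ)
    (hg : ∀ t i, IsStochasticGradient (f i) σ (g i) (P.map (ξ t i)))
    (hC : 0 < C) (hQ : ∀ k i, IsUnbiasedCompressor C Q (P.map (ζ k i)))
    (hL : 0 < L) (hα0 : 0 < α) (hα1 : α ≤ 1) (hαC : 12 * (α * C) ≤ 1)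
    (hγ0 : 0 < γ) (hγ : γ ≤ 1 / 2) (hlt : lambdaTwo W hW.symm hn < 1)
    (hβ : β = γ * (1 - lambdaTwo W hW.symm hn) / 2)
    (hγα : 1728 * (γ * (γ * C)) ≤ 2 * (α ^ 2 * β))
    {Δ : ℝ} (hΔ : avgFun f (avg xinit) - (n : ℝ)⁻¹ * ∑ i, flow i ≤ Δ) (K : ℕ)
    (hηK : 64 * n * L ^ 2 / β ^ 2 ≤ K) (hK0 : 0 < K)
    (h1 : (n : ℝ) ^ 3 / (4 * β ^ 2) ≤ K) (h2 : stackNorm xinit ^ 4 / (4 * n * β ^ 2) ≤ K)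
    (h3 : stackNorm H₀ ^ 4 / (4 * n * β ^ 2) ≤ K)
    (h4 : (n * stackNorm (stackGrad f xinit) ^ 4 / (16 * β ^ 4)) ^ ((1 : ℝ) / 3) ≤ K) :
    meanSqGrad P f G W α γ g Q xinit H₀ ξ ζ K
      ≤ ENNReal.ofReal ((4 * (Δ + L ^ 2 + L * σ ^ 2) + 8 * L ^ 2 * (96 + 20 * σ ^ 2)
        + 32 * L ^ 2 * σ ^ 2 + 2 * L * σ ^ 2) / Real.sqrt (n * K)) := by
  obtain ⟨U, lam, l₀, hU⟩ := exists_isSpectralFrame hW hn hlt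
  have hβ0 : 0 < β := by
    rw [hβ]; exact half_pos (mul_pos hγ0 (sub_pos.2 hlt))
  have hβγ : β ≤ γ := by
    obtain ⟨l, hl⟩ : ∃ l : Fin n, l ≠ l₀ := by
      have : Nontrivial (Fin n) := Fin.nontrivial_iff_two_le.2 hn
      exact exists_ne l₀
    rw [hβ]
    exact (hU.le_rate hγ0.le hl).trans (hU.rate_le hγ0.le l)
  have hn' : (2 : ℝ) ≤ n := by exact_mod_cast hn
  have hn0 : (0 : ℝ) < n := by linarith
  have hK' : (0 : ℝ) < K := by exact_mod_cast hK0
  set R := Real.sqrt (n * K) with hRdef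
  set η := Real.sqrt (n / K) with hηdef
  have hR : 0 < R := Real.sqrt_pos.2 (by positivity)
  have hη0 : 0 < η := Real.sqrt_pos.2 (by positivity)
  have hR2 : n * (K : ℝ) = R ^ 2 := (Real.sq_sqrt (by positivity)).symm
  have hη2 : η ^ 2 = n / K := Real.sq_sqrt (by positivity)
  have hηR : η * R = n := by
    rw [hRdef, hηdef, ← Real.sqrt_mul (by positivity)]
    rw [show (n : ℝ) / K * (n * K) = n ^ 2 by field_simp, Real.sqrt_sq hn0.le]
  have hη : 64 * (η ^ 2 * L ^ 2) ≤ β ^ 2 := by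
    rw [div_le_iff₀ (by positivity)] at hηK
    rw [hη2, div_mul_eq_mul_div, mul_div_assoc', div_le_iff₀ hK']
    linarith
  obtain ⟨b1, b2, b3, b4⟩ := bounds_of_horizon hn' hK' hR hηR hR2 hβ0 h1 h2 h3 h4
  have T := hW.isTrajectory (α := α) (γ := γ) (η := η) (g := g) (Q := Q) (xinit := xinit)
    (H₀ := H₀) (ξ := ξ) (ζ := ζ)
  -- The accumulated bounds are stated over `range (M + 1)`.
  obtain ⟨M, rfl⟩ : ∃ M, K = M + 1 := ⟨K - 1, by omega⟩
  have key := T.sum_norm_grad_le_of_horizon hf hS hg hC.le hQ hU hW.stochastic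
    (fun i j => hW.symm.apply j i) hβ hβ0 hβγ hγ0 hγ hη hα0 hα1 hαC hγα hη0 hL hn hΔ M hR hηR
    (by rw [← hR2]; push_cast; ring) b1 b2 b3 b4
  have hX := T.memLp_x hf hS hg hC.le hQ
  have hterm : ∀ t, ∫⁻ ω, ‖gradient (avgFun f) (avg (iterate G W α γ η g Q xinit H₀
      (fun s i => ξ s i ω) (fun s i => ζ s i ω) t).x)‖ₑ ^ 2 ∂P
      = ENNReal.ofReal
        (‖mean fun i => (hf.memLp_gradient i (memLp_avg (hX t))).toLp _‖ ^ 2) := by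
    intro t
    rw [hf.mean_gradient_toLp (memLp_avg (hX t)) (hf.memLp_gradient_avgFun (memLp_avg (hX t))),
      ofReal_norm_toLp_sq]
  rw [meanSqGrad, ← hηdef]
  simp_rw [hterm]
  rw [← ENNReal.ofReal_sum_of_nonneg fun _ _ => sq_nonneg _, ← ENNReal.ofReal_natCast,
    ← ENNReal.ofReal_inv_of_pos hK', ← ENNReal.ofReal_mul (by positivity)]
  refine ENNReal.ofReal_le_ofReal ?_
  rw [inv_mul_le_iff₀ hK']
  refine key.trans (le_of_eq ?_)
  rw [show ((M + 1 : ℕ) : ℝ) = R ^ 2 / n by rw [← hR2]; field_simp]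
  field_simp

/-- Rounding up costs `⌈m⌉ ≤ m + 1 ≤ 2m`, which is the source of the factor two. -/
theorem transientTime_le {admissible : Set ℕ} {err : ℕ → ℝ≥0∞} {c m : ℝ} (hm : 1 ≤ m)
    (h : ∀ K ∈ admissible, m ≤ K → err K ≤ ENNReal.ofReal (c / Real.sqrt (n * K))) :
    transientTime n admissible err c ≤ ENNReal.ofReal (2 * m) := by
  refine (iInf₂_le ⌈m⌉₊ fun K hK hadm => h K hadm (Nat.ceil_le.1 hK)).trans ?_
  rw [← ENNReal.ofReal_natCast]
  refine ENNReal.ofReal_le_ofReal ?_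
  have := Nat.ceil_lt_add_one (show 0 ≤ m by linarith)
  linarith

end Main

end CEDAS

theorem theorem5 (L σ Δ : ℝ) (hL : 0 < L) (hσ : 0 < σ) :
    ∃ c > (0 : ℝ), ∃ c' > (0 : ℝ),
      ∀ (n p q : ℕ) (hn : 2 ≤ n)
        -- the network
        (G : SimpleGraph (Fin n)) (W : Matrix (Fin n) (Fin n) ℝ)
        (hW : CEDAS.IsMixingMatrix G W)
        -- the objective functions
        (f : Fin n → CEDAS.Vec p → ℝ) (flow : Fin n → ℝ),
        CEDAS.IsSmoothBddBelow f L flow →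
      ∀ -- the randomness: gradient samples and compression seeds
        (Ω : Type*) [MeasurableSpace Ω] (P : Measure Ω) [IsProbabilityMeasure P]
        (Z : Type*) [MeasurableSpace Z]
        (ξ : ℕ → Fin n → Ω → CEDAS.Vec q) (ζ : ℕ → Fin n → Ω → Z),
        CEDAS.IsSampling P ξ ζ →
      ∀ -- the stochastic gradients and the compression operator
        (g : Fin n → CEDAS.Vec p → CEDAS.Vec q → CEDAS.Vec p)
        (C : ℝ) (Q : CEDAS.Vec p → Z → CEDAS.Vec p),
        (∀ t i, CEDAS.IsStochasticGradient (f i) σ (g i) (P.map (ξ t i))) →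
        0 < C →
        (∀ k i, CEDAS.IsUnbiasedCompressor C Q (P.map (ζ k i))) →
      ∀ -- the parameters and the initial values
        (α γ : ℝ) (xinit H₀ : CEDAS.Stack n p),
        0 < α → α ≤ 1 → α ≤ 1 / (12 * C) →
        0 < γ →
        γ ≤ min (Real.sqrt α / (2 * Real.sqrt C))
          (min (1 / 2) (α ^ 2 * (1 - CEDAS.lambdaTwo W hW.symm hn) / (1728 * C))) →
        CEDAS.avgFun f (CEDAS.avg xinit) - (n : ℝ)⁻¹ * ∑ i, flow i ≤ Δ →
        CEDAS.transientTime n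
            {K : ℕ | max (12 * L ^ 2 * n / α)
              (256 * n * L ^ 2 / (γ ^ 2 * (1 - CEDAS.lambdaTwo W hW.symm hn) ^ 2)) ≤ (K : ℝ)}
            (CEDAS.meanSqGrad P f G W α γ g Q xinit H₀ ξ ζ) c
          ≤ ENNReal.ofReal (c' *
              max ((n : ℝ) ^ 3 / (γ ^ 2 * (1 - CEDAS.lambdaTwo W hW.symm hn) ^ 2))
                (max (CEDAS.stackNorm xinit ^ 4 /
                    (n * γ ^ 2 * (1 - CEDAS.lambdaTwo W hW.symm hn) ^ 2))
                  (max (CEDAS.stackNorm H₀ ^ 4 /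
                      (n * γ ^ 2 * (1 - CEDAS.lambdaTwo W hW.symm hn) ^ 2))
                    ((n * CEDAS.stackNorm (CEDAS.stackGrad f xinit) ^ 4 /
                      (γ ^ 4 * (1 - CEDAS.lambdaTwo W hW.symm hn) ^ 4)) ^ ((1 : ℝ) / 3))))) := by
  -- The absolute value keeps the constant positive when `Δ` is negative; the witness `2` pays for
  -- rounding the horizon to an integer.
  refine ⟨4 * (|Δ| + L ^ 2 + L * σ ^ 2) + 8 * L ^ 2 * (96 + 20 * σ ^ 2) + 32 * L ^ 2 * σ ^ 2
    + 2 * L * σ ^ 2, by positivity, 2, by norm_num, ?_⟩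
  intro n p q hn G W hW f flow hf Ω _ P _ Z _ ξ ζ hS g C Q hg hC hQ α γ xinit H₀ hα0 hα1 hαC hγ0 hγ
    hΔ
  have hn' : (2 : ℝ) ≤ n := by exact_mod_cast hn
  have hn0 : (0 : ℝ) < n := by linarith
  obtain ⟨-, hγ2⟩ := le_min_iff.1 hγ
  obtain ⟨hγ1, hγ3⟩ := le_min_iff.1 hγ2
  rw [le_div_iff₀ (by positivity)] at hγ3 hαC
  set l := CEDAS.lambdaTwo W hW.symm hn with hl
  -- The spectral gap is positive because a positive `γ` lies below a positive multiple of `1 - λ₂`.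
  have hlt : l < 1 := by
    have h1 : 0 < α ^ 2 * (1 - l) := lt_of_lt_of_le (by positivity) hγ3
    exact sub_pos.1 (pos_of_mul_pos_right h1 (sq_nonneg α))
  set β := γ * (1 - l) / 2 with hβ
  have hβ0 : 0 < β := half_pos (mul_pos hγ0 (sub_pos.2 hlt))
  have e1 : γ ^ 2 * (1 - l) ^ 2 = 4 * β ^ 2 := by rw [hβ]; ring
  have e2 : γ ^ 4 * (1 - l) ^ 4 = 16 * β ^ 4 := by rw [hβ]; ring
  have e3 : ∀ a : ℝ, a * γ ^ 2 * (1 - l) ^ 2 = 4 * a * β ^ 2 := fun a => by rw [hβ]; ring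
  have hγα : 1728 * (γ * (γ * C)) ≤ 2 * (α ^ 2 * β) := by
    have := mul_le_mul_of_nonneg_left hγ3 hγ0.le
    rw [hβ]; linarith
  have hl1 : -1 ≤ l := by
    obtain ⟨U, lam, l₀, hU⟩ := CEDAS.exists_isSpectralFrame hW hn hlt
    have : Nontrivial (Fin n) := Fin.nontrivial_iff_two_le.2 hn
    obtain ⟨m, hm⟩ := exists_ne l₀
    exact (hU.ge m).trans (hU.le m hm)
  have hβ1 : β ≤ 1 / 2 := by rw [hβ]; nlinarith
  rw [e1, e2, e3]
  refine CEDAS.transientTime_le (le_max_of_le_left ?_) fun K hadm hK => ?_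
  -- From `n ≥ 2` and `β ≤ 1/2`, the first entry of the maximum is at least `8`, more than the
  -- required `1`.
  · rw [le_div_iff₀ (by positivity)]
    have h1 : β ^ 2 ≤ (1 / 2) ^ 2 := by gcongr
    have h2 : (2 : ℝ) ^ 3 ≤ (n : ℝ) ^ 3 := by gcongr
    linarith
  · obtain ⟨k1, k2⟩ := max_le_iff.1 hK
    obtain ⟨k2, k3⟩ := max_le_iff.1 k2
    obtain ⟨k3, k4⟩ := max_le_iff.1 k3
    rw [Set.mem_ofPred_eq, max_le_iff] at hadm
    obtain ⟨a1, a2⟩ := hadm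
    have hK0 : (0 : ℝ) < K := lt_of_lt_of_le (by positivity) a1
    refine CEDAS.meanSqGrad_le hW hn hf hS hg hC hQ hL hα0 hα1 (by linarith) hγ0 hγ1 hlt hβ hγα
      (hΔ.trans (le_abs_self Δ)) K ?_ (by exact_mod_cast hK0) k1 k2 k3 k4
    -- As `γ²(1 - λ₂)² = 4β²`, the admissibility constant `256` becomes the `64` of the stepsize
    -- condition.
    refine le_trans (le_of_eq ?_) a2
    field_simp
    ring
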